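/- **The group.** Let $G=\mathbb Z\times(\mathbb R\rtimes\mathbb Z_2)$ with multiplication $(x,a,n)(y,b,m)=(x+y,\,a+(-1)^n b,\,n+m)$, with its product metric ($\mathbb Z_2$ discrete) and a Haar measure $\lambda$ (counting $\times$ Lebesgue $\times$ counting, up to scaling). Its center is $\mathbb Z\times\{0\}\times\{0\}$. For a positive integer $a$ write $\mathrm{Box}(a)=\{(x,t,m)\in G: -a<x\le a,\ -a<t\le a\}$. For a non-empty finite set $D$ let $\kappa_D$ be the uniform probability on $D$, and let $\|\cdot\|_1$ be the $\ell^1$-norm of signed measures on a finite set. **The sequences.** Let $(r_n)_{n\ge0}$ be a non-decreasing sequence of positive integers with $n^4/r_n\to0$. Put $\tilde a_0=1$ and, for $n\ge1$, $a_n=(2r_{n-1}+1)\tilde a_{n-1}$, $b_n=(2n-1)\tilde a_{n-1}$, $\tilde a_n=a_n+b_n+n$. For $n\ge 1$ let $F_n=\mathrm{Box}(a_n)$, $S_n=\mathrm{Box}(b_n)$, $H_n=\{-r_n,\dots,r_n\}^2$ and $\phi_n(i,j)=(2i\tilde a_n,2j\tilde a_n,0)$. Suppose that for every $n\ge1$ we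 are given * a finite partition $\xi_n$ of $F_n$ into non-empty Borel sets of diameter less than $1/n$; * a finite set $D_n\subset S_n$ such that, for all unions $A,B$ of atoms of $\xi_n$ and all $g,h\in F_n$ with $AgS_n\subset F_n$ and $BhS_n\subset F_n$, $$\Big|\int f_{Ag,Bh}\,d\kappa_{D_n}d\kappa_{D_n}-\frac1{\lambda(S_n)^2}\int_{S_n\times S_n}f_{Ag,Bh}\,d\lambda\,d\lambda\Big|<\frac1n,\qquad f_{A',B'}(x,y)=\frac{\lambda(A'x\cap B'y)}{\lambda(F_n)};$$ * a map $s_n:H_n\to D_n$ such that, for every integer $N>r_n/n^2$ and all $h\ne h'$ in $H_n\cap(H_n-(N-1,0))$, the distribution $\nu$ of $\big(s_n(h+(t,0)),s_n(h'+(t,0))\big)$, with $t$ uniform in $\{0,\dots,N-1\}$, satisfies $\|\nu-\kappa_{D_n}\times\kappa_{D_n}\|_1<1/n$. Put $c_{n+1}(h)=s_n(h)\phi_n(h)$ for $h\in H_n$ and $C_{n+1}=c_{n+1}(H_n)$, $n\ge1$, and suppose that $Ac$ is a union of atoms of $\xi_{n+1}$ whenever $A\in\xi_n$, $c\in C_{n+1}$,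 $n\ge1$. **The action.** For $n\ge1$ let $X_n=F_n\times\prod_{k>n}C_k$, with the product of the measure $(|C_2|\cdots|C_n|)^{-1}\lambda|_{F_n}$ and the uniform probabilities on the $C_k$. Embed $X_n$ into $X_{n+1}$ by $(f_n,c_{n+1},c_{n+2},\dots)\mapsto(f_nc_{n+1},c_{n+2},\dots)$, and let $(X,\mathfrak B,\mu)$ be the inductive limit of the measure spaces $X_n$, with $\lambda$ scaled so that $\mu(X)=1$. For each $g\in G$ one has $gF_nC_{n+1}\subset F_{n+1}$ for all large $n$, and for such $n$ the $(C,F)$-action $T=(T_g)_{g\in G}$ is given on $X_n$ by $T_g(f_n,c_{n+1},c_{n+2},\dots)=(gf_nc_{n+1},c_{n+2},\dots)\in X_{n+1}$. **Proposition.** For all such choices, $(X,\mathfrak B,\mu)$ is a probability space, $T$ is a $\mu$-preserving action of $G$, and the transformation $T_{(1,0,0)}$ is mixing: $\mu(T_{(1,0,0)}^{-n}A\cap B)\to\mu(A)\mu(B)$ for all $A,B\in\mathfrak B$. More generally, $\mu(T_{g_n}A\cap B)\to\mu(A)\mu(B)$ for all $A,B\in\mathfrak B$ and every sequence $g_n\to\infty$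 in the center $\mathbb Z\times\{0\}\times\{0\}$. -/

import Mathlib

open MeasureTheory Filter Topology
open scoped Pointwise

/-! ## The general `(C, F)`-construction -/

/-- The data of a `(C, F)`-construction in a group `G`: sets `F n` (`n ≥ 0`) and finite sets `C n`
(`n ≥ 1`; the value `C 0` is never used). -/
structure CFSequence (G : Type*) [Group G] where
  F : ℕ → Set G
  C : ℕ → Finset G
  one_lt_card : ∀ n, 1 < (C (n + 1)).card
  mul_mem : ∀ n, ∀ f ∈ F n, ∀ c ∈ C (n + 1), f * c ∈ F (n + 1)
  disjoint : ∀ n, ∀ c ∈ C (n + 1), ∀ c' ∈ C (n + 1), c ≠ c' →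
    Disjoint (F n * {c}) (F n * {c'})
  gap : ∀ g : G, ∃ m, ∀ n, m ≤ n → ∀ f ∈ F n, ∀ c ∈ C (n + 1), g * f * c ∈ F (n + 1)

namespace CFSequence

variable {G : Type*} [Group G] (P : CFSequence G)

/-- `X_n = F_n × ∏_{k > n} C_k`. -/
abbrev Level (n : ℕ) : Type _ := P.F n × ((k : {k : ℕ // n < k}) → P.C k.1)

/-- The embedding `X_n → X_{n+1}`,
`(f_n, c_{n+1}, c_{n+2}, …) ↦ (f_n c_{n+1}, c_{n+2}, …)`. -/
def embed {n : ℕ} (x : P.Level n) : P.Level (n + 1) :=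
  (⟨x.1.1 * (x.2 ⟨n + 1, n.lt_succ_self⟩).1,
      P.mul_mem n _ x.1.2 _ (x.2 ⟨n + 1, n.lt_succ_self⟩).2⟩,
    fun k => x.2 ⟨k.1, n.lt_succ_self.trans k.2⟩)

/-- The embedding, on the disjoint union of all `X_n`. -/
def up (p : Σ n, P.Level n) : Σ n, P.Level n := ⟨p.1 + 1, P.embed p.2⟩

/-- `X`, the inductive limit (increasing union) of `X_0 → X_1 → ⋯`: the disjoint union of the `X_n`
in which every point is identified with its image under the embedding. -/
def Space : Type _ := Quot (fun p q : Σ n, P.Level n => q = P.up p)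

/-- The map `X_n → X`. -/
def incl (n : ℕ) (x : P.Level n) : P.Space := Quot.mk _ ⟨n, x⟩

/-- The σ-algebra of the inductive limit: a set is measurable if and only if its trace on every
`X_n` is measurable. -/
instance [MeasurableSpace G] : MeasurableSpace P.Space :=
  inferInstanceAs (MeasurableSpace (Quot _))

/-- The measure on `X_n`: the product of `(|C_1| ⋯ |C_n|)⁻¹ λ` on `F_n` and of the uniform
distributions on the `C_k`, `k > n`. -/
noncomputable def levelMeasure [MeasurableSpace G] (haar : Measure G) (n : ℕ) :
    Measure (P.Level n) :=
  (((∏ k ∈ Finset.Icc 1 n, ((P.C k).card : ENNReal))⁻¹ • haar.comap Subtype.val).prod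
    (Measure.infinitePi fun k : {k : ℕ // n < k} =>
      ProbabilityTheory.uniformOn (Set.univ : Set (P.C k.1))))

/-- The inductive limit of the measures on the `X_n` (an increasing limit of measures on `X`). -/
noncomputable def limitMeasure [MeasurableSpace G] (haar : Measure G) : Measure P.Space :=
  ⨆ n, (P.levelMeasure haar n).map (P.incl n)

/-- The measure `μ` on `X`, for the normalization of the Haar measure that makes `X` have
mass one. -/
noncomputable def μ [MeasurableSpace G] (haar : Measure G) : Measure P.Space :=
  (P.limitMeasure haar Set.univ)⁻¹ • P.limitMeasure haar

theorem incl_embed {n : ℕ} (x : P.Level n) : P.incl (n + 1) (P.embed x) = P.incl n x :=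
  (Quot.sound (r := fun p q : Σ n, P.Level n => q = P.up p) (a := ⟨n, x⟩) rfl).symm

theorem up_iterate_fst (k : ℕ) (p : Σ n, P.Level n) : (P.up^[k] p).1 = p.1 + k := by
  induction k generalizing p with
  | zero => rfl
  | succ k ih => rw [Function.iterate_succ_apply, ih]; simp only [up]; omega

theorem incl_up_iterate (k : ℕ) (p : Σ n, P.Level n) :
    P.incl (P.up^[k] p).1 (P.up^[k] p).2 = P.incl p.1 p.2 := by
  induction k generalizing p with
  | zero => rfl
  | succ k ih =>
    rw [Function.iterate_succ_apply, ih]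
    exact P.incl_embed p.2

theorem exists_rep (N : ℕ) (x : P.Space) : ∃ n, N ≤ n ∧ ∃ y : P.Level n, P.incl n y = x := by
  induction x using Quot.ind with
  | mk p =>
    refine ⟨(P.up^[N] p).1, ?_, (P.up^[N] p).2, P.incl_up_iterate N p⟩
    rw [up_iterate_fst]; omega

open Classical in
/-- The first level from which on `g F_n C_{n+1} ⊆ F_{n+1}`. -/
noncomputable def gapIndex (g : G) : ℕ := Nat.find (P.gap g)

open Classical in
theorem gapIndex_spec (g : G) {n : ℕ} (hn : P.gapIndex g ≤ n) :
    ∀ f ∈ P.F n, ∀ c ∈ P.C (n + 1), g * f * c ∈ P.F (n + 1) :=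
  Nat.find_spec (P.gap g) n hn

/-- `(f_n, c_{n+1}, c_{n+2}, …) ↦ (g f_n c_{n+1}, c_{n+2}, …)`, from `X_n` to `X_{n+1}`. -/
def step (g : G) {n : ℕ} (hn : ∀ f ∈ P.F n, ∀ c ∈ P.C (n + 1), g * f * c ∈ P.F (n + 1))
    (x : P.Level n) : P.Level (n + 1) :=
  (⟨g * x.1.1 * (x.2 ⟨n + 1, n.lt_succ_self⟩).1,
      hn _ x.1.2 _ (x.2 ⟨n + 1, n.lt_succ_self⟩).2⟩,
    fun k => x.2 ⟨k.1, n.lt_succ_self.trans k.2⟩)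

theorem step_embed (g : G) {n : ℕ}
    (hn : ∀ f ∈ P.F n, ∀ c ∈ P.C (n + 1), g * f * c ∈ P.F (n + 1))
    (hn' : ∀ f ∈ P.F (n + 1), ∀ c ∈ P.C (n + 1 + 1), g * f * c ∈ P.F (n + 1 + 1))
    (x : P.Level n) : P.step g hn' (P.embed x) = P.embed (P.step g hn x) := by
  simp [step, embed, mul_assoc]

/-- `T_g` on a point of some `X_n`: the point is first moved up to a level at which
`g F_n C_{n+1} ⊆ F_{n+1}` is guaranteed. -/
noncomputable def preAct (g : G) (p : Σ n, P.Level n) : P.Space :=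
  P.incl _ (P.step g (n := (P.up^[P.gapIndex g - p.1] p).1)
    (P.gapIndex_spec g (by rw [up_iterate_fst]; omega)) (P.up^[P.gapIndex g - p.1] p).2)

theorem preAct_of_le (g : G) {n : ℕ} (hn : P.gapIndex g ≤ n) (x : P.Level n) :
    P.preAct g ⟨n, x⟩ = P.incl (n + 1) (P.step g (P.gapIndex_spec g hn) x) := by
  have h : P.gapIndex g - n = 0 := by omega
  have key : ∀ (k : ℕ) (hk : k = 0)
      (hh : ∀ f ∈ P.F (P.up^[k] ⟨n, x⟩).1, ∀ c ∈ P.C ((P.up^[k] ⟨n, x⟩).1 + 1),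
        g * f * c ∈ P.F ((P.up^[k] ⟨n, x⟩).1 + 1)),
      P.incl _ (P.step g hh (P.up^[k] ⟨n, x⟩).2)
        = P.incl (n + 1) (P.step g (P.gapIndex_spec g hn) x) := by
    rintro k rfl hh; rfl
  exact key _ h _

theorem preAct_up (g : G) (p : Σ n, P.Level n) : P.preAct g p = P.preAct g (P.up p) := by
  obtain ⟨n, x⟩ := p
  by_cases hn : P.gapIndex g ≤ n
  · have hn' : P.gapIndex g ≤ n + 1 := by omega
    rw [P.preAct_of_le g hn]
    change _ = P.preAct g ⟨n + 1, P.embed x⟩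
    rw [P.preAct_of_le g hn', P.step_embed g (P.gapIndex_spec g hn), incl_embed]
  · have key : ∀ (q q' : Σ n, P.Level n) (_ : q = q')
        (h : P.gapIndex g ≤ q.1) (h' : P.gapIndex g ≤ q'.1),
        P.incl _ (P.step g (P.gapIndex_spec g h) q.2)
          = P.incl _ (P.step g (P.gapIndex_spec g h') q'.2) := by
      rintro q _ rfl h h'; rfl
    refine key _ _ ?_ (by rw [up_iterate_fst]; omega) (by rw [up_iterate_fst]; omega)
    rw [← Function.iterate_succ_apply]
    congr 2
    simp only [up]; omega

/-- The transformation `T_g` of `X`. -/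
noncomputable def T (g : G) : P.Space → P.Space :=
  Quot.lift (P.preAct g) (by rintro p _ rfl; exact P.preAct_up g p)

/-- The defining formula of `T_g`. -/
theorem T_incl (g : G) {n : ℕ} (hn : P.gapIndex g ≤ n) (x : P.Level n) :
    P.T g (P.incl n x) = P.incl (n + 1) (P.step g (P.gapIndex_spec g hn) x) :=
  P.preAct_of_le g hn x

theorem T_one (x : P.Space) : P.T 1 x = x := by
  obtain ⟨n, hn, y, rfl⟩ := P.exists_rep (P.gapIndex 1) x
  rw [P.T_incl 1 hn, ← P.incl_embed y]
  simp [step, embed]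

theorem T_mul (g h : G) (x : P.Space) : P.T (g * h) x = P.T g (P.T h x) := by
  obtain ⟨n, hn, y, rfl⟩ := P.exists_rep (P.gapIndex g + P.gapIndex h + P.gapIndex (g * h)) x
  rw [P.T_incl h (by omega), P.T_incl g (by omega), P.T_incl (g * h) (by omega), ← P.incl_embed]
  simp [step, embed, mul_assoc]

/-- The `(C, F)`-action `T = (T_g)_{g ∈ G}` on `X`. -/
noncomputable instance : MulAction G P.Space where
  smul g x := P.T g x
  one_smul := P.T_one
  mul_smul := P.T_mul

end CFSequence

/-! ## The group `G = ℤ × (ℝ ⋊ ℤ₂)` -/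

/-- Elements `(k, t, e)` of `ℤ × (ℝ ⋊ ℤ₂)`. -/
@[ext]
structure GG where
  k : ℤ
  t : ℝ
  e : ZMod 2

namespace GG

/-- `(-1)^e`, for `e ∈ ℤ₂`. -/
def sgn (e : ZMod 2) : ℝ := (-1) ^ e.val

theorem sgn_zero : sgn 0 = 1 := by simp [sgn]

theorem sgn_one : sgn 1 = -1 := by simp [sgn, ZMod.val_one]

theorem zmod_cases (e : ZMod 2) : e = 0 ∨ e = 1 := by
  revert e; decide

theorem sgn_cases (e : ZMod 2) : sgn e = 1 ∨ sgn e = -1 := by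
  rcases zmod_cases e with rfl | rfl
  · exact Or.inl sgn_zero
  · exact Or.inr sgn_one

theorem sgn_add (e e' : ZMod 2) : sgn (e + e') = sgn e * sgn e' := by
  rcases zmod_cases e with rfl | rfl <;> rcases zmod_cases e' with rfl | rfl
  · simp [sgn_zero]
  · simp [sgn_zero]
  · simp [sgn_zero]
  · have : (1 + 1 : ZMod 2) = 0 := by decide
    rw [this, sgn_zero, sgn_one]; norm_num

instance : Mul GG := ⟨fun p q => ⟨p.k + q.k, p.t + sgn p.e * q.t, p.e + q.e⟩⟩
instance : One GG := ⟨⟨0, 0, 0⟩⟩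
instance : Inv GG := ⟨fun p => ⟨-p.k, -(sgn p.e * p.t), -p.e⟩⟩

theorem mul_def (p q : GG) : p * q = ⟨p.k + q.k, p.t + sgn p.e * q.t, p.e + q.e⟩ := rfl
theorem one_def : (1 : GG) = ⟨0, 0, 0⟩ := rfl
theorem inv_def (p : GG) : p⁻¹ = ⟨-p.k, -(sgn p.e * p.t), -p.e⟩ := rfl

instance : Group GG :=
  Group.ofLeftAxioms
    (by
      intro p q r
      ext
      · simp only [mul_def]; ring
      · simp only [mul_def, sgn_add]; ring
      · simp only [mul_def]; ring)
    (by intro p; ext <;> simp [mul_def, one_def, sgn_zero])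
    (by
      intro p
      have h : -p.e = p.e := ZMod.neg_eq_self_mod_two p.e
      ext
      · simp [mul_def, one_def, inv_def]
      · simp [mul_def, one_def, inv_def, h]
      · simp only [mul_def, one_def, inv_def]; ring)

/-- `G` as the set `ℤ × ℝ × ℤ₂`. -/
def equivProd : GG ≃ ℤ × ℝ × ZMod 2 where
  toFun p := (p.k, p.t, p.e)
  invFun p := ⟨p.1, p.2.1, p.2.2⟩
  left_inv _ := rfl
  right_inv _ := rfl

/-- The Borel σ-algebra. -/
instance : MeasurableSpace GG := MeasurableSpace.comap equivProd inferInstance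

/-- A Haar measure `λ` on `G`: (counting measure) × (Lebesgue measure) × (counting measure). -/
noncomputable def haar : Measure GG :=
  ((Measure.count : Measure ℤ).prod
    ((volume : Measure ℝ).prod (Measure.count : Measure (ZMod 2)))).map equivProd.symm

/-- The product metric on `ℤ × ℝ × ℤ₂`, with `ℤ₂` discrete. -/
noncomputable def distance (p q : GG) : ℝ :=
  max (max |(p.k : ℝ) - q.k| |p.t - q.t|) (if p.e = q.e then 0 else 1)

/-- The central element `(x, 0, 0)`. -/
def z (x : ℤ) : GG := ⟨x, 0, 0⟩

/-- The set `(-a, a]_ℤ × (-a, a]_ℝ × ℤ₂`. -/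
def box (a : ℕ) : Set GG :=
  {p | -(a : ℤ) < p.k ∧ p.k ≤ a ∧ -(a : ℝ) < p.t ∧ p.t ≤ a}

end GG

/-! ## The sequences of the construction

Below, `r : ℕ → ℕ` is the sequence `(r_n)` and `s n` is the map `s_n : H_n → G`, given as a function
on `ℤ²` of which only the values on `H_n` matter. -/

namespace Cstr

open GG

/-- `ã_0 = 1`, `ã_{n+1} = a_{n+1} + b_{n+1} + (n + 1)`, where `a_{n+1} = (2 r_n + 1) ã_n` and
`b_{n+1} = (2 (n + 1) - 1) ã_n`. -/
def aTilde (r : ℕ → ℕ) : ℕ → ℕ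
  | 0 => 1
  | n + 1 => (2 * r n + 1) * aTilde r n + (2 * n + 1) * aTilde r n + (n + 1)

/-- `a_{n+1} = (2 r_n + 1) ã_n` (and `a_0` is not used). -/
def a (r : ℕ → ℕ) : ℕ → ℕ
  | 0 => 0
  | n + 1 => (2 * r n + 1) * aTilde r n

/-- `b_{n+1} = (2 (n + 1) - 1) ã_n` (and `b_0` is not used). -/
def b (r : ℕ → ℕ) : ℕ → ℕ
  | 0 => 0
  | n + 1 => (2 * n + 1) * aTilde r n

/-- `F_n`, for `n ≥ 1`. -/
def F (r : ℕ → ℕ) (n : ℕ) : Set GG := box (a r n)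

/-- `S_n`, for `n ≥ 1`. -/
def S (r : ℕ → ℕ) (n : ℕ) : Set GG := box (b r n)

/-- `H_n = {-r_n, …, r_n}²`. -/
noncomputable def H (r : ℕ → ℕ) (n : ℕ) : Finset (ℤ × ℤ) :=
  Finset.Icc (-(r n : ℤ)) (r n) ×ˢ Finset.Icc (-(r n : ℤ)) (r n)

/-- `φ_n(i, j) = (2 i ã_n, 2 j ã_n, 0)`. -/
def phi (r : ℕ → ℕ) (n : ℕ) (h : ℤ × ℤ) : GG :=
  ⟨2 * h.1 * aTilde r n, 2 * h.2 * aTilde r n, 0⟩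

open Classical in
/-- `C_{n+1} = c_{n+1}(H_n)`, where `c_{n+1}(h) = s_n(h) φ_n(h)`. -/
noncomputable def Csucc (r : ℕ → ℕ) (s : ℕ → ℤ × ℤ → GG) (n : ℕ) : Finset GG :=
  (H r n).image fun h => s n h * phi r n h

/-- `E` is measurable with respect to the partition `ξ`: it is a union of atoms. -/
def IsUnionOfAtoms (ξ : Set (Set GG)) (E : Set GG) : Prop := ∃ 𝒜 ⊆ ξ, E = ⋃₀ 𝒜

/-- `f_{A,B}(x, y) = λ(Ax ∩ By) / λ(F_n)`. -/
noncomputable def overlap (r : ℕ → ℕ) (n : ℕ) (A B : Set GG) (x y : GG) : ℝ :=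
  haar.real (A * {x} ∩ B * {y}) / haar.real (F r n)

/-- The finite set `D ⊆ S_n` discretizes Haar measure on `S_n`, up to `1/n`, for the partition
`ξ` of `F_n`. -/
def Discretizes (r : ℕ → ℕ) (n : ℕ) (ξ : Set (Set GG)) (D : Finset GG) : Prop :=
  ∀ A B : Set GG, IsUnionOfAtoms ξ A → IsUnionOfAtoms ξ B →
    ∀ g ∈ F r n, ∀ h ∈ F r n, A * {g} * S r n ⊆ F r n → B * {h} * S r n ⊆ F r n →
      |(1 / (D.card : ℝ) ^ 2) * ∑ x ∈ D, ∑ y ∈ D, overlap r n (A * {g}) (B * {h}) x y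
        - (1 / haar.real (S r n) ^ 2) *
          ∫ p in S r n ×ˢ S r n, overlap r n (A * {g}) (B * {h}) p.1 p.2 ∂(haar.prod haar)|
        < (1 : ℝ) / n

open Classical in
/-- The `ℓ¹`-distance between the distribution of `(σ(h + (t, 0)), σ(h' + (t, 0)))`, for `t` uniform
in `{0, …, N - 1}`, and the uniform distribution on `D × D`. -/
noncomputable def pairDiscrepancy (D : Finset GG) (σ : ℤ × ℤ → GG) (N : ℕ) (h h' : ℤ × ℤ) : ℝ :=
  ∑ d ∈ D ×ˢ D,
    |((((Finset.range N).filter fun t : ℕ =>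
        (σ (h + ((t : ℤ), 0)), σ (h' + ((t : ℤ), 0))) = d).card : ℕ) : ℝ) / N
      - 1 / (D.card : ℝ) ^ 2|

end Cstr

open GG Cstr in
/-- All the choices made in the construction: the numbers `r_n`, the partitions `ξ_n` of `F_n`, the
finite sets `D_n ⊆ S_n` and the maps `s_n : H_n → D_n`. (Values at `n = 0` of `ξ`, `D`, `s` are
not used.) -/
structure Construction where
  r : ℕ → ℕ
  r_pos : ∀ n, 0 < r n
  r_mono : Monotone r
  r_growth : Tendsto (fun n : ℕ => (n : ℝ) ^ 4 / r n) atTop (𝓝 0)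
  s : ℕ → ℤ × ℤ → GG
  ξ : ℕ → Set (Set GG)
  ξ_finite : ∀ n, 1 ≤ n → (ξ n).Finite
  ξ_measurable : ∀ n, 1 ≤ n → ∀ A ∈ ξ n, MeasurableSet A
  ξ_nonempty : ∀ n, 1 ≤ n → ∀ A ∈ ξ n, A.Nonempty
  ξ_disjoint : ∀ n, 1 ≤ n → (ξ n).PairwiseDisjoint id
  ξ_cover : ∀ n, 1 ≤ n → ⋃₀ (ξ n) = F r n
  ξ_diam : ∀ n, 1 ≤ n → ∀ A ∈ ξ n,
    ∃ δ : ℝ, δ < (1 : ℝ) / n ∧ ∀ p ∈ A, ∀ q ∈ A, distance p q ≤ δ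
  ξ_refine : ∀ n, 1 ≤ n → ∀ A ∈ ξ n, ∀ c ∈ Csucc r s n, IsUnionOfAtoms (ξ (n + 1)) (A * {c})
  D : ℕ → Finset GG
  D_subset : ∀ n, 1 ≤ n → (D n : Set GG) ⊆ S r n
  D_discretizes : ∀ n, 1 ≤ n → Discretizes r n (ξ n) (D n)
  s_mem : ∀ n, 1 ≤ n → ∀ h ∈ H r n, s n h ∈ D n
  s_equidistributed : ∀ n, 1 ≤ n → ∀ N : ℕ, (r n : ℝ) / (n : ℝ) ^ 2 < N →
    ∀ h ∈ H r n, ∀ h' ∈ H r n, h ≠ h' →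
      h + ((N : ℤ) - 1, 0) ∈ H r n → h' + ((N : ℤ) - 1, 0) ∈ H r n →
      pairDiscrepancy (D n) (s n) N h h' < (1 : ℝ) / n

namespace Construction

open GG Cstr

variable (K : Construction)

theorem aTilde_succ (r : ℕ → ℕ) (n : ℕ) :
    aTilde r (n + 1) = a r (n + 1) + b r (n + 1) + (n + 1) := rfl

theorem aTilde_pos (r : ℕ → ℕ) (n : ℕ) : 0 < aTilde r n := by
  cases n with
  | zero => simp [aTilde]
  | succ n => rw [aTilde_succ]; omega

/-- For small `g`, the set `g F_n S_n` stays in the window `F̃_n`. -/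
theorem mem_window {r : ℕ → ℕ} {n : ℕ} {g f σ : GG} (hk : |g.k| ≤ n) (ht : |g.t| < n)
    (hn : 1 ≤ n) (hf : f ∈ F r n) (hσ : σ ∈ S r n) :
    g * f * σ ∈ box (aTilde r n) := by
  obtain ⟨m, rfl⟩ : ∃ m, n = m + 1 := ⟨n - 1, by omega⟩
  obtain ⟨f1, f2, f3, f4⟩ := hf
  obtain ⟨s1, s2, s3, s4⟩ := hσ
  have hA := aTilde_succ r m
  have hA' : (aTilde r (m + 1) : ℝ) = a r (m + 1) + b r (m + 1) + ((m + 1 : ℕ) : ℝ) := by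
    rw [hA]; push_cast; ring
  rw [abs_le] at hk
  rw [abs_lt] at ht
  refine ⟨?_, ?_, ?_, ?_⟩
  · simp only [mul_def]; omega
  · simp only [mul_def]; omega
  · simp only [mul_def]; rw [hA']
    rcases sgn_cases g.e with h | h <;> rcases sgn_cases (g.e + f.e) with h' | h' <;>
      rw [h, h'] <;> linarith
  · simp only [mul_def]; rw [hA']
    rcases sgn_cases g.e with h | h <;> rcases sgn_cases (g.e + f.e) with h' | h' <;>
      rw [h, h'] <;> linarith

/-- The window `F̃_n φ_n(h)`, `h ∈ H_n`, lies in `F_{n+1}`. -/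
theorem window_mul_phi_mem {r : ℕ → ℕ} {n : ℕ} {w : GG} {h : ℤ × ℤ}
    (hw : w ∈ box (aTilde r n)) (hh : h ∈ H r n) : w * phi r n h ∈ F r (n + 1) := by
  obtain ⟨w1, w2, w3, w4⟩ := hw
  simp only [H, Finset.mem_product, Finset.mem_Icc] at hh
  obtain ⟨⟨i1, i2⟩, j1, j2⟩ := hh
  have hA : (0 : ℤ) ≤ aTilde r n := Int.natCast_nonneg _
  have hA' : (0 : ℝ) ≤ aTilde r n := Nat.cast_nonneg _
  have e1 : ((a r (n + 1) : ℕ) : ℤ) = (2 * r n + 1) * aTilde r n := by simp [a]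
  have e2 : ((a r (n + 1) : ℕ) : ℝ) = (2 * r n + 1) * aTilde r n := by simp [a]
  have j1' : -(r n : ℝ) ≤ h.2 := by exact_mod_cast j1
  have j2' : (h.2 : ℝ) ≤ r n := by exact_mod_cast j2
  have p1 := mul_le_mul_of_nonneg_right i1 hA
  have p2 := mul_le_mul_of_nonneg_right i2 hA
  have q1 := mul_le_mul_of_nonneg_right j1' hA'
  have q2 := mul_le_mul_of_nonneg_right j2' hA'
  refine ⟨?_, ?_, ?_, ?_⟩
  · rw [e1]; simp only [mul_def, phi]; linarith
  · rw [e1]; simp only [mul_def, phi]; linarith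
  · rw [e2]; simp only [mul_def, phi]
    rcases sgn_cases w.e with h' | h' <;> rw [h'] <;> linarith
  · rw [e2]; simp only [mul_def, phi]
    rcases sgn_cases w.e with h' | h' <;> rw [h'] <;> linarith

/-- The windows `F̃_n φ_n(h)` are pairwise disjoint. -/
theorem window_inj {r : ℕ → ℕ} {n : ℕ} {w w' : GG} {h h' : ℤ × ℤ}
    (hw : w ∈ box (aTilde r n)) (hw' : w' ∈ box (aTilde r n))
    (heq : w * phi r n h = w' * phi r n h') : h = h' := by
  obtain ⟨w1, w2, w3, w4⟩ := hw
  obtain ⟨v1, v2, v3, v4⟩ := hw'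
  have hA : (0 : ℤ) < aTilde r n := by exact_mod_cast aTilde_pos r n
  have hA' : (0 : ℝ) < aTilde r n := by exact_mod_cast aTilde_pos r n
  have hk := congrArg GG.k heq
  have ht := congrArg GG.t heq
  have he := congrArg GG.e heq
  simp only [mul_def, phi, add_zero] at hk ht he
  rw [he] at ht
  have aux : ∀ x y : ℤ, (x : ℝ) - y < 1 → (y : ℝ) - x < 1 → x = y := by
    intro x y h1 h2
    have h1' : x - y < 1 := by exact_mod_cast h1
    have h2' : y - x < 1 := by exact_mod_cast h2
    omega
  refine Prod.ext ?_ ?_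
  · have e1 : 2 * aTilde r n * (h.1 - h'.1) = w'.k - w.k := by linear_combination hk
    have l1 : h.1 - h'.1 < 1 := by
      by_contra hc
      push Not at hc
      have := mul_le_mul_of_nonneg_left hc hA.le
      linarith
    have l2 : -1 < h.1 - h'.1 := by
      by_contra hc
      push Not at hc
      have := mul_le_mul_of_nonneg_left hc hA.le
      linarith
    omega
  · have key : ∀ ε : ℝ, ε * ε = 1 → (ε = 1 ∨ ε = -1) →
        w.t + ε * (2 * h.2 * aTilde r n) = w'.t + ε * (2 * h'.2 * aTilde r n) → h.2 = h'.2 := by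
      intro ε _ hε hteq
      apply aux
      · by_contra hc
        push Not at hc
        have := mul_le_mul_of_nonneg_left hc hA'.le
        rcases hε with rfl | rfl <;> linarith
      · by_contra hc
        push Not at hc
        have := mul_le_mul_of_nonneg_left hc hA'.le
        rcases hε with rfl | rfl <;> linarith
    refine key (sgn w'.e) ?_ (sgn_cases _) ht
    rcases sgn_cases w'.e with h1 | h1 <;> rw [h1] <;> norm_num

theorem s_mem_S {n : ℕ} (hn : 1 ≤ n) {h : ℤ × ℤ} (hh : h ∈ H K.r n) : K.s n h ∈ S K.r n :=
  K.D_subset n hn (K.s_mem n hn h hh)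

theorem copy_mem_window {n : ℕ} (hn : 1 ≤ n) {f : GG} (hf : f ∈ F K.r n) {h : ℤ × ℤ}
    (hh : h ∈ H K.r n) : f * K.s n h ∈ box (aTilde K.r n) := by
  have := mem_window (g := 1) (by simp [one_def]) (by simp [one_def]; omega) hn hf
    (K.s_mem_S hn hh)
  simpa using this

theorem zero_mem_box {m : ℕ} (hm : 0 < m) : (1 : GG) ∈ box m := by
  have : (0 : ℝ) < m := by exact_mod_cast hm
  refine ⟨?_, ?_, ?_, ?_⟩ <;> simp [one_def] <;> omega

/-- The sequence `(F_n, C_{n+1})_{n ≥ 1}` of the construction, enumerated from `0`. -/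
noncomputable def toCF : CFSequence GG where
  F n := F K.r (n + 1)
  C n := Csucc K.r K.s n
  one_lt_card n := by
    classical
    have hpos := K.r_pos (n + 1)
    have h0 : ((0, 0) : ℤ × ℤ) ∈ H K.r (n + 1) := by
      simp [H]
    have h1 : ((1, 0) : ℤ × ℤ) ∈ H K.r (n + 1) := by
      simp [H]; omega
    rw [Finset.one_lt_card]
    refine ⟨_, Finset.mem_image_of_mem _ h0, _, Finset.mem_image_of_mem _ h1, ?_⟩
    intro heq
    have hF : (1 : GG) ∈ F K.r (n + 1) :=
      zero_mem_box (Nat.mul_pos (by omega) (aTilde_pos _ _))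
    have w0 := K.copy_mem_window (by omega) hF h0
    have w1 := K.copy_mem_window (by omega) hF h1
    rw [one_mul] at w0 w1
    have := window_inj w0 w1 heq
    simp at this
  mul_mem n f hf c hc := by
    classical
    obtain ⟨h, hh, rfl⟩ := Finset.mem_image.1 hc
    rw [← mul_assoc]
    exact window_mul_phi_mem (K.copy_mem_window (by omega) hf hh) hh
  disjoint n c hc c' hc' hne := by
    classical
    obtain ⟨h, hh, rfl⟩ := Finset.mem_image.1 hc
    obtain ⟨h', hh', rfl⟩ := Finset.mem_image.1 hc'
    rw [Set.disjoint_left]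
    rintro _ ⟨f, hf, _, rfl, rfl⟩ ⟨f', hf', _, rfl, heq⟩
    apply hne
    simp only [← mul_assoc] at heq
    rw [window_inj (K.copy_mem_window (by omega) hf' hh') (K.copy_mem_window (by omega) hf hh) heq]
  gap g := by
    classical
    obtain ⟨m, hm⟩ := exists_nat_gt (max |(g.k : ℝ)| |g.t|)
    refine ⟨m, fun n hn f hf c hc => ?_⟩
    obtain ⟨h, hh, rfl⟩ := Finset.mem_image.1 hc
    rw [← mul_assoc]
    have hmn : (m : ℝ) ≤ ((n + 1 : ℕ) : ℝ) := by exact_mod_cast (by omega : m ≤ n + 1)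
    refine window_mul_phi_mem (mem_window ?_ ?_ (by omega) hf (K.s_mem_S (by omega) hh)) hh
    · have : |(g.k : ℝ)| ≤ ((n + 1 : ℕ) : ℝ) :=
        ((le_max_left _ _).trans_lt hm).le.trans hmn
      exact_mod_cast this
    · exact ((le_max_right _ _).trans_lt hm).trans_le hmn

/-- The space `X` of the constructed action. -/
abbrev X : Type := K.toCF.Space

/-- The measure `μ` of the constructed action. -/
noncomputable def μ : Measure K.X := K.toCF.μ haar

end Construction

/-- The transformation `T` of the measure space `(X, μ)` is mixing. -/
def IsMixing {X : Type*} [MeasurableSpace X] (T : X → X) (μ : Measure X) : Prop :=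
  MeasurePreserving T μ μ ∧
    ∀ A B : Set X, MeasurableSet A → MeasurableSet B →
      Tendsto (fun n : ℕ => μ ((T^[n]) ⁻¹' A ∩ B)) atTop (𝓝 (μ A * μ B))

/-!
The two assertions of the theorem, that `μ` is an invariant probability measure and that central
translations are mixing, are of a different nature.

*The space.* The map `x ↦ g x c_{n+1}` from `X_n` to `X_{n+1}` does not decrease measures
(`levelMeasure_step_preimage_le`). For `g = 1` this makes the measures on the `X_n` increase, so
that the limit measure is computed setwise; for general `g` it shows that `T_g` does not increase
the measure of preimages, hence preserves it, as the same holds for `g⁻¹`. The total mass is finite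
because passing from `X_n` to `X_{n+1}` multiplies it by `(ã/a)² ≤ exp (4 · ratio)`, and the
numbers `ratio r n = b/a` are summable by the growth of `r`.

*Mixing.* The cylinders over unions of atoms of the partitions `ξ_n` form a `π`-system which
generates the σ-algebra (`generateFrom_atomCylinders`), since the diameters of the atoms tend to
zero and right translations are isometries at small distances. It suffices to bound the
correlations of two such cylinders from above: the lower bound follows by applying this to the
complement of one of them, and the rest is a `π`-`λ` argument.

For the upper bound let `A`, `B` be the traces of the cylinders in `F_n`. The copies of `A` in
`F_{n+1}` are the sets `A s_n(h) φ_n(h)`, `h ∈ H_n`, lying in disjoint windows of width `2 ã_n`. A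
translation by `z(k)`, `k = 2 i ã_n + l` with `0 ≤ l < 2 ã_n`, moves the copy with index `h` to the
windows of the copies with index `h + (i, 0)` and `h + (i + 1, 0)` (`lift_translate_inter_subset`),
so the correlation is a sum over rows of the overlaps of `A z(l) s_n(h)` with `B s_n(h + (i, 0))`.
For `i ≥ 1` the pairs of spacers occurring in a row are nearly uniformly distributed in
`D_n × D_n`, and averages over `D_n` are averages over `S_n`, up to `1/n`. When `A` and `B` come
from two levels below, their copies fill boxes so evenly that the averaged overlap is at most the
product of the densities times the overlap of two boxes (`mean_overlap_le`, `rowSum_le`). For `k`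
between `2 ã_n` and `2 ã_{n+1}` one has `i ≥ 1` at level `n`, while at level `n + 1` the terms with
`i = 0` reduce to level `n` and those with `i = 1` are estimated as before; the two contributions
are proportional to `2 ã_{n+1} - k` and to `k`, and add up to the product of the measures
(`eventually_translate_inter_le`).

Two points need care. The element `s_n(h) φ_n(h)` moves the two layers `e = 0` and `e = 1` of a set
into windows with opposite second index, so evenness holds only if both layers have nearly the same
measure; this is `haar_real_lift_layer_le`, which rests on the fact that about half of `D_n` lies
in each layer (`card_layer_D_le`). Furthermore, products and intersections of sets have the same
precedence, so that the numerator in `overlap` is the measure of `(A x ∩ B) y`, that is, of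
`A x ∩ B` (`overlap_eq`). The discretization hypothesis is thus about the mean over `x` only; the
translation of `B` by an element `y` of `D_n` is obtained from it by including `y` in the element
`h` by which `B` is translated.
-/

/-! ### Haar measure on `ℤ × (ℝ ⋊ ℤ₂)` -/

namespace GG

/-- The coordinates as a measurable equivalence with `ℤ × ℝ × ℤ₂`. -/
def measurableEquivProd : GG ≃ᵐ ℤ × ℝ × ZMod 2 where
  toEquiv := equivProd
  measurable_toFun := comap_measurable _
  measurable_invFun := by
    rintro _ ⟨s, hs, rfl⟩
    simpa [← Set.preimage_comp] using hs

theorem measurable_equivProd : Measurable equivProd := measurableEquivProd.measurable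

theorem measurable_k : Measurable GG.k := measurable_fst.comp measurable_equivProd

theorem measurable_t : Measurable GG.t :=
  (measurable_fst.comp measurable_snd).comp measurable_equivProd

theorem measurable_e : Measurable GG.e :=
  (measurable_snd.comp measurable_snd).comp measurable_equivProd

theorem measurable_sgn : Measurable sgn := measurable_from_top

theorem measurable_of_coords {α : Type*} [MeasurableSpace α] {f : α → GG}
    (hk : Measurable fun x => (f x).k) (ht : Measurable fun x => (f x).t)
    (he : Measurable fun x => (f x).e) : Measurable f :=
  measurableEquivProd.symm.measurable.comp (hk.prodMk (ht.prodMk he))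

instance : MeasurableMul₂ GG where
  measurable_mul := by
    refine measurable_of_coords ?_ ?_ ?_
    · exact (measurable_k.comp measurable_fst).add (measurable_k.comp measurable_snd)
    · exact (measurable_t.comp measurable_fst).add
        ((measurable_sgn.comp (measurable_e.comp measurable_fst)).mul
          (measurable_t.comp measurable_snd))
    · exact (measurable_of_countable fun p : ZMod 2 × ZMod 2 => p.1 + p.2).comp
        ((measurable_e.comp measurable_fst).prodMk (measurable_e.comp measurable_snd))

instance : MeasurableInv GG where
  measurable_inv := by
    refine measurable_of_coords ?_ ?_ ?_
    · exact measurable_k.neg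
    · exact ((measurable_sgn.comp measurable_e).mul measurable_t).neg
    · exact (measurable_of_countable fun p : ZMod 2 => -p).comp measurable_e

instance : MeasurableSingletonClass GG where
  measurableSet_singleton g := by
    have : ({g} : Set GG) = equivProd ⁻¹' {equivProd g} := by
      ext x; simp
    rw [this]
    exact measurable_equivProd (measurableSet_singleton _)

theorem measurableSet_box (a : ℕ) : MeasurableSet (box a) := by
  have : box a = GG.k ⁻¹' {x | -(a : ℤ) < x ∧ x ≤ a} ∩ GG.t ⁻¹' Set.Ioc (-(a : ℝ)) a := by
    ext p; simp [box, and_assoc]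
  rw [this]
  exact (measurable_k (.of_discrete)).inter (measurable_t measurableSet_Ioc)

instance : SigmaFinite haar := by
  unfold haar
  exact measurableEquivProd.symm.sigmaFinite_map

/-- Haar measure, computed slice by slice. -/
theorem haar_apply {E : Set GG} (hE : MeasurableSet E) :
    haar E = ∑' k : ℤ, ∑ e : ZMod 2, volume {t : ℝ | (⟨k, t, e⟩ : GG) ∈ E} := by
  have hm : Measurable equivProd.symm := measurableEquivProd.symm.measurable
  rw [haar, Measure.map_apply hm hE, Measure.prod_apply (hm hE), lintegral_count]
  refine tsum_congr fun k => ?_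
  rw [Measure.prod_apply_symm (measurable_prodMk_left (hm hE)), lintegral_count, tsum_fintype]
  rfl

theorem volume_slice_affine (S : Set ℝ) (c : ℝ) (e : ZMod 2) :
    volume {t : ℝ | c + sgn e * t ∈ S} = volume S := by
  rcases sgn_cases e with h | h <;> rw [h]
  · simp only [one_mul]
    exact measure_preimage_add volume c S
  · have : {t : ℝ | c + -1 * t ∈ S} = (fun t => c - t) ⁻¹' S := by
      ext t; simp [sub_eq_add_neg]
    rw [this]
    have h2 : (fun t => c - t) ⁻¹' S = Neg.neg ⁻¹' ((fun t => c + t) ⁻¹' S) := by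
      ext t; simp [sub_eq_add_neg]
    rw [h2, Measure.measure_preimage_neg, measure_preimage_add]

theorem haar_left (g : GG) {E : Set GG} (hE : MeasurableSet E) :
    haar ((fun x => g * x) ⁻¹' E) = haar E := by
  rw [haar_apply hE, haar_apply (measurable_const_mul g hE)]
  rw [← (Equiv.addLeft g.k).tsum_eq
    (fun k => ∑ e : ZMod 2, volume {t : ℝ | (⟨k, t, e⟩ : GG) ∈ E})]
  refine tsum_congr fun k => ?_
  rw [← Equiv.sum_comp (Equiv.addLeft g.e)
    (fun e => volume {t : ℝ | (⟨Equiv.addLeft g.k k, t, e⟩ : GG) ∈ E})]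
  refine Finset.sum_congr rfl fun e _ => ?_
  exact volume_slice_affine {t | (⟨g.k + k, t, g.e + e⟩ : GG) ∈ E} g.t g.e

theorem haar_right (g : GG) {E : Set GG} (hE : MeasurableSet E) :
    haar ((fun x => x * g) ⁻¹' E) = haar E := by
  rw [haar_apply hE, haar_apply (measurable_mul_const g hE)]
  rw [← (Equiv.addRight g.k).tsum_eq
    (fun k => ∑ e : ZMod 2, volume {t : ℝ | (⟨k, t, e⟩ : GG) ∈ E})]
  refine tsum_congr fun k => ?_
  rw [← Equiv.sum_comp (Equiv.addRight g.e)
    (fun e => volume {t : ℝ | (⟨Equiv.addRight g.k k, t, e⟩ : GG) ∈ E})]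
  refine Finset.sum_congr rfl fun e _ => ?_
  exact measure_preimage_add_right volume (sgn e * g.t)
    {t | (⟨k + g.k, t, e + g.e⟩ : GG) ∈ E}

theorem haar_inv {E : Set GG} (hE : MeasurableSet E) : haar (Inv.inv ⁻¹' E) = haar E := by
  rw [haar_apply hE, haar_apply (measurable_inv hE)]
  rw [← (Equiv.neg ℤ).tsum_eq
    (fun k => ∑ e : ZMod 2, volume {t : ℝ | (⟨k, t, e⟩ : GG) ∈ E})]
  refine tsum_congr fun k => ?_
  rw [← Equiv.sum_comp (Equiv.neg (ZMod 2))
    (fun e => volume {t : ℝ | (⟨Equiv.neg ℤ k, t, e⟩ : GG) ∈ E})]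
  refine Finset.sum_congr rfl fun e _ => ?_
  have := volume_slice_affine {t | (⟨-k, -t, -e⟩ : GG) ∈ E} 0 e
  simp only [zero_add, Set.mem_ofPred_eq] at this
  refine this.trans ?_
  exact Measure.measure_preimage_neg volume {t | (⟨-k, t, -e⟩ : GG) ∈ E}

theorem mul_singleton_eq_preimage (A : Set GG) (g : GG) :
    A * {g} = (fun x => x * g⁻¹) ⁻¹' A := by
  ext x; simp

theorem mem_mul_singleton {A : Set GG} {g x : GG} : x ∈ A * {g} ↔ x * g⁻¹ ∈ A := by
  rw [mul_singleton_eq_preimage]; rfl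

theorem measurableSet_mul_singleton {A : Set GG} (hA : MeasurableSet A) (g : GG) :
    MeasurableSet (A * {g}) := by
  rw [mul_singleton_eq_preimage]; exact measurable_mul_const _ hA

theorem haar_mul_singleton {A : Set GG} (hA : MeasurableSet A) (g : GG) :
    haar (A * {g}) = haar A := by
  rw [mul_singleton_eq_preimage]; exact haar_right _ hA

/-- Haar measure of a product of an interval of integers, an interval of reals, and a set of
signs. -/
theorem haar_rect (k₁ k₂ : ℤ) (t₁ t₂ : ℝ) (J : Finset (ZMod 2)) :
    haar {p : GG | (k₁ < p.k ∧ p.k ≤ k₂) ∧ (t₁ < p.t ∧ p.t ≤ t₂) ∧ p.e ∈ J}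
      = ((k₂ - k₁).toNat : ENNReal) * (ENNReal.ofReal (t₂ - t₁) * J.card) := by
  have hm : Measurable equivProd.symm := measurableEquivProd.symm.measurable
  have hE : MeasurableSet {p : GG | (k₁ < p.k ∧ p.k ≤ k₂) ∧ (t₁ < p.t ∧ p.t ≤ t₂) ∧ p.e ∈ J} := by
    have h1 : MeasurableSet (GG.k ⁻¹' Set.Ioc k₁ k₂) := measurable_k (.of_discrete)
    have h2 : MeasurableSet (GG.t ⁻¹' Set.Ioc t₁ t₂) := measurable_t measurableSet_Ioc
    have h3 : MeasurableSet (GG.e ⁻¹' (J : Set (ZMod 2))) := measurable_e (.of_discrete)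
    exact h1.inter (h2.inter h3)
  rw [haar, Measure.map_apply hm hE]
  have : equivProd.symm ⁻¹' {p : GG | (k₁ < p.k ∧ p.k ≤ k₂) ∧ (t₁ < p.t ∧ p.t ≤ t₂) ∧ p.e ∈ J}
      = (Finset.Ioc k₁ k₂ : Set ℤ) ×ˢ (Set.Ioc t₁ t₂ ×ˢ (J : Set (ZMod 2))) := by
    ext p; simp [equivProd]
  rw [this, Measure.prod_prod, Measure.prod_prod, Measure.count_apply_finset,
    Measure.count_apply_finset, Real.volume_Ioc, Int.card_Ioc]

theorem haar_real_rect {k₁ k₂ : ℤ} {t₁ t₂ : ℝ} (hk : k₁ ≤ k₂) (ht : t₁ ≤ t₂)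
    (J : Finset (ZMod 2)) :
    haar.real {p : GG | (k₁ < p.k ∧ p.k ≤ k₂) ∧ (t₁ < p.t ∧ p.t ≤ t₂) ∧ p.e ∈ J}
      = (k₂ - k₁) * ((t₂ - t₁) * J.card) := by
  rw [measureReal_def, haar_rect, ENNReal.toReal_mul, ENNReal.toReal_mul,
    ENNReal.toReal_ofReal (by linarith), ENNReal.toReal_natCast, ENNReal.toReal_natCast]
  congr 1
  have : (((k₂ - k₁).toNat : ℤ) : ℝ) = ((k₂ - k₁ : ℤ) : ℝ) := by
    rw [Int.toNat_of_nonneg (by omega)]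
  rw [← Int.cast_natCast, this]; push_cast; ring

theorem box_eq_rect (a : ℕ) : box a = {p : GG | (-(a : ℤ) < p.k ∧ p.k ≤ a) ∧
    (-(a : ℝ) < p.t ∧ p.t ≤ a) ∧ p.e ∈ (Finset.univ : Finset (ZMod 2))} := by
  ext p; simp [box, and_assoc]

theorem haar_real_box (a : ℕ) : haar.real (box a) = 8 * (a : ℝ) ^ 2 := by
  rw [box_eq_rect, haar_real_rect (by omega) (by
    have : (0 : ℝ) ≤ a := Nat.cast_nonneg a
    linarith)]
  simp [ZMod.card]; ring

theorem haar_box_ne_top (a : ℕ) : haar (box a) ≠ ⊤ := by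
  rw [box_eq_rect, haar_rect]
  exact ENNReal.mul_ne_top (by simp) (ENNReal.mul_ne_top (by simp) (by simp))

/-- Half of a box: the elements with a given sign. -/
theorem haar_real_box_layer (a : ℕ) (e : ZMod 2) :
    haar.real (box a ∩ {p | p.e = e}) = 4 * (a : ℝ) ^ 2 := by
  have : box a ∩ {p | p.e = e} = {p : GG | (-(a : ℤ) < p.k ∧ p.k ≤ a) ∧
    (-(a : ℝ) < p.t ∧ p.t ≤ a) ∧ p.e ∈ ({e} : Finset (ZMod 2))} := by
    ext p; simp [box, and_assoc]
  rw [this, haar_real_rect (by omega) (by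
    have : (0 : ℝ) ≤ a := Nat.cast_nonneg a
    linarith)]
  simp; ring

theorem haar_ne_top_of_subset_box {E : Set GG} {a : ℕ} (h : E ⊆ box a) : haar E ≠ ⊤ :=
  ((measure_mono h).trans_lt (haar_box_ne_top a).lt_top).ne

theorem z_mul (x : ℤ) (p : GG) : z x * p = ⟨x + p.k, p.t, p.e⟩ := by
  simp [z, mul_def, sgn_zero]

theorem mul_z (x : ℤ) (p : GG) : p * z x = ⟨p.k + x, p.t, p.e⟩ := by
  simp [z, mul_def]

theorem z_comm (x : ℤ) (p : GG) : z x * p = p * z x := by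
  rw [z_mul, mul_z, add_comm]

theorem z_inv (x : ℤ) : (z x)⁻¹ = z (-x) := by
  simp [z, inv_def]

theorem z_add (x y : ℤ) : z (x + y) = z x * z y := by
  rw [z_mul]; simp [z]

theorem mem_mul_z {A : Set GG} {x : ℤ} {p : GG} :
    p ∈ A * {z x} ↔ (⟨p.k - x, p.t, p.e⟩ : GG) ∈ A := by
  rw [mem_mul_singleton, z_inv, mul_z]; rfl

/-- Overlap of two translates of a box along the center. -/
theorem haar_real_box_inter (a : ℕ) {x y : ℤ} (h : |x - y| ≤ 2 * a) :
    haar.real ((box a * {z x}) ∩ (box a * {z y})) = 4 * a * (2 * a - |(x : ℝ) - y|) := by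
  have key : ∀ x y : ℤ, x ≤ y → y - x ≤ 2 * a →
      haar.real ((box a * {z x}) ∩ (box a * {z y})) = 4 * a * (2 * a - (y - x)) := by
    intro x y h1 h2
    have : (box a * {z x}) ∩ (box a * {z y}) = {p : GG | (-(a : ℤ) + y < p.k ∧ p.k ≤ a + x) ∧
      (-(a : ℝ) < p.t ∧ p.t ≤ a) ∧ p.e ∈ (Finset.univ : Finset (ZMod 2))} := by
      ext p
      simp only [Set.mem_inter_iff, mem_mul_z, box, Set.mem_ofPred_eq, Finset.mem_univ, and_true]
      constructor
      · rintro ⟨⟨a1, a2, a3, a4⟩, b1, b2, b3, b4⟩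
        exact ⟨⟨by omega, by omega⟩, a3, a4⟩
      · rintro ⟨⟨a1, a2⟩, a3, a4⟩
        exact ⟨⟨by omega, by omega, a3, a4⟩, by omega, by omega, a3, a4⟩
    rw [this, haar_real_rect (by omega) (by
      have : (0 : ℝ) ≤ a := Nat.cast_nonneg a
      linarith)]
    simp [ZMod.card]; ring
  rcases le_total x y with h1 | h1
  · rw [key x y h1 (by rw [abs_le] at h; omega), abs_sub_comm, abs_of_nonneg]
    have : (x : ℝ) ≤ y := by exact_mod_cast h1
    linarith
  · rw [Set.inter_comm, key y x h1 (by rw [abs_le] at h; omega), abs_of_nonneg]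
    have : (y : ℝ) ≤ x := by exact_mod_cast h1
    linarith

end GG

/-! ### Copies of `F_n` in `F_{n+1}` -/

namespace Construction

open GG Cstr

variable (K : Construction)

/-- `A ↦ A C_{n+1}`: the copies, inside `F_{n+1}`, of a subset of `F_n`. -/
def lift (n : ℕ) (A : Set GG) : Set GG := A * (Csucc K.r K.s n : Set GG)

variable {K}

theorem mem_lift {n : ℕ} {A : Set GG} {x : GG} :
    x ∈ K.lift n A ↔ ∃ h ∈ H K.r n, x ∈ A * {K.s n h * phi K.r n h} := by
  classical
  constructor
  · rintro ⟨p, hp, c, hc, rfl⟩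
    obtain ⟨h, hh, rfl⟩ := Finset.mem_image.1 hc
    exact ⟨h, hh, p, hp, _, rfl, rfl⟩
  · rintro ⟨h, hh, p, hp, _, rfl, rfl⟩
    exact ⟨p, hp, _, Finset.mem_image_of_mem _ hh, rfl⟩

theorem lift_eq_biUnion (n : ℕ) (A : Set GG) :
    K.lift n A = ⋃ h ∈ H K.r n, A * {K.s n h * phi K.r n h} := by
  ext x; simp only [mem_lift, Set.mem_iUnion, exists_prop]

theorem mem_H {r : ℕ → ℕ} {n : ℕ} {h : ℤ × ℤ} :
    h ∈ H r n ↔ (-(r n : ℤ) ≤ h.1 ∧ h.1 ≤ r n) ∧ (-(r n : ℤ) ≤ h.2 ∧ h.2 ≤ r n) := by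
  simp [H]

theorem card_H (r : ℕ → ℕ) (n : ℕ) : (H r n).card = (2 * r n + 1) ^ 2 := by
  have : ((r n : ℤ) + 1 - -(r n : ℤ)).toNat = 2 * r n + 1 := by omega
  rw [H, Finset.card_product, Int.card_Icc, this, sq]

theorem measurableSet_F (r : ℕ → ℕ) (n : ℕ) : MeasurableSet (F r n) := measurableSet_box _

theorem haar_ne_top_of_subset_F {r : ℕ → ℕ} {n : ℕ} {A : Set GG} (hA : A ⊆ F r n) :
    haar A ≠ ⊤ := haar_ne_top_of_subset_box hA

theorem F_subset_window (r : ℕ → ℕ) {n : ℕ} (hn : 1 ≤ n) : F r n ⊆ box (aTilde r n) := by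
  obtain ⟨m, rfl⟩ : ∃ m, n = m + 1 := ⟨n - 1, by omega⟩
  rintro p ⟨h1, h2, h3, h4⟩
  have hA := aTilde_succ r m
  have hA' : (aTilde r (m + 1) : ℝ) = a r (m + 1) + b r (m + 1) + ((m + 1 : ℕ) : ℝ) := by
    rw [hA]; push_cast; ring
  have : (0 : ℝ) ≤ b r (m + 1) := Nat.cast_nonneg _
  have : (0 : ℝ) ≤ ((m + 1 : ℕ) : ℝ) := Nat.cast_nonneg _
  exact ⟨by omega, by omega, by linarith, by linarith⟩

theorem copy_mem_F {n : ℕ} (hn : 1 ≤ n) {p : GG} (hp : p ∈ F K.r n) {h : ℤ × ℤ}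
    (hh : h ∈ H K.r n) : p * (K.s n h * phi K.r n h) ∈ F K.r (n + 1) := by
  rw [← mul_assoc]
  exact window_mul_phi_mem (K.copy_mem_window hn hp hh) hh

theorem lift_subset_F {n : ℕ} (hn : 1 ≤ n) {A : Set GG} (hA : A ⊆ F K.r n) :
    K.lift n A ⊆ F K.r (n + 1) := by
  intro x hx
  obtain ⟨h, hh, p, hp, _, rfl, rfl⟩ := mem_lift.1 hx
  exact copy_mem_F hn (hA hp) hh

theorem measurableSet_lift (n : ℕ) {A : Set GG} (hA : MeasurableSet A) :
    MeasurableSet (K.lift n A) := by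
  rw [lift_eq_biUnion]
  exact Finset.measurableSet_biUnion _ fun h _ => measurableSet_mul_singleton hA _

theorem copies_disjoint {n : ℕ} (hn : 1 ≤ n) {A : Set GG} (hA : A ⊆ F K.r n) {h h' : ℤ × ℤ}
    (hh : h ∈ H K.r n) (hh' : h' ∈ H K.r n) (hne : h ≠ h') :
    Disjoint (A * {K.s n h * phi K.r n h}) (A * {K.s n h' * phi K.r n h'}) := by
  rw [Set.disjoint_left]
  rintro _ ⟨p, hp, _, rfl, rfl⟩ ⟨q, hq, _, rfl, heq⟩
  simp only [← mul_assoc] at heq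
  exact hne (window_inj (K.copy_mem_window hn (hA hq) hh') (K.copy_mem_window hn (hA hp) hh)
    heq).symm

theorem haar_lift {n : ℕ} (hn : 1 ≤ n) {A : Set GG} (hA : A ⊆ F K.r n) (hm : MeasurableSet A) :
    haar (K.lift n A) = (H K.r n).card * haar A := by
  rw [lift_eq_biUnion, measure_biUnion_finset
    (fun h hh h' hh' hne => copies_disjoint hn hA hh hh' hne)
    (fun h _ => measurableSet_mul_singleton hm _)]
  simp only [haar_mul_singleton hm, Finset.sum_const, nsmul_eq_mul]

/-- A set which meets each copy of `A` in a set of measure at most `β`, and only the copies with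
index in `J`, meets `A C_{n+1}` in a set of measure at most `|J| β`. -/
theorem haar_real_lift_inter_le {n : ℕ} (hn : 1 ≤ n) {A Q : Set GG} (hA : A ⊆ F K.r n)
    {J : Finset (ℤ × ℤ)} {β : ℝ}
    (hJ : ∀ h ∈ H K.r n, ∀ x ∈ A * {K.s n h * phi K.r n h}, x ∈ Q → h ∈ J)
    (hβ : ∀ h ∈ J, h ∈ H K.r n → haar.real ((A * {K.s n h * phi K.r n h}) ∩ Q) ≤ β)
    (hβ0 : 0 ≤ β) :
    haar.real (K.lift n A ∩ Q) ≤ J.card * β := by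
  classical
  have hsub : K.lift n A ∩ Q ⊆
      ⋃ h ∈ J ∩ H K.r n, (A * {K.s n h * phi K.r n h}) ∩ Q := by
    rintro x ⟨hx, hxQ⟩
    obtain ⟨h, hh, hxh⟩ := mem_lift.1 hx
    exact Set.mem_biUnion (Finset.mem_coe.2 (Finset.mem_inter.2 ⟨hJ h hh x hxh hxQ, hh⟩))
      ⟨hxh, hxQ⟩
  have hfin : haar (⋃ h ∈ J ∩ H K.r n, (A * {K.s n h * phi K.r n h}) ∩ Q) ≠ ⊤ := by
    refine haar_ne_top_of_subset_F (r := K.r) (n := n + 1) ?_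
    refine Set.iUnion₂_subset fun h hh => ?_
    rintro x ⟨⟨p, hp, _, rfl, rfl⟩, _⟩
    exact copy_mem_F hn (hA hp) (Finset.mem_inter.1 hh).2
  calc haar.real (K.lift n A ∩ Q)
      ≤ haar.real (⋃ h ∈ J ∩ H K.r n, (A * {K.s n h * phi K.r n h}) ∩ Q) :=
        measureReal_mono hsub hfin
    _ ≤ ∑ h ∈ J ∩ H K.r n, haar.real ((A * {K.s n h * phi K.r n h}) ∩ Q) :=
        measureReal_biUnion_finset_le _ _
    _ ≤ ∑ h ∈ J ∩ H K.r n, β :=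
        Finset.sum_le_sum fun h hh => hβ h (Finset.mem_inter.1 hh).1 (Finset.mem_inter.1 hh).2
    _ = ((J ∩ H K.r n).card : ℝ) * β := by simp
    _ ≤ J.card * β := by
        gcongr
        exact Finset.inter_subset_left

/-- The position of a point in the copy of `F_n` with index `h`. -/
theorem copy_coords {n : ℕ} (hn : 1 ≤ n) {A : Set GG} (hA : A ⊆ F K.r n) {h : ℤ × ℤ}
    (hh : h ∈ H K.r n) {x : GG} (hx : x ∈ A * {K.s n h * phi K.r n h}) :
    (-(aTilde K.r n : ℤ) < x.k - 2 * h.1 * aTilde K.r n ∧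
      x.k - 2 * h.1 * aTilde K.r n ≤ aTilde K.r n) ∧
    (-(aTilde K.r n : ℝ) < x.t - sgn x.e * (2 * h.2 * aTilde K.r n) ∧
      x.t - sgn x.e * (2 * h.2 * aTilde K.r n) ≤ aTilde K.r n) := by
  obtain ⟨p, hp, _, rfl, rfl⟩ := hx
  obtain ⟨h1, h2, h3, h4⟩ := K.copy_mem_window hn (hA hp) hh
  beta_reduce
  rw [← mul_assoc]
  set w := p * K.s n h
  refine ⟨⟨?_, ?_⟩, ?_, ?_⟩ <;> simp only [mul_def w, phi, add_zero]
  · linarith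
  · linarith
  · linarith
  · linarith

theorem haar_real_mul_singleton_layer {A : Set GG} (hA : MeasurableSet A) (g : GG) (e : ZMod 2) :
    haar.real ((A * {g}) ∩ {p | p.e = e}) = haar.real (A ∩ {p | p.e = e - g.e}) := by
  have hm : MeasurableSet (A ∩ {p : GG | p.e = e - g.e}) :=
    hA.inter (measurable_e (measurableSet_singleton _))
  have : (A * {g}) ∩ {p | p.e = e} = (A ∩ {p : GG | p.e = e - g.e}) * {g} := by
    ext x
    rw [Set.mem_inter_iff, mem_mul_singleton, mem_mul_singleton]
    simp [mul_def, inv_def, sub_eq_add_neg]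
  rw [this, measureReal_def, haar_mul_singleton hm, measureReal_def]

theorem card_Icc_le (x : ℝ) (m : ℕ) :
    (((Finset.Icc ⌈x - m⌉ ⌊x + m⌋).card : ℕ) : ℝ) ≤ 2 * m + 1 := by
  have h1 := Int.floor_le (x + m)
  have h2 := Int.le_ceil (x - m)
  rw [Int.card_Icc]
  have h3 : ((⌊x + m⌋ : ℝ)) - ⌈x - m⌉ ≤ 2 * m := by linarith
  have h4 : ⌊x + m⌋ - ⌈x - m⌉ ≤ 2 * (m : ℤ) := by exact_mod_cast h3
  have h5 : (⌊x + m⌋ + 1 - ⌈x - m⌉).toNat ≤ 2 * m + 1 := by omega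
  exact_mod_cast h5

/-- In each of the two layers, a square of radius `(2n+1) ã_n` meets at most `(2n+3)²` copies
of `F_n`. -/
theorem haar_real_lift_inter_square_le {n : ℕ} (hn : 1 ≤ n) {A Q : Set GG} (hA : A ⊆ F K.r n)
    (hm : MeasurableSet A) {α : ℝ} (hα : ∀ e, haar.real (A ∩ {p | p.e = e}) ≤ α) (g : GG)
    (hQ : ∀ q ∈ Q, |(q.k : ℝ) - g.k| ≤ b K.r (n + 1) ∧ |q.t - g.t| ≤ b K.r (n + 1)) :
    haar.real (K.lift n A ∩ Q) ≤ 2 * ((2 * (n + 1 : ℕ) + 1) ^ 2 * α) := by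
  set u : ℝ := ((aTilde K.r n : ℕ) : ℝ) with hu
  have hu0 : 0 < u := by rw [hu]; exact_mod_cast aTilde_pos K.r n
  have hb : (b K.r (n + 1) : ℝ) = (2 * n + 1) * u := by simp [b, hu]
  have hα0 : 0 ≤ α := measureReal_nonneg.trans (hα 0)
  have layer : ∀ e : ZMod 2, haar.real (K.lift n A ∩ (Q ∩ {p | p.e = e})) ≤
      (2 * (n + 1 : ℕ) + 1) ^ 2 * α := by
    intro e
    refine (haar_real_lift_inter_le hn hA
      (J := Finset.Icc ⌈(g.k : ℝ) / (2 * u) - (n + 1 : ℕ)⌉ ⌊(g.k : ℝ) / (2 * u) + (n + 1 : ℕ)⌋ ×ˢ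
        Finset.Icc ⌈sgn e * g.t / (2 * u) - (n + 1 : ℕ)⌉ ⌊sgn e * g.t / (2 * u) + (n + 1 : ℕ)⌋)
      (β := α) ?_ ?_ hα0).trans ?_
    · rintro h hh x hx ⟨hxQ, hxe⟩
      have hxe : x.e = e := hxe
      obtain ⟨⟨c1, c2⟩, c3, c4⟩ := copy_coords hn hA hh hx
      obtain ⟨q1, q2⟩ := hQ x hxQ
      have c1' : -u < x.k - 2 * h.1 * u := by rw [hu]; exact_mod_cast c1
      have c2' : x.k - 2 * h.1 * u ≤ u := by rw [hu]; exact_mod_cast c2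
      rw [hxe, ← hu] at c3 c4
      rw [hb, abs_le] at q1 q2
      have hcast : ((n + 1 : ℕ) : ℝ) = n + 1 := by push_cast; ring
      have sq1 : sgn e * sgn e = 1 := by rcases sgn_cases e with h' | h' <;> rw [h'] <;> norm_num
      have aux : ∀ y w : ℝ, -(2 * (n + 1) * u) ≤ 2 * y * u - w → 2 * y * u - w ≤ 2 * (n + 1) * u →
          w / (2 * u) - (n + 1 : ℕ) ≤ y ∧ y ≤ w / (2 * u) + (n + 1 : ℕ) := by
        intro y w hy1 hy2
        have e1 : w / (2 * u) * (2 * u) = w := div_mul_cancel₀ _ (by positivity)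
        rw [hcast]
        constructor
        · by_contra hc
          push Not at hc
          have := mul_lt_mul_of_pos_right hc (by positivity : 0 < 2 * u)
          linarith
        · by_contra hc
          push Not at hc
          have := mul_lt_mul_of_pos_right hc (by positivity : 0 < 2 * u)
          linarith
      rw [Finset.mem_product, Finset.mem_Icc, Finset.mem_Icc, Int.ceil_le, Int.le_floor,
        Int.ceil_le, Int.le_floor]
      refine ⟨aux _ _ (by linarith) (by linarith), aux _ _ ?_ ?_⟩
      · rcases sgn_cases e with h' | h' <;> rw [h'] at c3 c4 ⊢ <;> linarith
      · rcases sgn_cases e with h' | h' <;> rw [h'] at c3 c4 ⊢ <;> linarith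
    · intro h _ hh
      refine le_trans (measureReal_mono ?_ ?_) ((haar_real_mul_singleton_layer hm
        (K.s n h * phi K.r n h) e).trans_le (hα _))
      · exact fun x hx => ⟨hx.1, hx.2.2⟩
      · refine haar_ne_top_of_subset_F (r := K.r) (n := n + 1) ?_
        rintro x ⟨⟨p, hp, _, rfl, rfl⟩, _⟩
        exact copy_mem_F hn (hA hp) hh
    · rw [Finset.card_product]
      push_cast
      have h1 := card_Icc_le ((g.k : ℝ) / (2 * u)) (n + 1)
      have h2 := card_Icc_le (sgn e * g.t / (2 * u)) (n + 1)
      push_cast at h1 h2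
      rw [sq]
      gcongr
  have hsub : K.lift n A ∩ Q ⊆ (K.lift n A ∩ (Q ∩ {p | p.e = 0})) ∪
      (K.lift n A ∩ (Q ∩ {p | p.e = 1})) := by
    rintro x ⟨h1, h2⟩
    rcases zmod_cases x.e with h | h
    · exact Or.inl ⟨h1, h2, h⟩
    · exact Or.inr ⟨h1, h2, h⟩
  have hfin : haar ((K.lift n A ∩ (Q ∩ {p | p.e = 0})) ∪
      (K.lift n A ∩ (Q ∩ {p | p.e = 1}))) ≠ ⊤ :=
    haar_ne_top_of_subset_F (r := K.r) (n := n + 1)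
      (Set.union_subset (Set.inter_subset_left.trans (lift_subset_F hn hA))
        (Set.inter_subset_left.trans (lift_subset_F hn hA)))
  calc haar.real (K.lift n A ∩ Q) ≤ _ := measureReal_mono hsub hfin
    _ ≤ _ := measureReal_union_le _ _
    _ ≤ _ := add_le_add (layer 0) (layer 1)
    _ = _ := by ring

/-- The number of copies of `F_n` in `F_{n+1}` near the overlap of `F_{n+1}` with a translate of it
along the center. -/
theorem haar_real_lift_inter_strip_le {n : ℕ} (hn : 1 ≤ n) {B Q : Set GG} (hB : B ⊆ F K.r n)
    (hm : MeasurableSet B) (l : ℤ) (hl : |l| ≤ 2 * aTilde K.r (n + 1))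
    (hQ : ∀ q ∈ Q, |(q.k : ℝ) - l| ≤ aTilde K.r (n + 1) + b K.r (n + 1)) :
    haar.real (K.lift n B ∩ Q) ≤ haar.real B / (8 * (aTilde K.r n : ℝ) ^ 2) *
      (4 * aTilde K.r (n + 1) * (2 * aTilde K.r (n + 1) - |(l : ℝ)|
        + (b K.r (n + 1) + 3 * aTilde K.r n))) := by
  set u : ℝ := ((aTilde K.r n : ℕ) : ℝ) with hu
  set v : ℝ := ((aTilde K.r (n + 1) : ℕ) : ℝ) with hv
  set β : ℝ := ((b K.r (n + 1) : ℕ) : ℝ) with hβ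
  have hu0 : 0 < u := by rw [hu]; exact_mod_cast aTilde_pos K.r n
  have hv0 : 0 < v := by rw [hv]; exact_mod_cast aTilde_pos K.r (n + 1)
  have hβ0 : 0 ≤ β := Nat.cast_nonneg _
  have hl' : |(l : ℝ)| ≤ 2 * v := by rw [hv]; exact_mod_cast hl
  have hav : ((2 * K.r n + 1 : ℕ) : ℝ) * u ≤ v := by
    rw [hu, hv]
    have : (2 * K.r n + 1) * aTilde K.r n ≤ aTilde K.r (n + 1) := by
      rw [aTilde_succ]; simp only [a]; omega
    exact_mod_cast this
  -- the copies meeting the strip have their first index in an interval of this length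
  set M : ℝ := (2 * v - |(l : ℝ)| + (β + 3 * u)) / (2 * u) with hM
  have hM0 : 0 ≤ M := div_nonneg (by linarith) (by positivity)
  have hMu : M * (2 * u) = 2 * v - |(l : ℝ)| + (β + 3 * u) := div_mul_cancel₀ _ (by positivity)
  have main : ∃ J : Finset ℤ, (J.card : ℝ) ≤ M ∧
      ∀ h ∈ H K.r n, ∀ x ∈ B * {K.s n h * phi K.r n h}, x ∈ Q → h.1 ∈ J := by
    have coords : ∀ h ∈ H K.r n, ∀ x ∈ B * {K.s n h * phi K.r n h}, x ∈ Q →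
        (-v ≤ h.1 * (2 * u) + u ∧ h.1 * (2 * u) - u ≤ v) ∧
        (l - v - β - u ≤ h.1 * (2 * u) ∧ h.1 * (2 * u) ≤ l + v + β + u) := by
      intro h hh x hx hxQ
      obtain ⟨⟨c1, c2⟩, -⟩ := copy_coords hn hB hh hx
      have c1' : -u < x.k - 2 * h.1 * u := by rw [hu]; exact_mod_cast c1
      have c2' : x.k - 2 * h.1 * u ≤ u := by rw [hu]; exact_mod_cast c2
      have q1 := hQ x hxQ
      rw [abs_le] at q1
      obtain ⟨⟨g1, g2⟩, -⟩ := mem_H.1 hh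
      have g1' : -(K.r n : ℝ) ≤ h.1 := by exact_mod_cast g1
      have g2' : (h.1 : ℝ) ≤ K.r n := by exact_mod_cast g2
      have := mul_le_mul_of_nonneg_right g1' hu0.le
      have := mul_le_mul_of_nonneg_right g2' hu0.le
      push_cast at hav
      exact ⟨⟨by linarith, by linarith⟩, by linarith, by linarith⟩
    have card : ∀ x y : ℝ, (y - x + 2 * u) / (2 * u) ≤ M → 0 ≤ y - x + 2 * u →
        (((Finset.Icc ⌈x / (2 * u)⌉ ⌊y / (2 * u)⌋).card : ℕ) : ℝ) ≤ M := by
      intro x y hxy h0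
      refine le_trans ?_ hxy
      have h1 := Int.floor_le (y / (2 * u))
      have h2 := Int.le_ceil (x / (2 * u))
      rw [Int.card_Icc]
      have h3 : (y - x + 2 * u) / (2 * u) = y / (2 * u) - x / (2 * u) + 1 := by
        field_simp
      rcases le_total (⌊y / (2 * u)⌋ + 1 - ⌈x / (2 * u)⌉) 0 with h | h
      · rw [Int.toNat_of_nonpos h]
        simp only [Nat.cast_zero]
        positivity
      · have : (((⌊y / (2 * u)⌋ + 1 - ⌈x / (2 * u)⌉).toNat : ℤ) : ℝ)
            = ((⌊y / (2 * u)⌋ + 1 - ⌈x / (2 * u)⌉ : ℤ) : ℝ) := by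
          rw [Int.toNat_of_nonneg h]
        rw [← Int.cast_natCast, this, h3]
        push_cast
        linarith
    rcases le_total 0 l with h0 | h0
    · have h0' : (0 : ℝ) ≤ l := by exact_mod_cast h0
      rw [abs_of_nonneg h0'] at hM hl' hMu
      refine ⟨Finset.Icc ⌈(l - v - β - u) / (2 * u)⌉ ⌊(v + u - u) / (2 * u)⌋, ?_, ?_⟩
      · refine card _ _ ?_ (by linarith)
        rw [hM]; exact div_le_div_of_nonneg_right (by linarith) (by positivity)
      · intro h hh x hx hxQ
        obtain ⟨⟨d1, d2⟩, d3, d4⟩ := coords h hh x hx hxQ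
        obtain ⟨⟨g1, g2⟩, -⟩ := mem_H.1 hh
        have g2' : (h.1 : ℝ) ≤ K.r n := by exact_mod_cast g2
        have := mul_le_mul_of_nonneg_right g2' hu0.le
        push_cast at hav
        rw [Finset.mem_Icc, Int.ceil_le, Int.le_floor, div_le_iff₀ (by positivity),
          le_div_iff₀ (by positivity)]
        exact ⟨d3, by linarith⟩
    · have h0' : (l : ℝ) ≤ 0 := by exact_mod_cast h0
      rw [abs_of_nonpos h0'] at hM hl' hMu
      refine ⟨Finset.Icc ⌈(-v) / (2 * u)⌉ ⌊(l + v + β + u) / (2 * u)⌋, ?_, ?_⟩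
      · refine card _ _ ?_ (by linarith)
        rw [hM]; exact div_le_div_of_nonneg_right (by linarith) (by positivity)
      · intro h hh x hx hxQ
        obtain ⟨⟨d1, d2⟩, d3, d4⟩ := coords h hh x hx hxQ
        obtain ⟨⟨g1, g2⟩, -⟩ := mem_H.1 hh
        have g1' : -(K.r n : ℝ) ≤ h.1 := by exact_mod_cast g1
        have := mul_le_mul_of_nonneg_right g1' hu0.le
        push_cast at hav
        rw [Finset.mem_Icc, Int.ceil_le, Int.le_floor, div_le_iff₀ (by positivity),
          le_div_iff₀ (by positivity)]
        exact ⟨by linarith, d4⟩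
  obtain ⟨J, hJ, hJm⟩ := main
  have hIcc : (((Finset.Icc (-(K.r n : ℤ)) (K.r n)).card : ℕ) : ℝ) * u ≤ v := by
    have : ((K.r n : ℤ) + 1 - -(K.r n : ℤ)).toNat = 2 * K.r n + 1 := by omega
    rw [Int.card_Icc, this]; exact hav
  refine (haar_real_lift_inter_le hn hB (J := J ×ˢ Finset.Icc (-(K.r n : ℤ)) (K.r n))
    (β := haar.real B) ?_ ?_ measureReal_nonneg).trans ?_
  · intro h hh x hx hxQ
    exact Finset.mem_product.2 ⟨hJm h hh x hx hxQ, Finset.mem_Icc.2 (mem_H.1 hh).2⟩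
  · intro h _ hh
    refine (measureReal_mono Set.inter_subset_left ?_).trans_eq ?_
    · rw [haar_mul_singleton hm]; exact haar_ne_top_of_subset_F hB
    · rw [measureReal_def, haar_mul_singleton hm, measureReal_def]
  · rw [Finset.card_product]
    push_cast
    have h1 : (((Finset.Icc (-(K.r n : ℤ)) (K.r n)).card : ℕ) : ℝ) ≤ v / u :=
      (le_div_iff₀ hu0).2 hIcc
    calc _ ≤ M * (v / u) * haar.real B := by
          gcongr
      _ = _ := by rw [hM]; field_simp; ring

end Construction

/-! ### Unions of atoms and mean overlaps -/

namespace Construction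

open GG Cstr

variable {K : Construction}

theorem isUnionOfAtoms_iff {ξ : Set (Set GG)} {E : Set GG} :
    IsUnionOfAtoms ξ E ↔ ∀ x ∈ E, ∃ A ∈ ξ, x ∈ A ∧ A ⊆ E := by
  constructor
  · rintro ⟨𝒜, h𝒜, rfl⟩ x ⟨A, hA, hx⟩
    exact ⟨A, h𝒜 hA, hx, Set.subset_sUnion_of_mem hA⟩
  · intro h
    refine ⟨{A ∈ ξ | A ⊆ E}, fun A hA => hA.1, Set.Subset.antisymm ?_ ?_⟩
    · intro x hx
      obtain ⟨A, hA, hxA, hAE⟩ := h x hx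
      exact ⟨A, ⟨hA, hAE⟩, hxA⟩
    · exact Set.sUnion_subset fun A hA => hA.2

theorem isUnionOfAtoms_biUnion {ξ : Set (Set GG)} {ι : Type*} {I : Set ι} {E : ι → Set GG}
    (h : ∀ i ∈ I, IsUnionOfAtoms ξ (E i)) : IsUnionOfAtoms ξ (⋃ i ∈ I, E i) := by
  rw [isUnionOfAtoms_iff]
  intro x hx
  obtain ⟨i, hi, hx⟩ := Set.mem_iUnion₂.1 hx
  obtain ⟨A, hA, hxA, hAE⟩ := isUnionOfAtoms_iff.1 (h i hi) x hx
  exact ⟨A, hA, hxA, hAE.trans (Set.subset_biUnion_of_mem (u := E) hi)⟩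

theorem subset_F_of_isUnionOfAtoms {n : ℕ} (hn : 1 ≤ n) {A : Set GG}
    (hA : IsUnionOfAtoms (K.ξ n) A) : A ⊆ F K.r n := by
  obtain ⟨𝒜, h𝒜, rfl⟩ := hA
  rw [← K.ξ_cover n hn]
  exact Set.sUnion_subset_sUnion h𝒜

theorem measurableSet_of_isUnionOfAtoms {n : ℕ} (hn : 1 ≤ n) {A : Set GG}
    (hA : IsUnionOfAtoms (K.ξ n) A) : MeasurableSet A := by
  obtain ⟨𝒜, h𝒜, rfl⟩ := hA
  exact MeasurableSet.sUnion ((K.ξ_finite n hn).subset h𝒜).countable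
    fun A hA => K.ξ_measurable n hn A (h𝒜 hA)

theorem isUnionOfAtoms_F {n : ℕ} (hn : 1 ≤ n) : IsUnionOfAtoms (K.ξ n) (F K.r n) :=
  ⟨K.ξ n, subset_rfl, (K.ξ_cover n hn).symm⟩

theorem isUnionOfAtoms_mul_singleton {n : ℕ} (hn : 1 ≤ n) {A : Set GG}
    (hA : IsUnionOfAtoms (K.ξ n) A) {c : GG} (hc : c ∈ Csucc K.r K.s n) :
    IsUnionOfAtoms (K.ξ (n + 1)) (A * {c}) := by
  obtain ⟨𝒜, h𝒜, rfl⟩ := hA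
  have : ⋃₀ 𝒜 * {c} = ⋃ A ∈ 𝒜, A * {c} := by
    ext x
    simp only [mem_mul_singleton, Set.mem_sUnion, Set.mem_iUnion, exists_prop]
  rw [this]
  exact isUnionOfAtoms_biUnion fun A hA => K.ξ_refine n hn A (h𝒜 hA) c hc

theorem copy_mem_Csucc {n : ℕ} {h : ℤ × ℤ} (hh : h ∈ H K.r n) :
    K.s n h * phi K.r n h ∈ Csucc K.r K.s n := by
  classical
  exact Finset.mem_image_of_mem _ hh

theorem isUnionOfAtoms_lift {n : ℕ} (hn : 1 ≤ n) {A : Set GG}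
    (hA : IsUnionOfAtoms (K.ξ n) A) : IsUnionOfAtoms (K.ξ (n + 1)) (K.lift n A) := by
  rw [lift_eq_biUnion]
  exact isUnionOfAtoms_biUnion (I := (H K.r n : Set (ℤ × ℤ))) fun h hh =>
    isUnionOfAtoms_mul_singleton hn hA (copy_mem_Csucc hh)

/-- The part of `A C_{n+1}` made of the copies of `A` that stay well inside `F_{n+1}` after
a translation by `v` along the center. -/
theorem exists_trim {n : ℕ} (hn : 1 ≤ n) {A : Set GG} (hA : IsUnionOfAtoms (K.ξ n) A) (v : ℤ) :
    ∃ A₁ ⊆ K.lift n A, IsUnionOfAtoms (K.ξ (n + 1)) A₁ ∧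
      (∀ p ∈ A₁, |(p.k : ℝ) + v| + 2 * b K.r (n + 1) < a K.r (n + 1) ∧
        |p.t| + 2 * b K.r (n + 1) < a K.r (n + 1)) ∧
      ∀ p ∈ K.lift n A, p ∉ A₁ →
        (a K.r (n + 1) : ℝ) ≤ |(p.k : ℝ) + v| + 2 * aTilde K.r n + 2 * b K.r (n + 1) ∨
        (a K.r (n + 1) : ℝ) ≤ |p.t| + 2 * aTilde K.r n + 2 * b K.r (n + 1) := by
  have hAF := subset_F_of_isUnionOfAtoms hn hA
  set I : Set (ℤ × ℤ) := {h | h ∈ H K.r n ∧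
    |2 * (h.1 : ℝ) * aTilde K.r n + v| + aTilde K.r n + 2 * b K.r (n + 1) < a K.r (n + 1) ∧
    |2 * (h.2 : ℝ) * aTilde K.r n| + aTilde K.r n + 2 * b K.r (n + 1) < a K.r (n + 1)} with hI
  have coords : ∀ h ∈ H K.r n, ∀ x ∈ A * {K.s n h * phi K.r n h},
      |((x.k : ℝ) + v) - (2 * (h.1 : ℝ) * aTilde K.r n + v)| ≤ aTilde K.r n ∧
      |(|x.t| - |2 * (h.2 : ℝ) * aTilde K.r n|)| ≤ aTilde K.r n := by
    intro h hh x hx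
    obtain ⟨⟨c1, c2⟩, c3, c4⟩ := copy_coords hn hAF hh hx
    have c1' : -(aTilde K.r n : ℝ) < x.k - 2 * h.1 * aTilde K.r n := by exact_mod_cast c1
    have c2' : (x.k : ℝ) - 2 * h.1 * aTilde K.r n ≤ aTilde K.r n := by exact_mod_cast c2
    refine ⟨abs_le.2 ⟨by linarith, by linarith⟩, ?_⟩
    have hs : |sgn x.e * (2 * (h.2 : ℝ) * aTilde K.r n)| = |2 * (h.2 : ℝ) * aTilde K.r n| := by
      rcases sgn_cases x.e with h' | h' <;> rw [h'] <;> simp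
    rw [← hs]
    exact (abs_abs_sub_abs_le_abs_sub _ _).trans (abs_le.2 ⟨c3.le, c4⟩)
  refine ⟨⋃ h ∈ I, A * {K.s n h * phi K.r n h}, ?_, ?_, ?_, ?_⟩
  · intro x hx
    obtain ⟨h, hh, hx⟩ := Set.mem_iUnion₂.1 hx
    exact mem_lift.2 ⟨h, hh.1, hx⟩
  · exact isUnionOfAtoms_biUnion fun h hh =>
      isUnionOfAtoms_mul_singleton hn hA (copy_mem_Csucc hh.1)
  · intro x hx
    obtain ⟨h, ⟨hh, h1, h2⟩, hx⟩ := Set.mem_iUnion₂.1 hx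
    obtain ⟨c1, c2⟩ := coords h hh x hx
    have c3 := abs_sub_abs_le_abs_sub ((x.k : ℝ) + v) (2 * (h.1 : ℝ) * aTilde K.r n + v)
    have c4 := (abs_le.1 c2).2
    constructor <;> linarith
  · intro x hx hxn
    obtain ⟨h, hh, hx⟩ := mem_lift.1 hx
    obtain ⟨c1, c2⟩ := coords h hh x hx
    rw [abs_sub_comm] at c1
    have c3 := abs_sub_abs_le_abs_sub (2 * (h.1 : ℝ) * aTilde K.r n + v) ((x.k : ℝ) + v)
    have c4 := (abs_le.1 c2).1
    by_contra hc
    push Not at hc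
    exact hxn (Set.mem_biUnion (show h ∈ I from ⟨hh, by linarith, by linarith⟩) hx)

/-- Products and intersections of sets have the same precedence and associate to the left, so the
numerator in `overlap` is the measure of `(A x ∩ B) y`, which does not depend on `y`. -/
theorem overlap_eq {r : ℕ → ℕ} {n : ℕ} {A B : Set GG} (hA : MeasurableSet A) (hB : MeasurableSet B)
    (x y : GG) : overlap r n A B x y = haar.real ((A * {x}) ∩ B) / haar.real (F r n) := by
  have : (A * {x} ∩ B * {y} : Set GG) = ((A * {x}) ∩ B) * {y} := rfl
  rw [overlap, this, measureReal_def,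
    haar_mul_singleton ((measurableSet_mul_singleton hA x).inter hB), ← measureReal_def]

/-- If no point is covered by more than measure `U` of the translates `A x`, `x ∈ S`, and these
translates lie in `Q`, then the mean overlap of `A x` with `B` is at most
`U λ(B ∩ Q) / λ(S)`. -/
theorem integral_overlap_le {r : ℕ → ℕ} {n m : ℕ} {A B Q : Set GG} (hA : MeasurableSet A)
    (hB : MeasurableSet B) (hBf : haar B ≠ ⊤) {U : ℝ}
    (hU : ∀ p, haar.real (box m ∩ {x | p ∈ A * {x}}) ≤ U)
    (hQ : ∀ x ∈ box m, ∀ p ∈ A * {x}, p ∈ Q) :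
    ∫ p in box m ×ˢ box m, overlap r n A B p.1 p.2 ∂(haar.prod haar)
      ≤ haar.real (box m) * (U * haar.real (B ∩ Q)) / haar.real (F r n) := by
  have hU0 : 0 ≤ U := measureReal_nonneg.trans (hU 1)
  simp only [overlap_eq hA hB]
  rw [integral_div]
  refine div_le_div_of_nonneg_right ?_ measureReal_nonneg
  rw [← Measure.prod_restrict,
    integral_fun_fst (μ := haar.restrict (box m)) (ν := haar.restrict (box m))
      (fun x => haar.real ((A * {x}) ∩ B)), smul_eq_mul, measureReal_restrict_apply_univ]
  refine mul_le_mul_of_nonneg_left ?_ measureReal_nonneg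
  set E : Set (GG × GG) := {q | q.2 * q.1⁻¹ ∈ A ∧ q.2 ∈ B} with hE
  have hEm : MeasurableSet E := by
    have h1 : Measurable fun q : GG × GG => q.2 * q.1⁻¹ := measurable_snd.mul measurable_fst.inv
    exact (h1 hA).inter (measurable_snd hB)
  have hslice : ∀ x : GG, (A * {x}) ∩ B = Prod.mk x ⁻¹' E := by
    intro x; ext p
    rw [Set.mem_inter_iff, mem_mul_singleton]; rfl
  have hmeas : Measurable fun x : GG => haar ((A * {x}) ∩ B) := by
    simp only [hslice]
    exact measurable_measure_prodMk_left hEm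
  have hlt : ∀ᵐ x ∂(haar.restrict (box m)), haar ((A * {x}) ∩ B) < ⊤ :=
    Eventually.of_forall fun x => (measure_mono Set.inter_subset_right).trans_lt hBf.lt_top
  have hint : ∫ x in box m, haar.real ((A * {x}) ∩ B) ∂haar
      = (∫⁻ x in box m, haar ((A * {x}) ∩ B) ∂haar).toReal :=
    integral_toReal hmeas.aemeasurable hlt
  rw [hint]
  have hle : ∫⁻ x in box m, haar ((A * {x}) ∩ B) ∂haar ≤ ENNReal.ofReal U * haar (B ∩ Q) := by
    simp only [hslice]
    rw [← Measure.prod_apply hEm, Measure.prod_apply_symm hEm]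
    set R := toMeasurable haar (B ∩ Q)
    calc ∫⁻ p, haar.restrict (box m) ((fun x => (x, p)) ⁻¹' E) ∂haar
        ≤ ∫⁻ p, R.indicator (fun _ => ENNReal.ofReal U) p ∂haar := by
          refine lintegral_mono fun p => ?_
          rw [Measure.restrict_apply (measurable_prodMk_right hEm)]
          have hset : (fun x => (x, p)) ⁻¹' E ∩ box m ⊆ box m ∩ {x | p ∈ A * {x}} := by
            rintro x ⟨⟨h1, h2⟩, h3⟩
            exact ⟨h3, mem_mul_singleton.2 h1⟩
          by_cases hp : p ∈ R
          · rw [Set.indicator_of_mem hp]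
            refine (measure_mono hset).trans ?_
            rw [← ENNReal.ofReal_toReal
              (haar_ne_top_of_subset_box (a := m) Set.inter_subset_left)]
            exact ENNReal.ofReal_le_ofReal (hU p)
          · rw [Set.indicator_of_notMem hp]
            refine le_of_eq ?_
            have : (fun x => (x, p)) ⁻¹' E ∩ box m = ∅ := by
              rw [Set.eq_empty_iff_forall_notMem]
              rintro x hx
              obtain ⟨h3, h1⟩ := hset hx
              exact hp (subset_toMeasurable _ _ ⟨hx.1.2, hQ x h3 p h1⟩)
            rw [this, measure_empty]
      _ = ENNReal.ofReal U * haar (B ∩ Q) := by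
          rw [lintegral_indicator_const (measurableSet_toMeasurable _ _), measure_toMeasurable]
  have hne : haar (B ∩ Q) ≠ ⊤ := ((measure_mono Set.inter_subset_left).trans_lt hBf.lt_top).ne
  calc (∫⁻ x in box m, haar ((A * {x}) ∩ B) ∂haar).toReal
      ≤ (ENNReal.ofReal U * haar (B ∩ Q)).toReal :=
        ENNReal.toReal_mono (ENNReal.mul_ne_top ENNReal.ofReal_ne_top hne) hle
    _ = U * haar.real (B ∩ Q) := by
        rw [ENNReal.toReal_mul, ENNReal.toReal_ofReal hU0, measureReal_def]

/-- How much of the translates `A₁ z(v) x`, `x ∈ S_{n+1}`, covers a given point, for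
`A₁ ⊆ A C_{n+1}`: the set `S_{n+1}` is a union of about `(2n+1)²` windows, each of which contains
one copy of `A`. -/
theorem haar_real_cover_le {n : ℕ} (hn : 1 ≤ n) {A A₁ : Set GG} (hA : A ⊆ F K.r n)
    (hm : MeasurableSet A) {α : ℝ} (hα : ∀ e, haar.real (A ∩ {p | p.e = e}) ≤ α)
    (hA₁ : A₁ ⊆ K.lift n A) (v : ℤ) (p : GG) :
    haar.real (box (b K.r (n + 1)) ∩ {x | p ∈ A₁ * {z v} * {x}})
      ≤ 2 * ((2 * (n + 1 : ℕ) + 1) ^ 2 * α) := by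
  set g : GG := p * z (-v)
  set Q : Set GG := {y | y⁻¹ * g ∈ box (b K.r (n + 1))} with hQdef
  have hQm : MeasurableSet Q :=
    ((measurable_inv (G := GG)).mul_const g) (measurableSet_box _)
  have hE : MeasurableSet (K.lift n A ∩ Q) := (measurableSet_lift n hm).inter hQm
  have hsub : box (b K.r (n + 1)) ∩ {x | p ∈ A₁ * {z v} * {x}} ⊆
      Inv.inv ⁻¹' ((fun y => g * y) ⁻¹' (K.lift n A ∩ Q)) := by
    rintro x ⟨hx, hpx⟩
    have hpx : p ∈ A₁ * {z v} * {x} := hpx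
    rw [mem_mul_singleton, mem_mul_singleton, z_inv, mul_assoc, ← z_comm, ← mul_assoc] at hpx
    refine ⟨hA₁ hpx, ?_⟩
    change (g * x⁻¹)⁻¹ * g ∈ box (b K.r (n + 1))
    simpa using hx
  have heq : haar (Inv.inv ⁻¹' ((fun y => g * y) ⁻¹' (K.lift n A ∩ Q)))
      = haar (K.lift n A ∩ Q) := by
    rw [haar_inv (measurable_const_mul g hE), haar_left g hE]
  have hne : haar (K.lift n A ∩ Q) ≠ ⊤ :=
    haar_ne_top_of_subset_F (r := K.r) (n := n + 1)
      (Set.inter_subset_left.trans (lift_subset_F hn hA))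
  refine (measureReal_mono hsub (by rw [heq]; exact hne)).trans ?_
  rw [measureReal_def, heq, ← measureReal_def]
  refine haar_real_lift_inter_square_le hn hA hm hα g ?_
  rintro q ⟨q1, q2, q3, q4⟩
  simp only [mul_def, inv_def] at q1 q2 q3 q4
  have q1' : -(b K.r (n + 1) : ℝ) < -q.k + g.k := by exact_mod_cast q1
  have q2' : -(q.k : ℝ) + g.k ≤ b K.r (n + 1) := by exact_mod_cast q2
  refine ⟨abs_le.2 ⟨by linarith, by linarith⟩, abs_le.2 ?_⟩
  rw [ZMod.neg_eq_self_mod_two] at q3 q4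
  rcases sgn_cases q.e with h | h <;> rw [h] at q3 q4 <;> constructor <;> linarith

end Construction

/-! ### Overlaps averaged over `D_{n+1}` -/

namespace Construction

open GG Cstr

variable {K : Construction}

theorem aTilde_le_b (r : ℕ → ℕ) (n : ℕ) : aTilde r n ≤ b r (n + 1) := by
  simp only [b]; nlinarith [aTilde_pos r n]

theorem D_card_pos {n : ℕ} (hn : 1 ≤ n) : 0 < (K.D n).card :=
  Finset.card_pos.2 ⟨_, K.s_mem n hn (0, 0) (mem_H.2 ⟨by simp, by simp⟩)⟩

/-- The boundary layer of `F_{n+1}` has measure comparable to `a_{n+1} b_{n+1}`. -/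
theorem haar_real_boundary_le {n : ℕ} (hab : 8 * b K.r (n + 1) ≤ a K.r (n + 1)) {Z : Set GG}
    (hZ : ∀ q ∈ Z, |(q.k : ℝ)| ≤ a K.r (n + 1) + b K.r (n + 1) ∧
      |q.t| ≤ a K.r (n + 1) + b K.r (n + 1) ∧
      ((a K.r (n + 1) : ℝ) ≤ |(q.k : ℝ)| + 2 * aTilde K.r n + 3 * b K.r (n + 1) ∨
       (a K.r (n + 1) : ℝ) ≤ |q.t| + 2 * aTilde K.r n + 3 * b K.r (n + 1))) :
    haar.real Z ≤ 128 * (a K.r (n + 1) * b K.r (n + 1)) := by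
  have hub := aTilde_le_b K.r n
  have hu0 := aTilde_pos K.r n
  generalize a K.r (n + 1) = a' at *
  generalize b K.r (n + 1) = b' at *
  generalize aTilde K.r n = u at *
  obtain ⟨d, hd⟩ : ∃ d, a' = d + (3 * b' + 2 * u + 1) := ⟨a' - (3 * b' + 2 * u + 1), by omega⟩
  have hd' : (a' : ℝ) = d + (3 * b' + 2 * u + 1) := by rw [hd]; push_cast; ring
  have hsub : Z ⊆ box (a' + b' + 1) \ box d := by
    intro q hq
    obtain ⟨h1, h2, h3⟩ := hZ q hq
    rw [abs_le] at h1 h2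
    refine ⟨⟨?_, ?_, ?_, ?_⟩, ?_⟩
    · have : (-((a' + b' + 1 : ℕ) : ℝ)) < q.k := by push_cast; linarith
      exact_mod_cast this
    · have : (q.k : ℝ) ≤ ((a' + b' + 1 : ℕ) : ℝ) := by push_cast; linarith
      exact_mod_cast this
    · push_cast; linarith
    · push_cast; linarith
    · rintro ⟨g1, g2, g3, g4⟩
      have g1' : -(d : ℝ) ≤ q.k := by exact_mod_cast g1.le
      have g2' : (q.k : ℝ) ≤ d := by exact_mod_cast g2
      have k1 : |(q.k : ℝ)| ≤ d := abs_le.2 ⟨g1', g2'⟩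
      have k2 : |q.t| ≤ d := abs_le.2 ⟨g3.le, g4⟩
      rcases h3 with h3 | h3 <;> linarith
  have hdsub : box d ⊆ box (a' + b' + 1) := by
    rintro q ⟨g1, g2, g3, g4⟩
    have h1 : (0 : ℝ) ≤ b' := Nat.cast_nonneg _
    have h2 : (0 : ℝ) ≤ u := Nat.cast_nonneg _
    refine ⟨by omega, by omega, ?_, ?_⟩ <;> push_cast <;> linarith
  calc haar.real Z ≤ haar.real (box (a' + b' + 1) \ box d) :=
        measureReal_mono hsub (haar_ne_top_of_subset_box Set.sdiff_subset)
    _ = haar.real (box (a' + b' + 1)) - haar.real (box d) := by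
        rw [measureReal_sdiff hdsub (measurableSet_box d) (haar_box_ne_top _)]
    _ = 8 * ((4 * b' + 2 * u + 2) * (2 * a' - 2 * b' - 2 * u)) := by
        rw [haar_real_box, haar_real_box, hd']; push_cast; rw [hd']; ring
    _ ≤ 128 * (a' * b') := by
        have h1 : (u : ℝ) ≤ b' := by exact_mod_cast hub
        have h2 : (1 : ℝ) ≤ u := by exact_mod_cast hu0
        have h3 : (8 : ℝ) * b' ≤ a' := by exact_mod_cast hab
        have : ((4 * b' + 2 * u + 2 : ℝ)) * (2 * a' - 2 * b' - 2 * u) ≤ (8 * b') * (2 * a') :=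
          mul_le_mul (by linarith) (by linarith) (by linarith) (by linarith)
        linarith

/-- For `A`, `B` made of atoms of `ξ_n`, the mean over `x ∈ D_{n+1}` of the measure of
`A C_{n+1} z(l) x ∩ B C_{n+1} y` is at most the product of the densities of `A` and `B` and the
measure of the overlap of two boxes, up to a small error. The translation `z(l)` is split evenly
between the two sets, because the translating elements have to lie in `F_{n+1}`. -/
theorem mean_overlap_le {n : ℕ} (hn : 1 ≤ n) (hab : 8 * b K.r (n + 1) ≤ a K.r (n + 1))
    {A B : Set GG} (hA : IsUnionOfAtoms (K.ξ n) A) (hB : IsUnionOfAtoms (K.ξ n) B)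
    {α : ℝ} (hα : ∀ e, haar.real (A ∩ {p | p.e = e}) ≤ α) {l : ℤ}
    (hl : |l| ≤ 2 * ((a K.r (n + 1) : ℤ) - b K.r (n + 1))) {y : GG} (hy : y ∈ K.D (n + 1)) :
    ∑ x ∈ K.D (n + 1), haar.real ((K.lift n A * {z l} * {x}) ∩ (K.lift n B * {y})) ≤
      (K.D (n + 1)).card * (haar.real (F K.r (n + 1)) * (1 / ((n + 1 : ℕ) : ℝ))
        + 128 * (a K.r (n + 1) * b K.r (n + 1))
        + 2 * ((2 * (n + 1 : ℕ) + 1) ^ 2 * α) / haar.real (S K.r (n + 1)) *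
          (haar.real B / (8 * (aTilde K.r n : ℝ) ^ 2) *
            (4 * aTilde K.r (n + 1) * (2 * aTilde K.r (n + 1) - |(l : ℝ)|
              + (b K.r (n + 1) + 3 * aTilde K.r n))))) := by
  set l₂ : ℤ := l / 2 with hl₂
  set l₁ : ℤ := l - l₂ with hl₁
  have hb0 : 0 < b K.r (n + 1) := (aTilde_pos K.r n).trans_le (aTilde_le_b K.r n)
  have ha0 : 0 < a K.r (n + 1) := by omega
  have hAF := subset_F_of_isUnionOfAtoms hn hA
  have hBF := subset_F_of_isUnionOfAtoms hn hB
  have hAm := measurableSet_of_isUnionOfAtoms hn hA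
  have hBm := measurableSet_of_isUnionOfAtoms hn hB
  have hLA := lift_subset_F hn hAF
  have hLB := lift_subset_F hn hBF
  have hLAm := measurableSet_lift (K := K) n hAm
  have hLBm := measurableSet_lift (K := K) n hBm
  obtain ⟨A₁, hA₁, hA₁u, hA₁in, hA₁out⟩ := exists_trim hn hA l₁
  obtain ⟨B₁, hB₁, hB₁u, hB₁in, hB₁out⟩ := exists_trim hn hB (-l₂)
  have hA₁m := measurableSet_of_isUnionOfAtoms (by omega) hA₁u
  have hB₁m := measurableSet_of_isUnionOfAtoms (by omega) hB₁u
  obtain ⟨y1, y2, y3, y4⟩ : y ∈ S K.r (n + 1) := K.D_subset (n + 1) (by omega) hy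
  have y1' : -(b K.r (n + 1) : ℝ) < y.k := by exact_mod_cast y1
  have y2' : (y.k : ℝ) ≤ b K.r (n + 1) := by exact_mod_cast y2
  have hba : (b K.r (n + 1) : ℝ) < a K.r (n + 1) := by exact_mod_cast (by omega)
  have hb0' : (0 : ℝ) < b K.r (n + 1) := by exact_mod_cast hb0
  rw [abs_le] at hl
  have hg : z l₁ ∈ F K.r (n + 1) := by
    refine ⟨?_, ?_, ?_, ?_⟩ <;> simp only [z]
    · omega
    · omega
    · linarith
    · linarith
  have hh : z (-l₂) * y ∈ F K.r (n + 1) := by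
    rw [z_mul]
    refine ⟨?_, ?_, ?_, ?_⟩ <;> dsimp only
    · omega
    · omega
    · linarith
    · linarith
  have hgS : A₁ * {z l₁} * S K.r (n + 1) ⊆ F K.r (n + 1) := by
    rintro _ ⟨_, ⟨p, hp, _, rfl, rfl⟩, σ, ⟨s1, s2, s3, s4⟩, rfl⟩
    have s1' : -(b K.r (n + 1) : ℝ) < σ.k := by exact_mod_cast s1
    have s2' : (σ.k : ℝ) ≤ b K.r (n + 1) := by exact_mod_cast s2
    obtain ⟨c1, c2⟩ := hA₁in p hp
    have c3 := abs_le.1 (le_refl |(p.k : ℝ) + l₁|)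
    have c4 := abs_le.1 (le_refl |p.t|)
    simp only [mul_z]
    refine ⟨?_, ?_, ?_, ?_⟩ <;> simp only [mul_def]
    · have : (-(a K.r (n + 1) : ℝ)) < p.k + l₁ + σ.k := by linarith
      exact_mod_cast this
    · have : (p.k : ℝ) + l₁ + σ.k ≤ a K.r (n + 1) := by linarith
      exact_mod_cast this
    · rcases sgn_cases p.e with h | h <;> rw [h] <;> linarith
    · rcases sgn_cases p.e with h | h <;> rw [h] <;> linarith
  have hhS : B₁ * {z (-l₂) * y} * S K.r (n + 1) ⊆ F K.r (n + 1) := by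
    rintro _ ⟨_, ⟨p, hp, _, rfl, rfl⟩, σ, ⟨s1, s2, s3, s4⟩, rfl⟩
    have s1' : -(b K.r (n + 1) : ℝ) < σ.k := by exact_mod_cast s1
    have s2' : (σ.k : ℝ) ≤ b K.r (n + 1) := by exact_mod_cast s2
    obtain ⟨c1, c2⟩ := hB₁in p hp
    have c3 := abs_le.1 (le_refl |(p.k : ℝ) + (-l₂ : ℤ)|)
    have c4 := abs_le.1 (le_refl |p.t|)
    simp only [z_mul]
    refine ⟨?_, ?_, ?_, ?_⟩ <;> simp only [mul_def]
    · have : (-(a K.r (n + 1) : ℝ)) < p.k + ((-l₂ : ℤ) + y.k) + σ.k := by linarith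
      exact_mod_cast this
    · have : (p.k : ℝ) + ((-l₂ : ℤ) + y.k) + σ.k ≤ a K.r (n + 1) := by linarith
      exact_mod_cast this
    · rcases sgn_cases p.e with h | h <;> rcases sgn_cases (p.e + y.e) with h' | h' <;>
        rw [h, h'] <;> linarith
    · rcases sgn_cases p.e with h | h <;> rcases sgn_cases (p.e + y.e) with h' | h' <;>
        rw [h, h'] <;> linarith
  have hdisc := K.D_discretizes (n + 1) (by omega) A₁ B₁ hA₁u hB₁u (z l₁) hg (z (-l₂) * y) hh
    hgS hhS
  set D := K.D (n + 1) with hD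
  set V : ℝ := haar.real B / (8 * (aTilde K.r n : ℝ) ^ 2) *
            (4 * aTilde K.r (n + 1) * (2 * aTilde K.r (n + 1) - |(l : ℝ)|
              + (b K.r (n + 1) + 3 * aTilde K.r n))) with hV
  set U : ℝ := 2 * ((2 * (n + 1 : ℕ) + 1) ^ 2 * α) with hU
  have hgm := measurableSet_mul_singleton hA₁m (z l₁)
  have hhm := measurableSet_mul_singleton hB₁m (z (-l₂) * y)
  have hα0 : 0 ≤ α := measureReal_nonneg.trans (hα 0)
  have hU0 : 0 ≤ U := by positivity
  have hFpos : 0 < haar.real (F K.r (n + 1)) := by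
    rw [F, haar_real_box]
    have : (0 : ℝ) < a K.r (n + 1) := by exact_mod_cast ha0
    positivity
  have hSpos : 0 < haar.real (S K.r (n + 1)) := by
    rw [S, haar_real_box]
    positivity
  -- the translates `A₁ z(l₁) x` lie in a strip, in which few copies of `B` are found
  set Q : Set GG := {q | |(q.k : ℝ) - l₁| ≤ aTilde K.r (n + 1)} with hQ
  have hstrip : haar.real ((B₁ * {z (-l₂) * y}) ∩ Q) ≤ V := by
    have hQm : MeasurableSet Q := by
      have : MeasurableSet (GG.k ⁻¹' {x : ℤ | |(x : ℝ) - l₁| ≤ aTilde K.r (n + 1)}) :=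
        measurable_k (.of_discrete)
      exact this
    set Q' : Set GG := (fun q => q * (z (-l₂) * y)) ⁻¹' Q
    have hQ'm : MeasurableSet Q' := measurable_mul_const _ hQm
    have hsub : (B₁ * {z (-l₂) * y}) ∩ Q ⊆ (K.lift n B ∩ Q') * {z (-l₂) * y} := by
      rintro _ ⟨⟨p, hp, _, rfl, rfl⟩, hq⟩
      exact ⟨p, ⟨hB₁ hp, hq⟩, _, rfl, rfl⟩
    have hfin : haar ((K.lift n B ∩ Q') * {z (-l₂) * y}) ≠ ⊤ := by
      rw [haar_mul_singleton (hLBm.inter hQ'm)]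
      exact haar_ne_top_of_subset_F (Set.inter_subset_left.trans hLB)
    refine (measureReal_mono hsub hfin).trans ?_
    rw [measureReal_def, haar_mul_singleton (hLBm.inter hQ'm), ← measureReal_def]
    refine haar_real_lift_inter_strip_le hn hBF hBm l ?_ ?_
    · rw [abs_le, aTilde_succ]; push_cast; constructor <;> omega
    · intro q hq
      have hq : |((q * (z (-l₂) * y)).k : ℝ) - l₁| ≤ aTilde K.r (n + 1) := hq
      rw [z_mul] at hq
      simp only [mul_def] at hq
      push_cast [hl₁] at hq
      rw [abs_le] at hq ⊢
      constructor <;> linarith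
  have hint := integral_overlap_le (r := K.r) (n := n + 1) (m := b K.r (n + 1)) (Q := Q) hgm hhm
    (by rw [haar_mul_singleton hB₁m]; exact haar_ne_top_of_subset_F (hB₁.trans hLB))
    (haar_real_cover_le hn hAF hAm hα hA₁ l₁) (by
      rintro x ⟨s1, s2, -, -⟩ _ ⟨_, ⟨p, hp, _, rfl, rfl⟩, x', hx', rfl⟩
      rw [Set.mem_singleton_iff] at hx'
      rw [hx']
      obtain ⟨f1, f2, -, -⟩ := hLA (hA₁ hp)
      change |(((p * z l₁ * x).k : ℤ) : ℝ) - l₁| ≤ aTilde K.r (n + 1)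
      rw [mul_z]
      simp only [mul_def]
      have : |p.k + l₁ + x.k - l₁| ≤ aTilde K.r (n + 1) := by
        rw [abs_le, aTilde_succ]; push_cast; constructor <;> omega
      exact_mod_cast this)
  have hmean : (1 / (D.card : ℝ)) * ∑ x ∈ D,
      haar.real ((A₁ * {z l₁} * {x}) ∩ (B₁ * {z (-l₂) * y})) ≤
      haar.real (F K.r (n + 1)) * (1 / ((n + 1 : ℕ) : ℝ)) +
        U / haar.real (S K.r (n + 1)) * V := by
    have hc : (0 : ℝ) < D.card := by exact_mod_cast D_card_pos (by omega)
    simp only [overlap_eq hgm hhm, Finset.sum_const, nsmul_eq_mul] at hdisc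
    have h1 := (abs_lt.1 hdisc).2
    simp only [overlap_eq hgm hhm] at hint
    have h2 : (1 / haar.real (S K.r (n + 1)) ^ 2) * ∫ p in S K.r (n + 1) ×ˢ S K.r (n + 1),
        haar.real ((A₁ * {z l₁} * {p.1}) ∩ (B₁ * {z (-l₂) * y})) / haar.real (F K.r (n + 1))
          ∂(haar.prod haar) ≤
        U / haar.real (S K.r (n + 1)) * V / haar.real (F K.r (n + 1)) := by
      calc _ ≤ (1 / haar.real (S K.r (n + 1)) ^ 2) * (haar.real (S K.r (n + 1)) *
            (U * haar.real ((B₁ * {z (-l₂) * y}) ∩ Q)) / haar.real (F K.r (n + 1))) := by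
            refine mul_le_mul_of_nonneg_left hint (by positivity)
        _ ≤ (1 / haar.real (S K.r (n + 1)) ^ 2) * (haar.real (S K.r (n + 1)) *
            (U * V) / haar.real (F K.r (n + 1))) := by gcongr
        _ = _ := by field_simp
    have h3 : (1 / (D.card : ℝ) ^ 2) * ∑ x ∈ D, (D.card : ℝ) *
        (haar.real ((A₁ * {z l₁} * {x}) ∩ (B₁ * {z (-l₂) * y})) / haar.real (F K.r (n + 1)))
        = (1 / (D.card : ℝ)) * (∑ x ∈ D,
          haar.real ((A₁ * {z l₁} * {x}) ∩ (B₁ * {z (-l₂) * y}))) /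
            haar.real (F K.r (n + 1)) := by
      rw [← Finset.mul_sum, ← Finset.sum_div]; field_simp
    rw [h3] at h1
    have h4 : (1 / (D.card : ℝ)) * (∑ x ∈ D,
          haar.real ((A₁ * {z l₁} * {x}) ∩ (B₁ * {z (-l₂) * y}))) /
            haar.real (F K.r (n + 1)) ≤ 1 / ((n + 1 : ℕ) : ℝ) +
        U / haar.real (S K.r (n + 1)) * V / haar.real (F K.r (n + 1)) := by linarith
    rw [div_le_iff₀ hFpos] at h4
    refine h4.trans_eq ?_
    field_simp
  -- the trimmed sets miss only a boundary layer of the overlap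
  set Z : Set GG := {q | |(q.k : ℝ)| ≤ a K.r (n + 1) + b K.r (n + 1) ∧
      |q.t| ≤ a K.r (n + 1) + b K.r (n + 1) ∧
      ((a K.r (n + 1) : ℝ) ≤ |(q.k : ℝ)| + 2 * aTilde K.r n + 3 * b K.r (n + 1) ∨
       (a K.r (n + 1) : ℝ) ≤ |q.t| + 2 * aTilde K.r n + 3 * b K.r (n + 1))} with hZ
  have hZle : haar.real Z ≤ 128 * (a K.r (n + 1) * b K.r (n + 1)) :=
    haar_real_boundary_le hab fun q hq => hq
  have hpoint : ∀ x ∈ D, haar.real ((K.lift n A * {z l} * {x}) ∩ (K.lift n B * {y})) ≤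
      haar.real ((A₁ * {z l₁} * {x}) ∩ (B₁ * {z (-l₂) * y})) +
        128 * (a K.r (n + 1) * b K.r (n + 1)) := by
    intro x hx
    obtain ⟨x1, x2, x3, x4⟩ : x ∈ S K.r (n + 1) := K.D_subset (n + 1) (by omega) hx
    have x1' : -(b K.r (n + 1) : ℝ) < x.k := by exact_mod_cast x1
    have x2' : (x.k : ℝ) ≤ b K.r (n + 1) := by exact_mod_cast x2
    have hEm : MeasurableSet ((K.lift n A * {z l} * {x}) ∩ (K.lift n B * {y})) :=
      (measurableSet_mul_singleton (measurableSet_mul_singleton hLAm _) _).inter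
        (measurableSet_mul_singleton hLBm _)
    rw [measureReal_def, ← haar_mul_singleton hEm (z (-l₂)), ← measureReal_def]
    have hsub : ((K.lift n A * {z l} * {x}) ∩ (K.lift n B * {y})) * {z (-l₂)} ⊆
        ((A₁ * {z l₁} * {x}) ∩ (B₁ * {z (-l₂) * y})) ∪ Z := by
      rintro _ ⟨q, ⟨⟨_, ⟨p, hp, _, rfl, rfl⟩, x', hx', hpq⟩, p', hp', y', hy', hpq'⟩, _, rfl, rfl⟩
      rw [Set.mem_singleton_iff] at hx' hy'
      rw [hx'] at hpq
      rw [hy'] at hpq'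
      have hpq : p * z l * x = q := hpq
      have hpq' : p' * y = q := hpq'
      change q * z (-l₂) ∈ _
      have e1 : q * z (-l₂) = p * z l₁ * x := by
        rw [← hpq, mul_z, mul_z, mul_z]
        simp only [mul_def]
        congr 1
        omega
      have e2 : q * z (-l₂) = p' * (z (-l₂) * y) := by
        rw [← hpq', mul_assoc, ← z_comm]
      by_cases h1 : p ∈ A₁ ∧ p' ∈ B₁
      · left
        refine ⟨?_, ?_⟩
        · rw [e1]; exact ⟨_, ⟨p, h1.1, _, rfl, rfl⟩, _, rfl, rfl⟩
        · rw [e2]; exact ⟨p', h1.2, _, rfl, rfl⟩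
      right
      obtain ⟨f1, f2, f3, f4⟩ := hLA hp
      obtain ⟨v1, v2, v3, v4⟩ := hLB hp'
      have hk1 : (q * z (-l₂)).k = p.k + l₁ + x.k := by rw [e1, mul_z]; rfl
      have ht1 : (q * z (-l₂)).t = p.t + sgn p.e * x.t := by rw [e1, mul_z]; rfl
      have hk2 : (q * z (-l₂)).k = p'.k + -l₂ + y.k := by
        rw [e2, z_mul]; simp only [mul_def]; ring
      have ht2 : (q * z (-l₂)).t = p'.t + sgn p'.e * y.t := by rw [e2, z_mul]; rfl
      generalize q * z (-l₂) = w at hk1 hk2 ht1 ht2 ⊢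
      have bk : |w.k| ≤ a K.r (n + 1) + b K.r (n + 1) := by
        rw [abs_le]; constructor <;> omega
      refine ⟨by exact_mod_cast bk, ?_, ?_⟩
      · rw [ht1, abs_le]
        rcases sgn_cases p.e with h | h <;> rw [h] <;> constructor <;> linarith
      · rw [not_and_or] at h1
        rcases h1 with h1 | h1
        · have hk1' : (w.k : ℝ) = p.k + l₁ + x.k := by rw [hk1]; push_cast; ring
          have i1 : |(p.k : ℝ) + l₁| ≤ |(w.k : ℝ)| + b K.r (n + 1) := by
            have : (p.k : ℝ) + l₁ = w.k - x.k := by linarith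
            rw [this]
            exact (abs_sub _ _).trans (by gcongr; exact abs_le.2 ⟨x1'.le, x2'⟩)
          have i2 : |p.t| ≤ |w.t| + b K.r (n + 1) := by
            have : p.t = w.t - sgn p.e * x.t := by linarith
            rw [this]
            refine (abs_sub _ _).trans ?_
            gcongr
            rw [abs_le]
            rcases sgn_cases p.e with h | h <;> rw [h] <;> constructor <;> linarith
          rcases hA₁out p hp h1 with h | h
          · left; linarith
          · right; linarith
        · have hk2' : (w.k : ℝ) = p'.k + (-l₂ : ℤ) + y.k := by rw [hk2]; push_cast; ring
          have i1 : |(p'.k : ℝ) + (-l₂ : ℤ)| ≤ |(w.k : ℝ)| + b K.r (n + 1) := by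
            have : (p'.k : ℝ) + (-l₂ : ℤ) = w.k - y.k := by linarith
            rw [this]
            exact (abs_sub _ _).trans (by gcongr; exact abs_le.2 ⟨y1'.le, y2'⟩)
          have i2 : |p'.t| ≤ |w.t| + b K.r (n + 1) := by
            have : p'.t = w.t - sgn p'.e * y.t := by linarith
            rw [this]
            refine (abs_sub _ _).trans ?_
            gcongr
            rw [abs_le]
            rcases sgn_cases p'.e with h | h <;> rw [h] <;> constructor <;> linarith
          rcases hB₁out p' hp' h1 with h | h
          · left; linarith
          · right; linarith
    have hZfin : haar Z ≠ ⊤ := by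
      refine haar_ne_top_of_subset_box (a := a K.r (n + 1) + b K.r (n + 1) + 1) ?_
      rintro q ⟨h1, h2, -⟩
      rw [abs_le] at h1 h2
      refine ⟨?_, ?_, ?_, ?_⟩
      · have : (-((a K.r (n + 1) + b K.r (n + 1) + 1 : ℕ) : ℝ)) < q.k := by push_cast; linarith
        exact_mod_cast this
      · have : (q.k : ℝ) ≤ ((a K.r (n + 1) + b K.r (n + 1) + 1 : ℕ) : ℝ) := by
          push_cast; linarith
        exact_mod_cast this
      · push_cast; linarith
      · push_cast; linarith
    have hfin : haar ((A₁ * {z l₁} * {x}) ∩ (B₁ * {z (-l₂) * y})) ≠ ⊤ := by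
      refine ((measure_mono Set.inter_subset_right).trans_lt ?_).ne
      rw [haar_mul_singleton hB₁m]
      exact (haar_ne_top_of_subset_F (hB₁.trans hLB)).lt_top
    calc _ ≤ _ := measureReal_mono hsub (measure_union_ne_top hfin hZfin)
      _ ≤ _ := measureReal_union_le _ _
      _ ≤ _ := by gcongr
  have hc : (0 : ℝ) < D.card := by exact_mod_cast D_card_pos (by omega)
  calc _ ≤ ∑ x ∈ D, (haar.real ((A₁ * {z l₁} * {x}) ∩ (B₁ * {z (-l₂) * y})) +
        128 * (a K.r (n + 1) * b K.r (n + 1))) := Finset.sum_le_sum hpoint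
    _ = D.card * ((1 / (D.card : ℝ)) * ∑ x ∈ D,
          haar.real ((A₁ * {z l₁} * {x}) ∩ (B₁ * {z (-l₂) * y})) +
        128 * (a K.r (n + 1) * b K.r (n + 1))) := by
        rw [Finset.sum_add_distrib, Finset.sum_const, nsmul_eq_mul]; field_simp
    _ ≤ _ := by
        refine mul_le_mul_of_nonneg_left ?_ hc.le
        linarith

end Construction

/-! ### Equidistribution along rows and balance of the two signs -/

namespace Construction

open GG Cstr

variable {K : Construction}

/-- Averages along a row against averages over `D × D`. -/
theorem abs_row_sum_sub_le {D : Finset GG} {σ : ℤ × ℤ → GG} {N : ℕ} (hN : 0 < N) {h h' : ℤ × ℤ}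
    (hσ : ∀ t < N, σ (h + ((t : ℤ), 0)) ∈ D) (hσ' : ∀ t < N, σ (h' + ((t : ℤ), 0)) ∈ D)
    (f : GG → GG → ℝ) {M : ℝ} (hf : ∀ x ∈ D, ∀ y ∈ D, |f x y| ≤ M) :
    |∑ t ∈ Finset.range N, f (σ (h + ((t : ℤ), 0))) (σ (h' + ((t : ℤ), 0)))
      - N * ((1 / (D.card : ℝ) ^ 2) * ∑ x ∈ D, ∑ y ∈ D, f x y)|
      ≤ N * (M * pairDiscrepancy D σ N h h') := by
  classical
  have hN' : (0 : ℝ) < N := by exact_mod_cast hN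
  set τ : ℕ → GG × GG := fun t => (σ (h + ((t : ℤ), 0)), σ (h' + ((t : ℤ), 0))) with hτ
  have h1 : ∑ t ∈ Finset.range N, f (σ (h + ((t : ℤ), 0))) (σ (h' + ((t : ℤ), 0)))
      = ∑ d ∈ D ×ˢ D, (((Finset.range N).filter fun t : ℕ => τ t = d).card : ℝ) * f d.1 d.2 := by
    rw [← Finset.sum_fiberwise_of_maps_to (s := Finset.range N) (t := D ×ˢ D) (g := τ)
      (fun t ht => Finset.mem_product.2
        ⟨hσ t (Finset.mem_range.1 ht), hσ' t (Finset.mem_range.1 ht)⟩)]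
    refine Finset.sum_congr rfl fun d _ => ?_
    rw [← nsmul_eq_mul, ← Finset.sum_const]
    refine Finset.sum_congr rfl fun t ht => ?_
    rw [← (Finset.mem_filter.1 ht).2]
  have h2 : ∑ x ∈ D, ∑ y ∈ D, f x y = ∑ d ∈ D ×ˢ D, f d.1 d.2 := by
    rw [Finset.sum_product]
  rw [h1, h2, Finset.mul_sum, Finset.mul_sum, ← Finset.sum_sub_distrib]
  refine (Finset.abs_sum_le_sum_abs _ _).trans ?_
  rw [pairDiscrepancy, Finset.mul_sum, Finset.mul_sum]
  refine Finset.sum_le_sum fun d hd => ?_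
  obtain ⟨hd1, hd2⟩ := Finset.mem_product.1 hd
  have e : (((Finset.range N).filter fun t : ℕ => τ t = d).card : ℝ) * f d.1 d.2
      - N * (1 / (D.card : ℝ) ^ 2 * f d.1 d.2)
      = N * (f d.1 d.2 * ((((Finset.range N).filter fun t : ℕ => τ t = d).card : ℝ) / N
        - 1 / (D.card : ℝ) ^ 2)) := by field_simp
  rw [e, abs_mul, abs_mul, abs_of_pos hN']
  have e2 : ((((Finset.range N).filter fun t : ℕ =>
        (σ (h + ((t : ℤ), 0)), σ (h' + ((t : ℤ), 0))) = d).card : ℕ) : ℝ) =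
        (((Finset.range N).filter fun t : ℕ => τ t = d).card : ℝ) := by
    congr
  gcongr
  exact hf d.1 hd1 d.2 hd2

/-- The atoms of one layer of `F_n` that stay in `F_n` after a translation by `S_n` fill most of
this layer. -/
theorem exists_layer {n : ℕ} (hn : 1 ≤ n) {c : ℕ} (hc : c + 2 * b K.r n + 2 = a K.r n)
    (e : ZMod 2) :
    ∃ T, IsUnionOfAtoms (K.ξ n) T ∧ (∀ p ∈ T, p.e = e) ∧ T * {1} * S K.r n ⊆ F K.r n ∧
      ∀ q ∈ box (c + b K.r n), q.e = e → q ∈ T := by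
  have hc' : (c : ℝ) + 2 * b K.r n + 2 = a K.r n := by exact_mod_cast hc
  have hb' : (0 : ℝ) ≤ b K.r n := Nat.cast_nonneg _
  have hn' : (1 : ℝ) ≤ n := by exact_mod_cast hn
  set I : Set (Set GG) := {α | α ∈ K.ξ n ∧ ∀ p ∈ α, p.e = e ∧
    |p.k| + b K.r n ≤ a K.r n ∧ |p.t| + b K.r n < a K.r n} with hI
  refine ⟨⋃ α ∈ I, α, isUnionOfAtoms_biUnion fun α hα =>
    isUnionOfAtoms_iff.2 fun x hx => ⟨α, hα.1, hx, subset_rfl⟩, ?_, ?_, ?_⟩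
  · intro p hp
    obtain ⟨α, hα, hp⟩ := Set.mem_iUnion₂.1 hp
    exact (hα.2 p hp).1
  · rintro _ ⟨_, ⟨p, hp, _, rfl, rfl⟩, σ, ⟨s1, s2, s3, s4⟩, rfl⟩
    obtain ⟨α, hα, hp⟩ := Set.mem_iUnion₂.1 hp
    obtain ⟨-, t2, t3⟩ := hα.2 p hp
    have c3 := abs_le.1 (le_refl |p.k|)
    have c4 := abs_le.1 (le_refl |p.t|)
    simp only [mul_one]
    refine ⟨?_, ?_, ?_, ?_⟩ <;> simp only [mul_def]
    · omega
    · omega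
    · rcases sgn_cases p.e with h | h <;> rw [h] <;> linarith
    · rcases sgn_cases p.e with h | h <;> rw [h] <;> linarith
  · rintro q ⟨q1, q2, q3, q4⟩ hqe
    push_cast at q1 q2 q3 q4
    have hqF : q ∈ F K.r n := ⟨by omega, by omega, by linarith, by linarith⟩
    rw [← K.ξ_cover n hn] at hqF
    obtain ⟨α, hα, hqα⟩ := hqF
    refine Set.mem_iUnion₂.2 ⟨α, ⟨hα, fun p hp => ?_⟩, hqα⟩
    obtain ⟨δ, hδ, hdist⟩ := K.ξ_diam n hn α hα
    have hd : distance p q < 1 := by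
      refine ((hdist p hp q hqα).trans_lt hδ).trans_le ?_
      rw [div_le_one (by linarith)]; exact hn'
    simp only [distance, max_lt_iff] at hd
    obtain ⟨⟨d1, d2⟩, d3⟩ := hd
    have hk : p.k = q.k := by
      have : |p.k - q.k| < 1 := by exact_mod_cast d1
      rw [abs_lt] at this; omega
    have he : p.e = e := by
      by_contra hne
      rw [if_neg (by rw [hqe]; exact hne)] at d3
      exact lt_irrefl _ d3
    rw [abs_lt] at d2
    refine ⟨he, ?_, ?_⟩
    · rw [hk]
      have : |q.k| ≤ c + b K.r n := abs_le.2 ⟨by omega, by omega⟩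
      omega
    · have : |p.t| < c + b K.r n + 1 := abs_lt.2 ⟨by linarith, by linarith⟩
      linarith

/-- About half of the points of `D_n` have a given sign: this is seen by comparing two layers of
`F_n`. -/
theorem card_layer_D_le {n : ℕ} (hn : 1 ≤ n) {c : ℕ} (hc : c + 2 * b K.r n + 2 = a K.r n)
    (hb : 0 < b K.r n) (e : ZMod 2) :
    (((K.D n).filter fun x => x.e = e).card : ℝ) * (c : ℝ) ^ 2 ≤
      (K.D n).card * ((1 / 2 + 2 / (n : ℝ)) * (a K.r n : ℝ) ^ 2) := by
  classical
  have hc' : (c : ℝ) + 2 * b K.r n + 2 = a K.r n := by exact_mod_cast hc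
  have hb' : (0 : ℝ) < b K.r n := by exact_mod_cast hb
  have hc0 : (0 : ℝ) ≤ c := Nat.cast_nonneg _
  obtain ⟨T, hTu, hTe, hTS, hTbig⟩ := exists_layer hn hc (0 : ZMod 2)
  obtain ⟨T', hTu', hTe', hTS', hTbig'⟩ := exists_layer hn hc e
  have hTm := measurableSet_of_isUnionOfAtoms hn hTu
  have hTm' := measurableSet_of_isUnionOfAtoms hn hTu'
  have hTF' := subset_F_of_isUnionOfAtoms hn hTu'
  have h1F : (1 : GG) ∈ F K.r n := zero_mem_box (by omega)
  have hdisc := K.D_discretizes n hn T T' hTu hTu' 1 h1F 1 h1F hTS hTS'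
  have hone : ∀ E : Set GG, E * {1} = E := fun E => by
    ext x; rw [mem_mul_singleton]; simp
  rw [hone, hone] at hdisc
  have hlayer : haar.real T' ≤ 4 * (a K.r n : ℝ) ^ 2 := by
    rw [← haar_real_box_layer _ e]
    exact measureReal_mono (fun p hp => ⟨hTF' hp, hTe' p hp⟩)
      (haar_ne_top_of_subset_box Set.inter_subset_left)
  have hint := integral_overlap_le (r := K.r) (n := n) (m := b K.r n) (A := T) (B := T')
    (Q := Set.univ) (U := 4 * (b K.r n : ℝ) ^ 2) hTm hTm'
    (haar_ne_top_of_subset_F hTF') (by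
      intro p
      rw [← haar_real_box_layer _ p.e]
      refine measureReal_mono ?_ (haar_ne_top_of_subset_box Set.inter_subset_left)
      rintro x ⟨hx, hpx⟩
      refine ⟨hx, ?_⟩
      have := hTe _ (mem_mul_singleton.1 hpx)
      simp only [mul_def, inv_def] at this
      change x.e = p.e
      rw [add_neg_eq_zero] at this
      exact this.symm) (fun _ _ _ _ => Set.mem_univ _)
  rw [Set.inter_univ] at hint
  set D := K.D n with hD
  have hDpos : (0 : ℝ) < D.card := by exact_mod_cast D_card_pos hn
  have ha' : (0 : ℝ) < a K.r n := by linarith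
  have hFval : haar.real (F K.r n) = 8 * (a K.r n : ℝ) ^ 2 := haar_real_box _
  have hSval : haar.real (S K.r n) = 8 * (b K.r n : ℝ) ^ 2 := haar_real_box _
  have hval : ∀ x y : ℝ, 0 < x → 0 < y → (1 / (8 * y ^ 2) ^ 2) *
      (8 * y ^ 2 * (4 * y ^ 2 * (4 * x ^ 2)) / (8 * x ^ 2)) = 1 / 4 := by
    intro x y hx hy
    field_simp
    norm_num
  have hquarter : (1 / haar.real (S K.r n) ^ 2) * ∫ p in S K.r n ×ˢ S K.r n,
      overlap K.r n T T' p.1 p.2 ∂(haar.prod haar) ≤ 1 / 4 := by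
    rw [← hval _ _ ha' hb', ← hFval, ← hSval]
    refine (mul_le_mul_of_nonneg_left hint (by positivity)).trans ?_
    change _ * (haar.real (S K.r n) * _ / _) ≤ _
    gcongr
  have hlow : ∀ x ∈ D, x.e = e → 4 * (c : ℝ) ^ 2 ≤ haar.real ((T * {x}) ∩ T') := by
    intro x hx hxe
    obtain ⟨s1, s2, s3, s4⟩ : x ∈ S K.r n := K.D_subset n hn hx
    rw [← haar_real_box_layer c e]
    refine measureReal_mono ?_ ((measure_mono Set.inter_subset_right).trans_lt
      (haar_ne_top_of_subset_F hTF').lt_top).ne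
    rintro q ⟨⟨q1, q2, q3, q4⟩, hqe⟩
    have hqe : q.e = e := hqe
    refine ⟨mem_mul_singleton.2 (hTbig _ ?_ ?_), hTbig' q ?_ hqe⟩
    · refine ⟨?_, ?_, ?_, ?_⟩ <;> simp only [mul_def, inv_def] <;> push_cast
      · omega
      · omega
      · rcases sgn_cases q.e with h | h <;> rcases sgn_cases x.e with h' | h' <;> rw [h, h'] <;>
          linarith
      · rcases sgn_cases q.e with h | h <;> rcases sgn_cases x.e with h' | h' <;> rw [h, h'] <;>
          linarith
    · simp only [mul_def, inv_def]
      rw [hqe, hxe, add_neg_cancel]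
    · refine ⟨?_, ?_, ?_, ?_⟩ <;> push_cast
      · omega
      · omega
      · linarith
      · linarith
  simp only [overlap_eq hTm hTm', Finset.sum_const, nsmul_eq_mul] at hdisc hquarter
  have h1 := (abs_lt.1 hdisc).2
  have h3 : (1 / (D.card : ℝ) ^ 2) * ∑ x ∈ D, (D.card : ℝ) *
      (haar.real ((T * {x}) ∩ T') / haar.real (F K.r n))
      = (∑ x ∈ D, haar.real ((T * {x}) ∩ T')) / (D.card * haar.real (F K.r n)) := by
    rw [← Finset.mul_sum, ← Finset.sum_div]; field_simp
  rw [h3] at h1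
  have h4 : (∑ x ∈ D, haar.real ((T * {x}) ∩ T')) / (D.card * haar.real (F K.r n))
      ≤ 1 / 4 + 1 / n := by linarith
  rw [div_le_iff₀ (by rw [hFval]; positivity), hFval] at h4
  have h5 : ((D.filter fun x => x.e = e).card : ℝ) * (4 * (c : ℝ) ^ 2) ≤
      ∑ x ∈ D, haar.real ((T * {x}) ∩ T') := by
    rw [← nsmul_eq_mul, ← Finset.sum_const]
    refine (Finset.sum_le_sum fun x hx => hlow x (Finset.mem_filter.1 hx).1
      (Finset.mem_filter.1 hx).2).trans ?_
    exact Finset.sum_le_sum_of_subset_of_nonneg (Finset.filter_subset _ _)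
      fun _ _ _ => measureReal_nonneg
  have h6 := h5.trans h4
  have e1 : (1 / 4 + 1 / (n : ℝ)) * (D.card * (8 * (a K.r n : ℝ) ^ 2))
      = 4 * (D.card * ((1 / 2 + 2 / (n : ℝ)) * (a K.r n : ℝ) ^ 2)) := by ring
  rw [e1] at h6
  linarith

/-- In a set of the form `A C_{n+1}` the two signs occur almost equally often. -/
theorem haar_real_lift_layer_le {n : ℕ} (hn : 1 ≤ n) {A : Set GG} (hA : A ⊆ F K.r n)
    (hm : MeasurableSet A) {θ : ℝ} (hθ0 : 0 ≤ θ)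
    (hθ : ∀ e, (((K.D n).filter fun x => x.e = e).card : ℝ) ≤ (K.D n).card * θ) (e : ZMod 2) :
    haar.real (K.lift n A ∩ {p | p.e = e}) ≤
      (θ + 1 / (n : ℝ) + 1 / (2 * K.r n + 1)) * haar.real (K.lift n A) := by
  classical
  have hn' : (1 : ℝ) ≤ n := by exact_mod_cast hn
  have hr := K.r_pos n
  have hr' : (1 : ℝ) ≤ K.r n := by exact_mod_cast hr
  set g : GG → ℝ := fun x => haar.real (A ∩ {p | p.e = e - x.e}) with hg
  have hAf := haar_ne_top_of_subset_F hA
  have hgA : ∀ x, g x ≤ haar.real A := fun x => measureReal_mono Set.inter_subset_left hAf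
  have hg0 : ∀ x, 0 ≤ g x := fun x => measureReal_nonneg
  set D := K.D n with hD
  have hDpos : (0 : ℝ) < D.card := by exact_mod_cast D_card_pos hn
  have hmean : ∑ x ∈ D, g x ≤ D.card * θ * haar.real A := by
    have hsum : ∑ x ∈ D, g x = ∑ e' : ZMod 2, ((D.filter fun x => x.e = e').card : ℝ) *
        haar.real (A ∩ {p | p.e = e - e'}) := by
      rw [← Finset.sum_fiberwise D (fun x => x.e)]
      refine Finset.sum_congr rfl fun e' _ => ?_
      rw [← nsmul_eq_mul, ← Finset.sum_const]
      exact Finset.sum_congr rfl fun x hx => by rw [hg]; simp only [(Finset.mem_filter.1 hx).2]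
    have hsplit : ∑ e' : ZMod 2, haar.real (A ∩ {p | p.e = e - e'}) = haar.real A := by
      rw [← Equiv.sum_comp (Equiv.subLeft e) (fun e' => haar.real (A ∩ {p | p.e = e - e'}))]
      simp only [Equiv.subLeft_apply, sub_sub_cancel]
      rw [← measureReal_biUnion_finset]
      · congr 1; ext x; simp
      · intro i _ j _ hij
        refine Set.disjoint_left.2 ?_
        rintro x ⟨-, h1⟩ ⟨-, h2⟩
        exact hij (h1.symm.trans h2)
      · exact fun i _ => hm.inter (measurable_e (measurableSet_singleton _))
    rw [hsum, ← hsplit, Finset.mul_sum]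
    exact Finset.sum_le_sum fun e' _ => mul_le_mul_of_nonneg_right (hθ e') measureReal_nonneg
  have hrow : ∀ j ∈ Finset.Icc (-(K.r n : ℤ)) (K.r n),
      ∑ i ∈ Finset.Icc (-(K.r n : ℤ)) (K.r n), g (K.s n (i, j)) ≤
        (2 * K.r n * (θ + 1 / n) + 1) * haar.real A := by
    intro j hj
    rw [Finset.mem_Icc] at hj
    have hre : ∑ i ∈ Finset.Icc (-(K.r n : ℤ)) (K.r n), g (K.s n (i, j))
        = ∑ t ∈ Finset.range (2 * K.r n + 1), g (K.s n ((-(K.r n : ℤ), j) + ((t : ℤ), 0))) := by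
      symm
      refine Finset.sum_bij (fun t _ => -(K.r n : ℤ) + t) ?_ ?_ ?_ ?_
      · intro t ht
        rw [Finset.mem_range] at ht
        rw [Finset.mem_Icc]
        omega
      · intro t _ t' _ h
        have h' : -(K.r n : ℤ) + t = -(K.r n : ℤ) + t' := h
        omega
      · intro i hi
        rw [Finset.mem_Icc] at hi
        exact ⟨(i + K.r n).toNat, by rw [Finset.mem_range]; omega, by omega⟩
      · intro t _
        simp
    rw [hre, Finset.sum_range_succ]
    have hmem : ∀ i : ℤ, -(K.r n : ℤ) ≤ i → i ≤ K.r n → (i, j) ∈ H K.r n :=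
      fun i h1 h2 => mem_H.2 ⟨⟨h1, h2⟩, hj⟩
    have hdis := K.s_equidistributed n hn (2 * K.r n) (by
        rw [div_lt_iff₀ (by positivity)]
        have h1 : (1 : ℝ) ≤ (n : ℝ) ^ 2 := one_le_pow₀ hn'
        have h2 := mul_le_mul_of_nonneg_left h1 (by linarith : (0 : ℝ) ≤ 2 * K.r n)
        push_cast
        linarith)
      (-(K.r n : ℤ), j) (hmem _ (by omega) (by omega))
      (-(K.r n : ℤ) + 1, j) (hmem _ (by omega) (by omega))
      (by intro h; have := congrArg Prod.fst h; simp at this)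
      (by
        simp only [Prod.mk_add_mk, add_zero]
        exact hmem _ (by push_cast; omega) (by push_cast; omega))
      (by
        simp only [Prod.mk_add_mk, add_zero]
        exact hmem _ (by push_cast; omega) (by push_cast; omega))
    have hav := abs_row_sum_sub_le (D := D) (σ := K.s n) (N := 2 * K.r n) (by omega)
      (h := (-(K.r n : ℤ), j)) (h' := (-(K.r n : ℤ) + 1, j))
      (by
        intro t ht
        simp only [Prod.mk_add_mk, add_zero]
        exact K.s_mem n hn _ (hmem _ (by omega) (by omega)))
      (by
        intro t ht
        simp only [Prod.mk_add_mk, add_zero]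
        exact K.s_mem n hn _ (hmem _ (by omega) (by omega)))
      (fun x _ => g x) (M := haar.real A)
      (fun x _ y _ => by rw [abs_of_nonneg (hg0 x)]; exact hgA x)
    have h1 := (abs_le.1 hav).2
    simp only [Finset.sum_const, nsmul_eq_mul] at h1
    have h2 : (1 / (D.card : ℝ) ^ 2) * ∑ x ∈ D, (D.card : ℝ) * g x ≤ θ * haar.real A := by
      rw [← Finset.mul_sum]
      calc _ ≤ (1 / (D.card : ℝ) ^ 2) * (D.card * (D.card * θ * haar.real A)) := by gcongr
        _ = _ := by field_simp
    have h3 : ((2 * K.r n : ℕ) : ℝ) * (haar.real A *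
        pairDiscrepancy D (K.s n) (2 * K.r n) (-(K.r n : ℤ), j) (-(K.r n : ℤ) + 1, j)) ≤
        ((2 * K.r n : ℕ) : ℝ) * (haar.real A * (1 / n)) := by
      have := measureReal_nonneg (μ := haar) (s := A)
      gcongr
    have h4 : ((2 * K.r n : ℕ) : ℝ) * ((1 / (D.card : ℝ) ^ 2) * ∑ x ∈ D, (D.card : ℝ) * g x) ≤
        ((2 * K.r n : ℕ) : ℝ) * (θ * haar.real A) := by gcongr
    have h5 := hgA (K.s n ((-(K.r n : ℤ), j) + (((2 * K.r n : ℕ) : ℤ), 0)))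
    push_cast at h1 h3 h4 h5 ⊢
    linarith
  have htotal : haar.real (K.lift n A ∩ {p | p.e = e}) ≤ ∑ h ∈ H K.r n, g (K.s n h) := by
    have hsub : K.lift n A ∩ {p | p.e = e} ⊆
        ⋃ h ∈ H K.r n, (A * {K.s n h * phi K.r n h}) ∩ {p | p.e = e} := by
      rintro x ⟨hx, hxe⟩
      obtain ⟨h, hh, hxh⟩ := mem_lift.1 hx
      exact Set.mem_biUnion (Finset.mem_coe.2 hh) ⟨hxh, hxe⟩
    refine (measureReal_mono hsub ?_).trans ((measureReal_biUnion_finset_le _ _).trans_eq ?_)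
    · refine haar_ne_top_of_subset_F (r := K.r) (n := n + 1) (Set.iUnion₂_subset fun h hh => ?_)
      exact Set.inter_subset_left.trans fun x hx => lift_subset_F hn hA (mem_lift.2 ⟨h, hh, hx⟩)
    · refine Finset.sum_congr rfl fun h _ => ?_
      rw [haar_real_mul_singleton_layer hm]
      simp [hg, mul_def, phi]
  have hlift : haar.real (K.lift n A) = (2 * K.r n + 1) ^ 2 * haar.real A := by
    rw [measureReal_def, haar_lift hn hA hm, ENNReal.toReal_mul, card_H, measureReal_def]
    congr 1
    push_cast
    simp only [ENNReal.toReal_pow]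
    norm_cast
  calc _ ≤ ∑ h ∈ H K.r n, g (K.s n h) := htotal
    _ = ∑ j ∈ Finset.Icc (-(K.r n : ℤ)) (K.r n), ∑ i ∈ Finset.Icc (-(K.r n : ℤ)) (K.r n),
        g (K.s n (i, j)) := by rw [H, Finset.sum_product_right]
    _ ≤ ∑ j ∈ Finset.Icc (-(K.r n : ℤ)) (K.r n),
        (2 * K.r n * (θ + 1 / n) + 1) * haar.real A := Finset.sum_le_sum hrow
    _ = (2 * K.r n + 1) * ((2 * K.r n * (θ + 1 / n) + 1) * haar.real A) := by
        have : ((K.r n : ℤ) + 1 - -(K.r n : ℤ)).toNat = 2 * K.r n + 1 := by omega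
        rw [Finset.sum_const, Int.card_Icc, this, nsmul_eq_mul]; push_cast; ring
    _ ≤ (2 * K.r n + 1) * (((2 * K.r n + 1) * (θ + 1 / n) + 1) * haar.real A) := by
        have : 0 ≤ haar.real A := measureReal_nonneg
        gcongr
        linarith
    _ = _ := by rw [hlift]; field_simp

end Construction

/-! ### Correlations along rows -/

namespace Construction

open GG Cstr

variable {K : Construction}

/-- The total overlap, over all pairs `h, h + (i, 0)` in `H_n`, of the copy of `A` with index `h`,
translated by `z(l)`, and the copy of `B` with index `h + (i, 0)`. The first component of `h` is
`-r_n + t`. -/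
noncomputable def rowSum (K : Construction) (n : ℕ) (A B : Set GG) (i : ℕ) (l : ℤ) : ℝ :=
  ∑ j ∈ Finset.Icc (-(K.r n : ℤ)) (K.r n), ∑ t ∈ Finset.range (2 * K.r n + 1 - i),
    haar.real ((A * {z l} * {K.s n ((-(K.r n : ℤ), j) + ((t : ℤ), 0))}) ∩
      (B * {K.s n ((-(K.r n : ℤ) + i, j) + ((t : ℤ), 0))}))

theorem row_mem_H {r : ℕ → ℕ} {n i t : ℕ} {j : ℤ} (hj : j ∈ Finset.Icc (-(r n : ℤ)) (r n))
    (ht : t < 2 * r n + 1 - i) :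
    ((-(r n : ℤ), j) + ((t : ℤ), 0) : ℤ × ℤ) ∈ H r n ∧
      ((-(r n : ℤ) + i, j) + ((t : ℤ), 0) : ℤ × ℤ) ∈ H r n := by
  rw [Finset.mem_Icc] at hj
  simp only [Prod.mk_add_mk, add_zero, mem_H]
  omega

theorem a_le_aTilde (r : ℕ → ℕ) {n : ℕ} (hn : 1 ≤ n) : a r n ≤ aTilde r n := by
  obtain ⟨m, rfl⟩ : ∃ m, n = m + 1 := ⟨n - 1, by omega⟩
  rw [aTilde_succ]; omega

/-- The ratio of `b_{n+1}` and `a_{n+1}`. -/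
noncomputable def ratio (r : ℕ → ℕ) (n : ℕ) : ℝ := (2 * n + 1) / (2 * r n + 1)

theorem ratio_nonneg (r : ℕ → ℕ) (n : ℕ) : 0 ≤ ratio r n := by
  unfold ratio; positivity

theorem b_eq_ratio_mul (r : ℕ → ℕ) (n : ℕ) :
    (b r (n + 1) : ℝ) = ratio r n * a r (n + 1) := by
  simp only [b, a, ratio]
  push_cast
  field_simp

theorem aTilde_sub_a_le (r : ℕ → ℕ) (n : ℕ) : aTilde r (n + 1) ≤ a r (n + 1) + 2 * b r (n + 1) := by
  have : n + 1 ≤ b r (n + 1) := by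
    simp only [b]; nlinarith [aTilde_pos r n]
  rw [aTilde_succ]; omega

theorem overlap_le_F {n : ℕ} {A B : Set GG} (hB : B ⊆ F K.r n) (hBm : MeasurableSet B)
    (l : ℤ) (x y : GG) :
    haar.real ((A * {z l} * {x}) ∩ (B * {y})) ≤ haar.real (F K.r n) := by
  have h1 : haar (B * {y}) = haar B := haar_mul_singleton hBm y
  have hne : haar (B * {y}) ≠ ⊤ := by rw [h1]; exact haar_ne_top_of_subset_F hB
  calc _ ≤ haar.real (B * {y}) := measureReal_mono Set.inter_subset_right hne
    _ = haar.real B := by rw [measureReal_def, h1, measureReal_def]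
    _ ≤ _ := measureReal_mono hB (haar_box_ne_top _)

theorem overlap_le_box {n : ℕ} (hn : 1 ≤ n) {A B : Set GG} (hA : A ⊆ F K.r n) (hB : B ⊆ F K.r n)
    {l : ℤ} (hl : |l| ≤ 2 * aTilde K.r n) {x y : GG} (hx : x ∈ S K.r n) (hy : y ∈ S K.r n) :
    haar.real ((A * {z l} * {x}) ∩ (B * {y})) ≤
      4 * aTilde K.r n * (2 * aTilde K.r n - |(l : ℝ)|) := by
  have h0 := haar_real_box_inter (aTilde K.r n) (x := l) (y := 0) (by simpa using hl)
  simp only [Int.cast_zero, sub_zero] at h0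
  rw [← h0]
  refine measureReal_mono ?_ ?_
  · rintro q ⟨⟨_, ⟨p, hp, _, rfl, rfl⟩, x', hx', hq⟩, p', hp', y', hy', hq'⟩
    rw [Set.mem_singleton_iff] at hx' hy'
    subst hx' hy'
    have hq : p * z l * x' = q := hq
    have hq' : p' * y' = q := hq'
    have w1 := mem_window (g := 1) (by simp [one_def]) (by simp [one_def]; omega) hn (hA hp) hx
    have w2 := mem_window (g := 1) (by simp [one_def]) (by simp [one_def]; omega) hn (hB hp') hy
    rw [one_mul] at w1 w2
    refine ⟨⟨p * x', w1, _, rfl, ?_⟩, ⟨q, hq' ▸ w2, _, rfl, ?_⟩⟩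
    · change p * x' * z l = q
      rw [← hq, mul_assoc, mul_assoc, z_comm]
    · change q * z 0 = q
      rw [mul_z]; simp
  · refine ((measure_mono Set.inter_subset_left).trans_lt ?_).ne
    rw [haar_mul_singleton (measurableSet_box _)]
    exact (haar_box_ne_top _).lt_top

/-- Along a long row the pairs `(s(h), s(h + (i, 0)))`, `i ≥ 1`, are equidistributed in `D × D`. -/
theorem long_row_le {n : ℕ} (hn : 1 ≤ n) {i : ℕ} (hi : 1 ≤ i) {j : ℤ}
    (hj : j ∈ Finset.Icc (-(K.r n : ℤ)) (K.r n))
    (hlong : (K.r n : ℝ) / (n : ℝ) ^ 2 < (2 * K.r n + 1 - i : ℕ)) (f : GG → GG → ℝ) {M : ℝ}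
    (hf : ∀ x ∈ K.D n, ∀ y ∈ K.D n, |f x y| ≤ M) :
    ∑ t ∈ Finset.range (2 * K.r n + 1 - i), f (K.s n ((-(K.r n : ℤ), j) + ((t : ℤ), 0)))
        (K.s n ((-(K.r n : ℤ) + i, j) + ((t : ℤ), 0))) ≤
      (2 * K.r n + 1 - i : ℕ) * ((1 / ((K.D n).card : ℝ) ^ 2) *
        ∑ x ∈ K.D n, ∑ y ∈ K.D n, f x y + M * (1 / n)) := by
  set N : ℕ := 2 * K.r n + 1 - i with hN
  have hN0 : 0 < N := by
    have : (0 : ℝ) < N := lt_of_le_of_lt (by positivity) hlong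
    exact_mod_cast this
  have hmem := fun t (ht : t < N) => row_mem_H (r := K.r) (i := i) hj ht
  have hlast := hmem (N - 1) (by omega)
  have hcast : (((N - 1 : ℕ) : ℤ), (0 : ℤ)) = ((N : ℤ) - 1, 0) := by
    rw [Nat.cast_sub (by omega)]; simp
  rw [hcast] at hlast
  have hfirst := hmem 0 hN0
  have hzero : (((0 : ℕ) : ℤ), (0 : ℤ)) = 0 := rfl
  rw [hzero, add_zero, add_zero] at hfirst
  have hdis := K.s_equidistributed n hn N hlong _ hfirst.1 _ hfirst.2
    (by intro h; have := congrArg Prod.fst h; simp only at this; omega) hlast.1 hlast.2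
  have hrow := (abs_le.1 (abs_row_sum_sub_le hN0
    (fun t ht => K.s_mem n hn _ (hmem t ht).1)
    (fun t ht => K.s_mem n hn _ (hmem t ht).2) f hf)).2
  have hM : 0 ≤ M := (abs_nonneg _).trans
    (hf _ (K.s_mem n hn _ hfirst.1) _ (K.s_mem n hn _ hfirst.1))
  have h3 : (N : ℝ) * (M * pairDiscrepancy (K.D n) (K.s n) N (-(K.r n : ℤ), j)
      (-(K.r n : ℤ) + i, j)) ≤ N * (M * (1 / n)) := by gcongr
  linarith

set_option maxHeartbeats 400000 in
/-- Correlations along a row: for `i ≥ 1` the pairs `(s(h), s(h + (i, 0)))` are equidistributed in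
`D × D`, so that the averaged estimate applies, unless the row is short or the overlap is small. -/
theorem row_le {n : ℕ} (hn : 1 ≤ n) (hab : 8 * b K.r (n + 1) ≤ a K.r (n + 1))
    {A B : Set GG} (hA : IsUnionOfAtoms (K.ξ n) A) (hB : IsUnionOfAtoms (K.ξ n) B)
    {α : ℝ} (hα : ∀ e, haar.real (A ∩ {p | p.e = e}) ≤ α)
    (hα' : α ≤ 8 * (aTilde K.r n : ℝ) ^ 2) {i : ℕ} (hi : 1 ≤ i) {l : ℤ}
    (hl : |l| ≤ 2 * aTilde K.r (n + 1)) {j : ℤ}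
    (hj : j ∈ Finset.Icc (-(K.r (n + 1) : ℤ)) (K.r (n + 1))) :
    ∑ t ∈ Finset.range (2 * K.r (n + 1) + 1 - i),
      haar.real ((K.lift n A * {z l} *
          {K.s (n + 1) ((-(K.r (n + 1) : ℤ), j) + ((t : ℤ), 0))}) ∩
        (K.lift n B * {K.s (n + 1) ((-(K.r (n + 1) : ℤ) + i, j) + ((t : ℤ), 0))})) ≤
    (2 * K.r (n + 1) + 1 - i : ℕ) *
        (2 * ((2 * (n + 1 : ℕ) + 1) ^ 2 * α) / haar.real (S K.r (n + 1)) *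
          (haar.real B / (8 * (aTilde K.r n : ℝ) ^ 2)) *
          (4 * aTilde K.r (n + 1) * (2 * aTilde K.r (n + 1) - |(l : ℝ)|)))
      + (2 * K.r (n + 1) + 1) *
        ((24 / ((n + 1 : ℕ) : ℝ) + 300 * ratio K.r n) * (aTilde K.r (n + 1) : ℝ) ^ 2) := by
  set N : ℕ := 2 * K.r (n + 1) + 1 - i with hN
  set u : ℝ := ((aTilde K.r n : ℕ) : ℝ) with hu
  set v : ℝ := ((aTilde K.r (n + 1) : ℕ) : ℝ) with hv
  set β : ℝ := ((b K.r (n + 1) : ℕ) : ℝ) with hβ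
  set a' : ℝ := ((a K.r (n + 1) : ℕ) : ℝ) with ha'
  set m : ℝ := ((n + 1 : ℕ) : ℝ) with hm
  set q : ℝ := ratio K.r n with hq
  set ρ : ℝ := 2 * ((2 * m + 1) ^ 2 * α) / haar.real (S K.r (n + 1)) with hρ
  set δ : ℝ := haar.real B / (8 * u ^ 2) with hδ
  set W : ℝ := 4 * v * (2 * v - |(l : ℝ)|) with hW
  have hAF := subset_F_of_isUnionOfAtoms hn hA
  have hBF := subset_F_of_isUnionOfAtoms hn hB
  have hAm := measurableSet_of_isUnionOfAtoms hn hA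
  have hBm := measurableSet_of_isUnionOfAtoms hn hB
  have hLA := lift_subset_F hn hAF
  have hLB := lift_subset_F hn hBF
  have hLBm := measurableSet_lift (K := K) n hBm
  have hu0 : 0 < u := by rw [hu]; exact_mod_cast aTilde_pos K.r n
  have hv0 : 0 < v := by rw [hv]; exact_mod_cast aTilde_pos K.r (n + 1)
  have hub : u ≤ β := by rw [hu, hβ]; exact_mod_cast aTilde_le_b K.r n
  have hba : β = q * a' := b_eq_ratio_mul K.r n
  have hav : a' ≤ v := by rw [ha', hv]; exact_mod_cast a_le_aTilde K.r (by omega)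
  have hva : v ≤ a' + 2 * β := by
    rw [ha', hv, hβ]; exact_mod_cast aTilde_sub_a_le K.r n
  have ha0 : 0 ≤ a' := Nat.cast_nonneg _
  have hq0 : 0 ≤ q := ratio_nonneg _ _
  have hβv : β ≤ q * v := by rw [hba]; gcongr
  have hm2 : (2 : ℝ) ≤ m := by rw [hm]; exact_mod_cast (by omega)
  have hα0 : 0 ≤ α := measureReal_nonneg.trans (hα 0)
  have hl' : |(l : ℝ)| ≤ 2 * v := by rw [hv]; exact_mod_cast hl
  have hW0 : 0 ≤ W := by
    have : 0 ≤ 2 * v - |(l : ℝ)| := by linarith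
    positivity
  have hδ0 : 0 ≤ δ := div_nonneg measureReal_nonneg (by positivity)
  have hδ1 : δ ≤ 1 := by
    rw [hδ, div_le_one (by positivity), hu, ← haar_real_box]
    exact measureReal_mono (hBF.trans (F_subset_window K.r hn)) (haar_box_ne_top _)
  have hρ0 : 0 ≤ ρ := div_nonneg (by positivity) measureReal_nonneg
  have hbm : β = (2 * m - 1) * u := by
    rw [hβ, hm, hu]; simp only [b]; push_cast; ring
  have hρ6 : ρ ≤ 6 := by
    have hS : haar.real (S K.r (n + 1)) = 8 * β ^ 2 := haar_real_box _
    have h2m : 0 < 2 * m - 1 := by linarith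
    rw [hρ, hS, hbm, div_le_iff₀ (by positivity)]
    have h1 : (2 * m + 1) ^ 2 ≤ 3 * (2 * m - 1) ^ 2 := by nlinarith
    calc 2 * ((2 * m + 1) ^ 2 * α) ≤ 2 * (3 * (2 * m - 1) ^ 2 * (8 * u ^ 2)) := by gcongr
      _ = 6 * (8 * ((2 * m - 1) * u) ^ 2) := by ring
  have hF : haar.real (F K.r (n + 1)) = 8 * a' ^ 2 := haar_real_box _
  have hFv : haar.real (F K.r (n + 1)) ≤ 8 * v ^ 2 := by rw [hF]; gcongr
  have hNr : (N : ℝ) ≤ 2 * K.r (n + 1) + 1 := by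
    have : N ≤ 2 * K.r (n + 1) + 1 := by omega
    exact_mod_cast this
  have hmain0 : 0 ≤ (N : ℝ) * (ρ * δ * W) := by positivity
  have herr0 : 0 ≤ (2 * (K.r (n + 1) : ℝ) + 1) * ((24 / m + 300 * q) * v ^ 2) := by positivity
  -- if `l` is large, the boxes hardly overlap
  by_cases hbig : 2 * ((a K.r (n + 1) : ℤ) - b K.r (n + 1)) < |l|
  · have hWs : W ≤ 300 * q * v ^ 2 := by
      have h1 : 2 * (a' - β) < |(l : ℝ)| := by rw [ha', hβ]; exact_mod_cast hbig
      calc W ≤ 4 * v * (6 * β) := by rw [hW]; gcongr; linarith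
        _ ≤ 4 * v * (6 * (q * v)) := by gcongr
        _ ≤ 300 * q * v ^ 2 := by
          have : 0 ≤ q * v ^ 2 := by positivity
          linarith
    calc _ ≤ ∑ t ∈ Finset.range N, W := by
          refine Finset.sum_le_sum fun t ht => ?_
          obtain ⟨h1, h2⟩ := row_mem_H hj (Finset.mem_range.1 ht)
          exact overlap_le_box (by omega) hLA hLB hl (K.s_mem_S (by omega) h1)
            (K.s_mem_S (by omega) h2)
      _ = N * W := by simp
      _ ≤ (2 * K.r (n + 1) + 1) * ((24 / m + 300 * q) * v ^ 2) := by
          have : 0 ≤ 24 / m * v ^ 2 := by positivity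
          gcongr
          linarith
      _ ≤ _ := by linarith
  push Not at hbig
  -- short rows contribute few terms
  by_cases hshort : (N : ℝ) ≤ (K.r (n + 1) : ℝ) / m ^ 2
  · calc _ ≤ ∑ t ∈ Finset.range N, 8 * v ^ 2 :=
          Finset.sum_le_sum fun t _ => (overlap_le_F hLB hLBm _ _ _).trans hFv
      _ = N * (8 * v ^ 2) := by simp
      _ ≤ (K.r (n + 1) : ℝ) / m ^ 2 * (8 * v ^ 2) := by gcongr
      _ ≤ (2 * K.r (n + 1) + 1) * ((24 / m) * v ^ 2) := by
          have h1 : (K.r (n + 1) : ℝ) / m ^ 2 ≤ (K.r (n + 1) : ℝ) / m := by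
            gcongr
            nlinarith
          have h2 : (0 : ℝ) ≤ K.r (n + 1) / m := by positivity
          have h3 : (2 * (K.r (n + 1) : ℝ) + 1) * ((24 / m) * v ^ 2) =
            48 * (K.r (n + 1) / m * v ^ 2) + 24 / m * v ^ 2 := by ring
          have h4 : (0 : ℝ) ≤ 24 / m * v ^ 2 := by positivity
          have h5 : (0 : ℝ) ≤ K.r (n + 1) / m * v ^ 2 := by positivity
          have h6 : (K.r (n + 1) : ℝ) / m ^ 2 * (8 * v ^ 2) ≤ K.r (n + 1) / m * (8 * v ^ 2) := by
            gcongr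
          linarith
      _ ≤ (2 * K.r (n + 1) + 1) * ((24 / m + 300 * q) * v ^ 2) := by
          gcongr
          have : 0 ≤ 300 * q := by positivity
          linarith
      _ ≤ _ := by linarith
  push Not at hshort
  set D := K.D (n + 1) with hD
  have hDpos : (0 : ℝ) < D.card := by exact_mod_cast D_card_pos (by omega)
  set f : GG → GG → ℝ := fun x y => haar.real ((K.lift n A * {z l} * {x}) ∩ (K.lift n B * {y}))
    with hf
  have hrow := long_row_le (K := K) (n := n + 1) (by omega) hi hj hshort f (M := 8 * v ^ 2)
    (fun x _ y _ => by
      rw [hf]; simp only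
      rw [abs_of_nonneg measureReal_nonneg]
      exact (overlap_le_F hLB hLBm _ _ _).trans hFv)
  set E : ℝ := 8 * v ^ 2 * (1 / m) + 128 * (q * v ^ 2) + ρ * δ * W + 96 * (q * v ^ 2) with hE
  have hmean : (1 / (D.card : ℝ) ^ 2) * ∑ x ∈ D, ∑ y ∈ D, f x y ≤ E := by
    have h1 : ∑ x ∈ D, ∑ y ∈ D, f x y ≤ ∑ y ∈ D, D.card * E := by
      rw [Finset.sum_comm]
      refine Finset.sum_le_sum fun y hy => ?_
      refine (mean_overlap_le hn hab hA hB hα hbig hy).trans ?_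
      refine mul_le_mul_of_nonneg_left ?_ hDpos.le
      have e1 : haar.real (F K.r (n + 1)) * (1 / m) ≤ 8 * v ^ 2 * (1 / m) := by gcongr
      have e2 : 128 * (a' * β) ≤ 128 * (q * v ^ 2) := by
        calc 128 * (a' * β) ≤ 128 * (v * (q * v)) := by gcongr
          _ = _ := by ring
      have e3 : ρ * (δ * (4 * v * (2 * v - |(l : ℝ)| + (β + 3 * u))))
          ≤ ρ * δ * W + 96 * (q * v ^ 2) := by
        have : ρ * δ * (4 * v * (β + 3 * u)) ≤ 6 * 1 * (4 * v * (4 * (q * v))) := by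
          gcongr
          linarith
        calc ρ * (δ * (4 * v * (2 * v - |(l : ℝ)| + (β + 3 * u))))
            = ρ * δ * W + ρ * δ * (4 * v * (β + 3 * u)) := by rw [hW]; ring
          _ ≤ ρ * δ * W + 6 * 1 * (4 * v * (4 * (q * v))) := by linarith
          _ = _ := by ring
      linarith
    rw [Finset.sum_const, nsmul_eq_mul] at h1
    refine (mul_le_mul_of_nonneg_left h1 (by positivity)).trans_eq ?_
    rw [one_div, sq, ← mul_assoc _ _ E, inv_mul_cancel_left₀ (by positivity)]
  have h2 : (N : ℝ) * ((1 / (D.card : ℝ) ^ 2) * ∑ x ∈ D, ∑ y ∈ D, f x y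
      + 8 * v ^ 2 * (1 / m)) ≤ N * (E + 8 * v ^ 2 * (1 / m)) := by gcongr
  have h4 : (N : ℝ) * (E + 8 * v ^ 2 * (1 / m)) =
      N * (ρ * δ * W) + N * ((16 / m + 224 * q) * v ^ 2) := by rw [hE]; ring
  have h5 : (N : ℝ) * ((16 / m + 224 * q) * v ^ 2) ≤
      (2 * K.r (n + 1) + 1) * ((24 / m + 300 * q) * v ^ 2) := by
    gcongr <;> norm_num
  linarith

theorem rowSum_le {n : ℕ} (hn : 1 ≤ n) (hab : 8 * b K.r (n + 1) ≤ a K.r (n + 1))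
    {A B : Set GG} (hA : IsUnionOfAtoms (K.ξ n) A) (hB : IsUnionOfAtoms (K.ξ n) B)
    {α : ℝ} (hα : ∀ e, haar.real (A ∩ {p | p.e = e}) ≤ α)
    (hα' : α ≤ 8 * (aTilde K.r n : ℝ) ^ 2) {i : ℕ} (hi : 1 ≤ i) {l : ℤ}
    (hl : |l| ≤ 2 * aTilde K.r (n + 1)) :
    K.rowSum (n + 1) (K.lift n A) (K.lift n B) i l ≤ (2 * K.r (n + 1) + 1) *
    ((2 * K.r (n + 1) + 1 - i : ℕ) *
        (2 * ((2 * (n + 1 : ℕ) + 1) ^ 2 * α) / haar.real (S K.r (n + 1)) *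
          (haar.real B / (8 * (aTilde K.r n : ℝ) ^ 2)) *
          (4 * aTilde K.r (n + 1) * (2 * aTilde K.r (n + 1) - |(l : ℝ)|)))
      + (2 * K.r (n + 1) + 1) *
        ((24 / ((n + 1 : ℕ) : ℝ) + 300 * ratio K.r n) * (aTilde K.r (n + 1) : ℝ) ^ 2)) := by
  refine (Finset.sum_le_sum fun j hj => row_le hn hab hA hB hα hα' hi hl hj).trans_eq ?_
  have : ((K.r (n + 1) : ℤ) + 1 - -(K.r (n + 1) : ℤ)).toNat = 2 * K.r (n + 1) + 1 := by omega
  rw [Finset.sum_const, Int.card_Icc, this, nsmul_eq_mul]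
  push_cast
  ring

end Construction

/-! ### Asymptotic form of the correlation estimate -/

namespace Construction

open GG Cstr

variable {K : Construction}

theorem tendsto_ratio (K : Construction) : Tendsto (ratio K.r) atTop (𝓝 0) := by
  have h := (K.r_growth.const_mul 3)
  rw [mul_zero] at h
  refine squeeze_zero' (Eventually.of_forall fun n => ratio_nonneg _ _) ?_ h
  filter_upwards [eventually_ge_atTop 1] with n hn
  have hr : (0 : ℝ) < K.r n := by exact_mod_cast K.r_pos n
  have hn' : (1 : ℝ) ≤ n := by exact_mod_cast hn
  have h4 : (n : ℝ) ≤ (n : ℝ) ^ 4 := le_self_pow₀ hn' (by norm_num)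
  unfold ratio
  rw [← mul_div_assoc]
  gcongr
  · linarith
  · linarith

theorem eventually_b_le_a (K : Construction) :
    ∀ᶠ n in atTop, 8 * b K.r (n + 1) ≤ a K.r (n + 1) := by
  filter_upwards [(tendsto_ratio K).eventually_le_const (show (0 : ℝ) < 1 / 8 by norm_num)]
    with n hn
  have h := b_eq_ratio_mul K.r n
  have h0 : (0 : ℝ) ≤ a K.r (n + 1) := Nat.cast_nonneg _
  have h1 : (8 : ℝ) * b K.r (n + 1) ≤ a K.r (n + 1) := by
    rw [h]; nlinarith
  exact_mod_cast h1

theorem eventually_card_layer_D_le (K : Construction) {ε : ℝ} (hε : 0 < ε) :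
    ∀ᶠ n in atTop, ∀ e, (((K.D n).filter fun x => x.e = e).card : ℝ) ≤
      (K.D n).card * (1 / 2 + ε) := by
  suffices h : ∀ᶠ n in atTop, ∀ e, (((K.D (n + 1)).filter fun x => x.e = e).card : ℝ) ≤
      (K.D (n + 1)).card * (1 / 2 + ε) by
    rw [← eventually_map (m := fun n => n + 1)
      (P := fun n => ∀ e, (((K.D n).filter fun x => x.e = e).card : ℝ) ≤
        (K.D n).card * (1 / 2 + ε)), map_add_atTop_eq_nat] at h
    exact h
  have hlim : Tendsto (fun n : ℕ => (1 / 2 + 2 / ((n + 1 : ℕ) : ℝ)) / (1 - 4 * ratio K.r n) ^ 2)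
      atTop (𝓝 ((1 / 2 + 0) / (1 - 4 * 0) ^ 2)) := by
    refine Tendsto.div ?_ (((tendsto_ratio K).const_mul 4).const_sub 1 |>.pow 2) (by norm_num)
    refine Tendsto.const_add _ ?_
    exact (tendsto_const_div_atTop_nhds_zero_nat 2).comp (tendsto_add_atTop_nat 1)
  have hlt := hlim.eventually_le_const (show (1 / 2 + 0) / (1 - 4 * 0) ^ 2 < 1 / 2 + ε by
    norm_num; exact hε)
  filter_upwards [hlt, eventually_b_le_a K] with n h1 h2 e
  have hb0 : 0 < b K.r (n + 1) := (aTilde_pos K.r n).trans_le (aTilde_le_b K.r n)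
  have hcard := card_layer_D_le (K := K) (n := n + 1) (by omega)
    (c := a K.r (n + 1) - 2 * b K.r (n + 1) - 2) (by omega) hb0 e
  set c := a K.r (n + 1) - 2 * b K.r (n + 1) - 2 with hc
  have ha0 : (0 : ℝ) < a K.r (n + 1) := by exact_mod_cast (by omega)
  have hq := b_eq_ratio_mul K.r n
  have h8 : (8 : ℝ) * b K.r (n + 1) ≤ a K.r (n + 1) := by exact_mod_cast h2
  have hca : (1 - 4 * ratio K.r n) * a K.r (n + 1) ≤ c := by
    have : a K.r (n + 1) ≤ c + 4 * b K.r (n + 1) := by omega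
    have : (a K.r (n + 1) : ℝ) ≤ c + 4 * b K.r (n + 1) := by exact_mod_cast this
    linarith
  have hq1 : 0 < 1 - 4 * ratio K.r n := by
    have : 0 < (1 - 4 * ratio K.r n) * a K.r (n + 1) := by linarith
    exact pos_of_mul_pos_left this ha0.le
  rw [div_le_iff₀ (by positivity)] at h1
  have hD0 : (0 : ℝ) ≤ (K.D (n + 1)).card := Nat.cast_nonneg _
  have hpos : 0 < ((1 - 4 * ratio K.r n) * a K.r (n + 1)) ^ 2 := by positivity
  refine le_of_mul_le_mul_right ?_ hpos
  calc (((K.D (n + 1)).filter fun x => x.e = e).card : ℝ) *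
        ((1 - 4 * ratio K.r n) * a K.r (n + 1)) ^ 2
      ≤ (((K.D (n + 1)).filter fun x => x.e = e).card : ℝ) * (c : ℝ) ^ 2 := by gcongr
    _ ≤ (K.D (n + 1)).card * ((1 / 2 + 2 / ((n + 1 : ℕ) : ℝ)) * (a K.r (n + 1) : ℝ) ^ 2) := hcard
    _ ≤ (K.D (n + 1)).card * ((1 / 2 + ε) * (1 - 4 * ratio K.r n) ^ 2 *
        (a K.r (n + 1) : ℝ) ^ 2) := by gcongr
    _ = _ := by ring

theorem eventually_layer_le (K : Construction) {ε : ℝ} (hε : 0 < ε) :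
    ∀ᶠ n in atTop, ∀ A ⊆ F K.r n, MeasurableSet A → ∀ e,
      haar.real (K.lift n A ∩ {p | p.e = e}) ≤ (1 / 2 + ε) * haar.real (K.lift n A) := by
  have h1 : ∀ᶠ n : ℕ in atTop, 1 / (n : ℝ) ≤ ε / 3 :=
    tendsto_one_div_atTop_nhds_zero_nat.eventually_le_const (by positivity)
  have h2 : ∀ᶠ n : ℕ in atTop, ratio K.r n ≤ ε / 3 :=
    (tendsto_ratio K).eventually_le_const (by positivity)
  filter_upwards [h1, h2, eventually_card_layer_D_le K (show 0 < ε / 3 by positivity),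
    eventually_ge_atTop 1] with n g1 g2 g3 hn A hA hm e
  refine (haar_real_lift_layer_le hn hA hm (by positivity) g3 e).trans ?_
  have h3 : 1 / (2 * (K.r n : ℝ) + 1) ≤ ratio K.r n := by
    unfold ratio
    gcongr
    have : (0 : ℝ) ≤ n := Nat.cast_nonneg n
    linarith
  exact mul_le_mul_of_nonneg_right (by linarith) measureReal_nonneg

/-- The density in `F_n`. -/
noncomputable def dens (K : Construction) (n : ℕ) (A : Set GG) : ℝ :=
  haar.real A / haar.real (F K.r n)

theorem dens_nonneg (n : ℕ) (A : Set GG) : 0 ≤ K.dens n A :=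
  div_nonneg measureReal_nonneg measureReal_nonneg

theorem a_succ (r : ℕ → ℕ) (n : ℕ) : (a r (n + 1) : ℝ) = (2 * r n + 1) * aTilde r n := by
  simp [a]

theorem haar_real_lift {n : ℕ} (hn : 1 ≤ n) {A : Set GG} (hA : A ⊆ F K.r n)
    (hm : MeasurableSet A) : haar.real (K.lift n A) = (2 * K.r n + 1) ^ 2 * haar.real A := by
  rw [measureReal_def, haar_lift hn hA hm, ENNReal.toReal_mul, card_H, measureReal_def]
  congr 1
  rw [ENNReal.toReal_natCast]
  push_cast
  ring

theorem dens_lift {n : ℕ} (hn : 1 ≤ n) {A : Set GG} (hA : A ⊆ F K.r n)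
    (hm : MeasurableSet A) :
    K.dens (n + 1) (K.lift n A) = haar.real A / (8 * (aTilde K.r n : ℝ) ^ 2) := by
  have h1 : haar.real (F K.r (n + 1)) = 8 * (a K.r (n + 1) : ℝ) ^ 2 := haar_real_box _
  have h2 : (0 : ℝ) < 2 * K.r n + 1 := by positivity
  have h3 : (0 : ℝ) < aTilde K.r n := by exact_mod_cast aTilde_pos K.r n
  rw [dens, haar_real_lift hn hA hm, h1, a_succ]
  field_simp

theorem haar_real_F_pos {n : ℕ} (hn : 1 ≤ n) : 0 < haar.real (F K.r n) := by
  obtain ⟨m, rfl⟩ : ∃ m, n = m + 1 := ⟨n - 1, by omega⟩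
  have h3 : (0 : ℝ) < aTilde K.r m := by exact_mod_cast aTilde_pos K.r m
  have h1 : haar.real (F K.r (m + 1)) = 8 * (a K.r (m + 1) : ℝ) ^ 2 := haar_real_box _
  rw [h1, a_succ]
  positivity

theorem dens_lift_le {n : ℕ} (hn : 1 ≤ n) {A : Set GG} (hA : A ⊆ F K.r n)
    (hm : MeasurableSet A) : K.dens (n + 1) (K.lift n A) ≤ K.dens n A := by
  rw [dens_lift hn hA hm, dens]
  have := haar_real_F_pos (K := K) hn
  have h : haar.real (F K.r n) ≤ 8 * (aTilde K.r n : ℝ) ^ 2 := by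
    rw [← haar_real_box]
    exact measureReal_mono (F_subset_window K.r hn) (haar_box_ne_top _)
  have := measureReal_nonneg (μ := haar) (s := A)
  gcongr

theorem dens_le_one {n : ℕ} {A : Set GG} (hA : A ⊆ F K.r n) : K.dens n A ≤ 1 := by
  refine div_le_one_of_le₀ (measureReal_mono hA (haar_box_ne_top _)) measureReal_nonneg

/-- The estimate of the correlations between different copies, in its asymptotic form. -/
theorem eventually_rowSum_le (K : Construction) {ε : ℝ} (hε : 0 < ε) :
    ∀ᶠ n in atTop, ∀ A B, IsUnionOfAtoms (K.ξ n) A → IsUnionOfAtoms (K.ξ n) B →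
      ∀ i : ℕ, 1 ≤ i → ∀ l : ℤ, |l| ≤ 2 * aTilde K.r (n + 2) →
      K.rowSum (n + 2) (K.lift (n + 1) (K.lift n A)) (K.lift (n + 1) (K.lift n B)) i l ≤
        (2 * K.r (n + 2) + 1) * ((2 * K.r (n + 2) + 1 - i : ℕ) *
          (K.dens (n + 2) (K.lift (n + 1) (K.lift n A)) *
            K.dens (n + 2) (K.lift (n + 1) (K.lift n B)) *
            (4 * aTilde K.r (n + 2) * (2 * aTilde K.r (n + 2) - |(l : ℝ)|)))
          + (2 * K.r (n + 2) + 1) * (ε * (aTilde K.r (n + 2) : ℝ) ^ 2)) := by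
  set η : ℝ := min (ε / 64) (1 / 2) with hη
  have hη0 : 0 < η := by positivity
  have hη1 : η ≤ 1 / 2 := min_le_right _ _
  have hη2 : 64 * η ≤ ε := by
    have := min_le_left (ε / 64) (1 / 2)
    linarith
  have e1 : ∀ᶠ n in atTop, (24 / ((n + 1 + 1 : ℕ) : ℝ) + 300 * ratio K.r (n + 1)) ≤ ε / 2 := by
    have h1 : Tendsto (fun n : ℕ => 24 / ((n + 2 : ℕ) : ℝ) + 300 * ratio K.r (n + 1)) atTop
        (𝓝 (0 + 300 * 0)) :=
      ((tendsto_const_div_atTop_nhds_zero_nat 24).comp (tendsto_add_atTop_nat 2)).add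
        (((tendsto_ratio K).comp (tendsto_add_atTop_nat 1)).const_mul 300)
    exact h1.eventually_le_const (by rw [mul_zero, add_zero]; positivity)
  have e2 : ∀ᶠ n : ℕ in atTop, (1 + 2 / (2 * ((n + 2 : ℕ) : ℝ) - 1)) ^ 2 * (1 + 2 * η)
      ≤ 1 + 4 * η := by
    have h1 : Tendsto (fun n : ℕ => (1 + 2 / (2 * ((n + 2 : ℕ) : ℝ) - 1)) ^ 2 * (1 + 2 * η))
        atTop (𝓝 ((1 + 0) ^ 2 * (1 + 2 * η))) := by
      refine Tendsto.mul_const _ (Tendsto.pow (Tendsto.const_add _ ?_) 2)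
      refine Tendsto.const_div_atTop ?_ 2
      refine tendsto_atTop_mono (fun n : ℕ => ?_) tendsto_natCast_atTop_atTop
      push_cast
      have : (0 : ℝ) ≤ n := Nat.cast_nonneg n
      linarith
    exact h1.eventually_le_const (by rw [add_zero, one_pow, one_mul]; linarith)
  filter_upwards [e1, e2, eventually_layer_le K hη0, (tendsto_add_atTop_nat 1).eventually
    (eventually_b_le_a K), eventually_ge_atTop 1] with n g1 g2 g3 g4 hn A B hA hB i hi l hl
  have hAF := subset_F_of_isUnionOfAtoms hn hA
  have hAm := measurableSet_of_isUnionOfAtoms hn hA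
  have hLA := isUnionOfAtoms_lift hn hA
  have hLB := isUnionOfAtoms_lift hn hB
  have hLAF := subset_F_of_isUnionOfAtoms (by omega) hLA
  have hLAm := measurableSet_of_isUnionOfAtoms (by omega) hLA
  have hLBF := subset_F_of_isUnionOfAtoms (by omega) hLB
  have hLBm := measurableSet_of_isUnionOfAtoms (by omega) hLB
  have hn2 : n + 2 = n + 1 + 1 := rfl
  rw [hn2] at *
  set A' := K.lift n A with hA'
  set B' := K.lift n B with hB'
  set u : ℝ := ((aTilde K.r (n + 1) : ℕ) : ℝ) with hu
  set v : ℝ := ((aTilde K.r (n + 1 + 1) : ℕ) : ℝ) with hv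
  set m : ℝ := ((n + 1 + 1 : ℕ) : ℝ) with hm
  have hu0 : 0 < u := by rw [hu]; exact_mod_cast aTilde_pos K.r (n + 1)
  have hv0 : 0 < v := by rw [hv]; exact_mod_cast aTilde_pos K.r (n + 1 + 1)
  have hm2 : (2 : ℝ) ≤ m := by rw [hm]; exact_mod_cast (by omega)
  have hα : (1 / 2 + η) * haar.real A' ≤ 8 * u ^ 2 := by
    have h1 : haar.real A' ≤ 8 * u ^ 2 := by
      rw [hu, ← haar_real_box]
      exact measureReal_mono (hLAF.trans (F_subset_window K.r (by omega))) (haar_box_ne_top _)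
    have h0 : 0 ≤ haar.real A' := measureReal_nonneg
    nlinarith
  refine (rowSum_le (by omega) g4 hLA hLB (g3 A hAF hAm) hα hi hl).trans ?_
  rw [dens_lift (by omega) hLAF hLAm, dens_lift (by omega) hLBF hLBm]
  set δ := haar.real B' / (8 * u ^ 2) with hδ
  set δ' := haar.real A' / (8 * u ^ 2) with hδ'
  have hδ0 : 0 ≤ δ := div_nonneg measureReal_nonneg (by positivity)
  have hδ'0 : 0 ≤ δ' := div_nonneg measureReal_nonneg (by positivity)
  have hδ1 : δ ≤ 1 := by
    rw [hδ, ← dens_lift (by omega) hLBF hLBm]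
    exact dens_le_one (lift_subset_F (by omega) hLBF)
  have hδ'1 : δ' ≤ 1 := by
    rw [hδ', ← dens_lift (by omega) hLAF hLAm]
    exact dens_le_one (lift_subset_F (by omega) hLAF)
  have hl' : |(l : ℝ)| ≤ 2 * v := by rw [hv]; exact_mod_cast hl
  set W : ℝ := 4 * v * (2 * v - |(l : ℝ)|) with hW
  have hW0 : 0 ≤ W := by
    have : 0 ≤ 2 * v - |(l : ℝ)| := by linarith
    positivity
  have hW1 : W ≤ 8 * v ^ 2 := by
    have := mul_nonneg hv0.le (abs_nonneg (l : ℝ))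
    rw [hW]; linarith
  have hbm : (b K.r (n + 1 + 1) : ℝ) = (2 * m - 1) * u := by
    rw [hm, hu]; simp only [b]; push_cast; ring
  have hS : haar.real (S K.r (n + 1 + 1)) = 8 * ((2 * m - 1) * u) ^ 2 := by
    rw [← hbm]; exact haar_real_box _
  have hρ : 2 * ((2 * m + 1) ^ 2 * ((1 / 2 + η) * haar.real A')) /
      haar.real (S K.r (n + 1 + 1)) ≤ (1 + 4 * η) * δ' := by
    have h2m : 0 < 2 * m - 1 := by linarith
    have h0 : 0 ≤ haar.real A' := measureReal_nonneg
    have : 2 * ((2 * m + 1) ^ 2 * ((1 / 2 + η) * haar.real A')) /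
        haar.real (S K.r (n + 1 + 1)) = (1 + 2 / (2 * m - 1)) ^ 2 * (1 + 2 * η) * δ' := by
      rw [hS, hδ']
      field_simp
      ring
    rw [this]
    gcongr
  have hNr : (((2 * K.r (n + 1 + 1) + 1 - i : ℕ)) : ℝ) ≤ 2 * K.r (n + 1 + 1) + 1 := by
    have : 2 * K.r (n + 1 + 1) + 1 - i ≤ 2 * K.r (n + 1 + 1) + 1 := by omega
    exact_mod_cast this
  refine mul_le_mul_of_nonneg_left ?_ (by positivity)
  set N : ℝ := ((2 * K.r (n + 1 + 1) + 1 - i : ℕ) : ℝ) with hN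
  have hN0 : 0 ≤ N := Nat.cast_nonneg _
  have h1 : N * (2 * ((2 * m + 1) ^ 2 * ((1 / 2 + η) * haar.real A')) /
      haar.real (S K.r (n + 1 + 1)) * δ * W) ≤ N * ((1 + 4 * η) * δ' * δ * W) := by gcongr
  have h2 : N * (4 * η * δ' * δ * W) ≤
      (2 * K.r (n + 1 + 1) + 1) * (4 * η * 1 * 1 * (8 * v ^ 2)) := by gcongr
  have h3 : (2 * (K.r (n + 1 + 1) : ℝ) + 1) * ((24 / m + 300 * ratio K.r (n + 1)) * v ^ 2) ≤
      (2 * K.r (n + 1 + 1) + 1) * (ε / 2 * v ^ 2) := by gcongr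
  have h4 : (2 * (K.r (n + 1 + 1) : ℝ) + 1) * (4 * η * 1 * 1 * (8 * v ^ 2)) ≤
      (2 * K.r (n + 1 + 1) + 1) * (ε / 2 * v ^ 2) := by
    have : 4 * η * 1 * 1 * (8 * v ^ 2) = (32 * η) * v ^ 2 := by ring
    rw [this]
    gcongr
    linarith
  linarith

end Construction

/-! ### Translations along the center -/

namespace Construction

open GG Cstr

variable {K : Construction}

/-- The set whose measure is estimated by `rowSum`: the union of the overlaps of the copies in
position. -/
noncomputable def rowUnion (K : Construction) (n : ℕ) (A B : Set GG) (i : ℕ) (l : ℤ) : Set GG :=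
  ⋃ j ∈ Finset.Icc (-(K.r n : ℤ)) (K.r n), ⋃ t ∈ Finset.range (2 * K.r n + 1 - i),
    ((A * {z l} * {K.s n ((-(K.r n : ℤ), j) + ((t : ℤ), 0))}) ∩
      (B * {K.s n ((-(K.r n : ℤ) + i, j) + ((t : ℤ), 0))})) *
        {phi K.r n ((-(K.r n : ℤ) + i, j) + ((t : ℤ), 0))}

theorem rowUnion_subset_F {n : ℕ} (hn : 1 ≤ n) {A B : Set GG} (hB : B ⊆ F K.r n) (i : ℕ) (l : ℤ) :
    K.rowUnion n A B i l ⊆ F K.r (n + 1) := by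
  refine Set.iUnion₂_subset fun j hj => Set.iUnion₂_subset fun t ht => ?_
  rintro _ ⟨_, ⟨-, p, hp, _, rfl, rfl⟩, _, rfl, rfl⟩
  beta_reduce
  rw [mul_assoc]
  exact copy_mem_F hn (hB hp) (row_mem_H hj (Finset.mem_range.1 ht)).2

theorem haar_real_rowUnion_le {n : ℕ} {A B : Set GG}
    (hAm : MeasurableSet A) (hBm : MeasurableSet B) (i : ℕ) (l : ℤ) :
    haar.real (K.rowUnion n A B i l) ≤ K.rowSum n A B i l := by
  refine (measureReal_biUnion_finset_le _ _).trans (Finset.sum_le_sum fun j _ => ?_)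
  refine (measureReal_biUnion_finset_le _ _).trans (Finset.sum_le_sum fun t _ => ?_)
  rw [measureReal_def, haar_mul_singleton, ← measureReal_def]
  exact (measurableSet_mul_singleton (measurableSet_mul_singleton hAm _) _).inter
    (measurableSet_mul_singleton hBm _)

theorem phi_add_fst (r : ℕ → ℕ) (n : ℕ) (h : ℤ × ℤ) (i : ℤ) :
    phi r n h * z (2 * i * aTilde r n) = phi r n (h + (i, 0)) := by
  rw [mul_z]
  simp only [phi, Prod.fst_add, Prod.snd_add, add_zero]
  ext
  · simp only []; ring
  · rfl
  · rfl

theorem overlap_mem_rowUnion {n : ℕ} {A B : Set GG} {h : ℤ × ℤ} {i : ℕ} {l : ℤ}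
    (hh : h ∈ H K.r n) (hh' : h + ((i : ℤ), 0) ∈ H K.r n) {p p' : GG} (hp : p ∈ A) (hp' : p' ∈ B)
    (heq : p * K.s n h * phi K.r n h * z (2 * i * aTilde K.r n + l) =
      p' * K.s n (h + ((i : ℤ), 0)) * phi K.r n (h + ((i : ℤ), 0))) :
    p * K.s n h * phi K.r n h * z (2 * i * aTilde K.r n + l) ∈ K.rowUnion n A B i l := by
  obtain ⟨⟨a1, a2⟩, a3, a4⟩ := mem_H.1 hh
  obtain ⟨⟨b1, b2⟩, -⟩ := mem_H.1 hh'
  simp only [Prod.fst_add] at b1 b2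
  have e1 : ((-(K.r n : ℤ), h.2) + (((h.1 + K.r n).toNat : ℤ), 0) : ℤ × ℤ) = h := by
    refine Prod.ext ?_ ?_
    · simp only [Prod.fst_add]; omega
    · simp
  have e2 : ((-(K.r n : ℤ) + i, h.2) + (((h.1 + K.r n).toNat : ℤ), 0) : ℤ × ℤ)
      = h + ((i : ℤ), 0) := by
    refine Prod.ext ?_ ?_
    · simp only [Prod.fst_add]; omega
    · simp
  refine Set.mem_biUnion (x := h.2) (by simp; omega) ?_
  refine Set.mem_biUnion (x := (h.1 + K.r n).toNat) (by simp; omega) ?_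
  simp only [e1, e2]
  refine ⟨p' * K.s n (h + ((i : ℤ), 0)), ⟨?_, p', hp', _, rfl, rfl⟩, _, rfl, heq.symm⟩
  refine ⟨p * z l, ⟨p, hp, _, rfl, rfl⟩, _, rfl, ?_⟩
  have : p * K.s n h * phi K.r n h * z (2 * i * aTilde K.r n + l) =
      p * z l * K.s n h * phi K.r n (h + ((i : ℤ), 0)) := by
    rw [z_add, ← phi_add_fst, mul_assoc p (z l), z_comm l (K.s n h), ← mul_assoc p,
      mul_assoc (p * K.s n h) (z l), z_comm l]
    simp only [mul_assoc]
  rw [this] at heq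
  exact mul_right_cancel heq

/-- The overlap of `A C_{n+1}`, translated by `z(k)`, and of `B C_{n+1}`: a copy of `A` meets only
copies of `B` in the same row, shifted by one of two consecutive numbers. -/
theorem lift_translate_inter_subset {n : ℕ} (hn : 1 ≤ n) {A B : Set GG} (hA : A ⊆ F K.r n)
    (hB : B ⊆ F K.r n) (i : ℕ) {l : ℤ} (hl0 : 0 ≤ l) (hl : l < 2 * aTilde K.r n) :
    (K.lift n A * {z (2 * i * aTilde K.r n + l)}) ∩ K.lift n B ⊆
      K.rowUnion n A B i l ∪ K.rowUnion n A B (i + 1) (l - 2 * aTilde K.r n) := by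
  rintro _ ⟨⟨_, hx, _, rfl, rfl⟩, hy⟩
  beta_reduce at hy ⊢
  obtain ⟨h, hh, p, hp, _, rfl, rfl⟩ := mem_lift.1 hx
  obtain ⟨h', hh', p', hp', _, rfl, heq⟩ := mem_lift.1 hy
  beta_reduce at heq ⊢
  simp only [← mul_assoc] at heq ⊢
  have hw := K.copy_mem_window hn (hA hp) hh
  have hw' := K.copy_mem_window hn (hB hp') hh'
  have hk := congrArg GG.k heq
  have ht := congrArg GG.t heq
  have he := congrArg GG.e heq
  have hpos : (0 : ℤ) < aTilde K.r n := by exact_mod_cast aTilde_pos K.r n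
  have h2 : h.2 = h'.2 := by
    set w := p * K.s n h with hwdef
    set w' := p' * K.s n h' with hwdef'
    obtain ⟨-, -, w3, w4⟩ := hw
    obtain ⟨-, -, v3, v4⟩ := hw'
    have := window_inj (r := K.r) (n := n) (w := ⟨0, w.t, w.e⟩) (w' := ⟨0, w'.t, w'.e⟩)
      (h := (0, h.2)) (h' := (0, h'.2)) ⟨by simpa using hpos, by simp, w3, w4⟩
      ⟨by simpa using hpos, by simp, v3, v4⟩ ?_
    · exact (Prod.mk.inj this).2
    · simp only [mul_z, mul_def w, mul_def w', phi, add_zero] at ht he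
      simp only [mul_def, phi, add_zero]
      ext
      · simp
      · simpa using ht.symm
      · simpa using he.symm
  have hd : h'.1 = h.1 + i ∨ h'.1 = h.1 + (i + 1) := by
    obtain ⟨w1, w2, -, -⟩ := hw
    obtain ⟨v1, v2, -, -⟩ := hw'
    set w := p * K.s n h
    set w' := p' * K.s n h'
    simp only [mul_z, mul_def w, mul_def w', phi] at hk
    have e : 2 * (aTilde K.r n : ℤ) * (h'.1 - h.1 - i) = w.k - w'.k + l := by
      linear_combination hk
    set d := h'.1 - h.1 - i with hd
    have d1 : -1 < d := by
      by_contra hc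
      have := mul_le_mul_of_nonneg_left (show d ≤ -1 by omega) hpos.le
      linarith
    have d2 : d < 2 := by
      by_contra hc
      have := mul_le_mul_of_nonneg_left (show 2 ≤ d by omega) hpos.le
      linarith
    omega
  rcases hd with hd | hd
  · left
    obtain rfl : h' = h + ((i : ℤ), 0) := Prod.ext (by simpa using hd) (by simpa using h2.symm)
    exact overlap_mem_rowUnion hh hh' hp hp' heq.symm
  · right
    obtain rfl : h' = h + (((i + 1 : ℕ) : ℤ), 0) :=
      Prod.ext (by simpa using hd) (by simpa using h2.symm)
    have e : (2 * i * aTilde K.r n + l : ℤ) =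
        2 * ((i + 1 : ℕ) : ℤ) * aTilde K.r n + (l - 2 * aTilde K.r n) := by push_cast; ring
    rw [e] at heq ⊢
    exact overlap_mem_rowUnion hh hh' hp hp' heq.symm

theorem haar_real_translate_inter_le {n : ℕ} (hn : 1 ≤ n) {A B : Set GG} (hA : A ⊆ F K.r n)
    (hB : B ⊆ F K.r n) (hAm : MeasurableSet A) (hBm : MeasurableSet B) (i : ℕ) {l : ℤ}
    (hl0 : 0 ≤ l) (hl : l < 2 * aTilde K.r n) :
    haar.real ((K.lift n A * {z (2 * i * aTilde K.r n + l)}) ∩ K.lift n B) ≤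
      K.rowSum n A B i l + K.rowSum n A B (i + 1) (l - 2 * aTilde K.r n) := by
  refine (measureReal_mono (lift_translate_inter_subset hn hA hB i hl0 hl) ?_).trans
    ((measureReal_union_le _ _).trans
      (add_le_add (haar_real_rowUnion_le hAm hBm _ _) (haar_real_rowUnion_le hAm hBm _ _)))
  exact haar_ne_top_of_subset_F (r := K.r) (n := n + 1)
    (Set.union_subset (rowUnion_subset_F hn hB _ _) (rowUnion_subset_F hn hB _ _))

theorem rowSum_zero {n : ℕ} {A B : Set GG} (hAm : MeasurableSet A) (hBm : MeasurableSet B)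
    (l : ℤ) : K.rowSum n A B 0 l = (2 * K.r n + 1) ^ 2 * haar.real ((A * {z l}) ∩ B) := by
  have key : ∀ x : GG, haar.real ((A * {z l} * {x}) ∩ (B * {x})) =
      haar.real ((A * {z l}) ∩ B) := by
    intro x
    have : (A * {z l} * {x}) ∩ (B * {x}) = ((A * {z l}) ∩ B) * {x} := by
      ext q
      simp only [Set.mem_inter_iff, mem_mul_singleton]
    rw [this, measureReal_def, haar_mul_singleton
      ((measurableSet_mul_singleton hAm _).inter hBm), ← measureReal_def]
  have hc : ((K.r n : ℤ) + 1 - -(K.r n : ℤ)).toNat = 2 * K.r n + 1 := by omega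
  simp only [rowSum, Nat.cast_zero, add_zero, Nat.sub_zero, key, Finset.sum_const,
    Finset.card_range, Int.card_Icc, hc, nsmul_eq_mul]
  push_cast
  ring

/-- Translates by central elements `z(k)`, with `k` between `2 ã_{n+2}` and `2 ã_{n+3}`: the
contributions of the two levels are `(2 ã_{n+3} - k)` and `k`, up to the same factor. -/
theorem eventually_translate_inter_le (K : Construction) {ε : ℝ} (hε : 0 < ε) :
    ∀ᶠ n in atTop, ∀ A B, IsUnionOfAtoms (K.ξ n) A → IsUnionOfAtoms (K.ξ n) B →
      ∀ k : ℕ, 2 * aTilde K.r (n + 2) ≤ k → k < 2 * aTilde K.r (n + 3) →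
      haar.real ((K.lift (n + 3) (K.lift (n + 2) (K.lift (n + 1) (K.lift n A))) * {z k}) ∩
          K.lift (n + 3) (K.lift (n + 2) (K.lift (n + 1) (K.lift n B)))) ≤
        (K.dens (n + 2) (K.lift (n + 1) (K.lift n A)) *
          K.dens (n + 2) (K.lift (n + 1) (K.lift n B)) + ε) * haar.real (F K.r (n + 4)) := by
  filter_upwards [eventually_rowSum_le K hε,
    (tendsto_add_atTop_nat 1).eventually (eventually_rowSum_le K hε), eventually_ge_atTop 1]
    with n g1 g2 hn A B hA hB k hk hk'
  have hA1 := isUnionOfAtoms_lift hn hA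
  have hB1 := isUnionOfAtoms_lift hn hB
  have hA2 := isUnionOfAtoms_lift (by omega) hA1
  have hB2 := isUnionOfAtoms_lift (by omega) hB1
  have hA3 := isUnionOfAtoms_lift (by omega) hA2
  have hB3 := isUnionOfAtoms_lift (by omega) hB2
  have fA2 := subset_F_of_isUnionOfAtoms (by omega) hA2
  have fB2 := subset_F_of_isUnionOfAtoms (by omega) hB2
  have fA3 := subset_F_of_isUnionOfAtoms (by omega) hA3
  have fB3 := subset_F_of_isUnionOfAtoms (by omega) hB3
  have mA2 := measurableSet_of_isUnionOfAtoms (by omega) hA2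
  have mB2 := measurableSet_of_isUnionOfAtoms (by omega) hB2
  have mA3 := measurableSet_of_isUnionOfAtoms (by omega) hA3
  have mB3 := measurableSet_of_isUnionOfAtoms (by omega) hB3
  have k1 := g1 A B hA hB
  have k2 := g2 _ _ hA1 hB1 1 le_rfl
  have dA : K.dens (n + 3) (K.lift (n + 2) (K.lift (n + 1) (K.lift n A))) ≤
    K.dens (n + 2) (K.lift (n + 1) (K.lift n A)) := dens_lift_le (by omega) fA2 mA2
  have dB : K.dens (n + 3) (K.lift (n + 2) (K.lift (n + 1) (K.lift n B))) ≤
    K.dens (n + 2) (K.lift (n + 1) (K.lift n B)) := dens_lift_le (by omega) fB2 mB2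
  have n12 : n + 1 + 2 = n + 3 := rfl
  have n11 : n + 1 + 1 = n + 2 := rfl
  simp only [n12, n11] at *
  set A2 := K.lift (n + 1) (K.lift n A)
  set B2 := K.lift (n + 1) (K.lift n B)
  set A3 := K.lift (n + 2) A2
  set B3 := K.lift (n + 2) B2
  set d := K.dens (n + 2) A2 * K.dens (n + 2) B2 with hd
  have hd0 : 0 ≤ d := mul_nonneg (dens_nonneg _ _) (dens_nonneg _ _)
  have hd3 : K.dens (n + 3) A3 * K.dens (n + 3) B3 ≤ d := mul_le_mul dA dB (dens_nonneg _ _)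
    (dens_nonneg _ _)
  set u : ℝ := ((aTilde K.r (n + 2) : ℕ) : ℝ) with hu
  set v : ℝ := ((aTilde K.r (n + 3) : ℕ) : ℝ) with hv
  set R : ℝ := 2 * (K.r (n + 2) : ℝ) + 1 with hR
  set R' : ℝ := 2 * (K.r (n + 3) : ℝ) + 1 with hR'
  have hR0 : 0 < R := by positivity
  have hR'0 : 0 < R' := by positivity
  have hu0 : 0 < u := by rw [hu]; exact_mod_cast aTilde_pos K.r _
  have hv0 : 0 < v := by rw [hv]; exact_mod_cast aTilde_pos K.r _
  have hRu : R * u ≤ v := by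
    rw [hR, hu, ← a_succ, hv]
    exact_mod_cast a_le_aTilde K.r (by omega)
  have hkv : (k : ℝ) ≤ 2 * v := by rw [hv]; exact_mod_cast hk'.le
  -- the lower of the two levels
  have low : haar.real ((A3 * {z k}) ∩ B3) ≤ 4 * d * v * (2 * v - k) + 2 * ε * v ^ 2 := by
    obtain ⟨i, l, hi, hl, hkil⟩ : ∃ i l : ℕ, 1 ≤ i ∧ l < 2 * aTilde K.r (n + 2) ∧
        k = 2 * i * aTilde K.r (n + 2) + l := by
      have hpos : 0 < 2 * aTilde K.r (n + 2) := by have := aTilde_pos K.r (n + 2); omega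
      refine ⟨k / (2 * aTilde K.r (n + 2)), k % (2 * aTilde K.r (n + 2)),
        Nat.div_pos hk hpos, Nat.mod_lt _ hpos, ?_⟩
      have := Nat.div_add_mod k (2 * aTilde K.r (n + 2))
      linarith
    have hz : (k : ℤ) = 2 * i * aTilde K.r (n + 2) + (l : ℤ) := by exact_mod_cast hkil
    have hl1 : (l : ℤ) < 2 * aTilde K.r (n + 2) := by exact_mod_cast hl
    have h1 := k1 i hi l (by rw [abs_of_nonneg (by omega)]; omega)
    have h2 := k1 (i + 1) (by omega) (l - 2 * aTilde K.r (n + 2))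
      (by rw [abs_of_nonpos (by omega)]; omega)
    have h3 := haar_real_translate_inter_le (K := K) (n := n + 2) (by omega) fA2 fB2 mA2 mB2 i
      (l := l) (by omega) hl1
    rw [← hz] at h3
    have hlu : (l : ℝ) ≤ 2 * u := by rw [hu]; exact_mod_cast hl.le
    have hl0 : (0 : ℝ) ≤ l := Nat.cast_nonneg _
    have hku : (k : ℝ) = 2 * i * u + l := by rw [hu]; exact_mod_cast hkil
    have c1 : |((l : ℤ) : ℝ)| = l := by simp
    have c2 : |(((l : ℤ) - 2 * aTilde K.r (n + 2) : ℤ) : ℝ)| = 2 * u - l := by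
      push_cast
      rw [abs_of_nonpos (by linarith)]
      ring
    rw [c1] at h1
    rw [c2] at h2
    set N1 : ℝ := ((2 * K.r (n + 2) + 1 - i : ℕ) : ℝ) with hN1
    set N2 : ℝ := ((2 * K.r (n + 2) + 1 - (i + 1) : ℕ) : ℝ) with hN2
    have comb : R * (N1 * (2 * u - l) + N2 * l) * u ≤ v * (2 * v - k) := by
      rcases Nat.lt_or_ge i (2 * K.r (n + 2) + 1) with hiR | hiR
      · have e1 : N1 = R - i := by
          rw [hN1, hR, Nat.cast_sub hiR.le]; push_cast; ring
        have e2 : N2 = R - i - 1 := by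
          rw [hN2, hR, Nat.cast_sub hiR]; push_cast; ring
        have e3 : N1 * (2 * u - l) + N2 * l = 2 * (R * u) - k := by
          rw [e1, e2, hku]; ring
        rw [e3]
        have e4 : 0 ≤ 2 * (R * u) - k := by
          rw [← e3]
          have : 0 ≤ 2 * u - (l : ℝ) := by linarith
          positivity
        calc R * (2 * (R * u) - k) * u = R * u * (2 * (R * u) - k) := by ring
          _ ≤ v * (2 * v - k) := by gcongr
      · have e1 : N1 = 0 := by rw [hN1, Nat.sub_eq_zero_of_le hiR, Nat.cast_zero]
        have e2 : N2 = 0 := by rw [hN2, Nat.sub_eq_zero_of_le (by omega), Nat.cast_zero]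
        rw [e1, e2]
        have : 0 ≤ 2 * v - k := by linarith
        have := mul_nonneg hv0.le this
        linarith
    have err : (R * u) ^ 2 ≤ v ^ 2 := by gcongr
    have comb' := mul_le_mul_of_nonneg_left comb (show 0 ≤ 4 * d by positivity)
    have err' := mul_le_mul_of_nonneg_left err (show 0 ≤ 2 * ε by positivity)
    linarith
  -- the upper of the two levels
  have high := k2 (k - 2 * aTilde K.r (n + 3)) (by rw [abs_of_nonpos (by omega)]; omega)
  have c3 : |(((k : ℤ) - 2 * aTilde K.r (n + 3) : ℤ) : ℝ)| = 2 * v - k := by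
    push_cast
    rw [abs_of_nonpos (by linarith)]
    ring
  rw [c3] at high
  have h3 := haar_real_translate_inter_le (K := K) (n := n + 3) (by omega) fA3 fB3 mA3 mB3 0
    (l := k) (by omega) (by exact_mod_cast hk')
  rw [rowSum_zero mA3 mB3] at h3
  simp only [Nat.cast_zero, mul_zero, zero_mul, zero_add] at h3
  have hN : ((2 * K.r (n + 3) + 1 - 1 : ℕ) : ℝ) ≤ R' := by
    rw [hR']; push_cast [Nat.add_sub_cancel]; linarith
  have hk0 : (0 : ℝ) ≤ k := Nat.cast_nonneg _
  have hF : haar.real (F K.r (n + 4)) = 8 * (R' * v) ^ 2 := by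
    have : haar.real (F K.r (n + 4)) = 8 * (a K.r (n + 3 + 1) : ℝ) ^ 2 := haar_real_box _
    rw [this, a_succ]
  have high' : R' * (((2 * K.r (n + 3) + 1 - 1 : ℕ) : ℝ) *
      (K.dens (n + 3) A3 * K.dens (n + 3) B3 * (4 * v * (2 * v - (2 * v - k)))) +
        R' * (ε * v ^ 2)) ≤ R' * (R' * (d * (4 * v * k)) + R' * (ε * v ^ 2)) := by
    have : 2 * v - (2 * v - (k : ℝ)) = k := by ring
    have hd3' : 0 ≤ K.dens (n + 3) A3 * K.dens (n + 3) B3 :=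
      mul_nonneg (dens_nonneg _ _) (dens_nonneg _ _)
    rw [this]
    gcongr
  have low' := mul_le_mul_of_nonneg_left low (show 0 ≤ R' ^ 2 by positivity)
  rw [hF]
  have : 0 ≤ ε * (R' * v) ^ 2 := by positivity
  linarith

end Construction

/-! ### Points of the inductive limit -/

namespace CFSequence

variable {G : Type*} [Group G] (P : CFSequence G)

theorem C_nonempty {k : ℕ} (hk : 0 < k) : (P.C k).Nonempty := by
  obtain ⟨m, rfl⟩ : ∃ m, k = m + 1 := ⟨k - 1, by omega⟩
  exact Finset.card_pos.1 (by have := P.one_lt_card m; omega)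

instance {n : ℕ} (k : {k : ℕ // n < k}) : Nonempty (P.C k.1) :=
  (P.C_nonempty (Nat.zero_lt_of_lt k.2)).to_subtype

/-- The coordinate `c_{n+1}`. -/
def head {n : ℕ} (y : (k : {k : ℕ // n < k}) → P.C k.1) : P.C (n + 1) := y ⟨n + 1, n.lt_succ_self⟩

/-- The coordinates `c_{n+2}, c_{n+3}, …`. -/
def tail {n : ℕ} (y : (k : {k : ℕ // n < k}) → P.C k.1) : (k : {k : ℕ // n + 1 < k}) → P.C k.1 :=
  fun k => y ⟨k.1, n.lt_succ_self.trans k.2⟩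

variable {P}

theorem embed_injective (n : ℕ) : Function.Injective (P.embed (n := n)) := by
  intro x y h
  have h1 : x.1.1 * (P.head x.2).1 = y.1.1 * (P.head y.2).1 :=
    congrArg (fun w : P.Level (n + 1) => w.1.1) h
  have h2 : P.tail x.2 = P.tail y.2 := congrArg (fun w : P.Level (n + 1) => w.2) h
  have h3 : P.head x.2 = P.head y.2 := by
    by_contra hne
    refine Set.disjoint_left.1 (P.disjoint n _ (P.head x.2).2 _ (P.head y.2).2
      (fun h => hne (Subtype.ext h))) ⟨_, x.1.2, _, rfl, rfl⟩ ⟨_, y.1.2, _, rfl, h1.symm⟩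
  rw [h3] at h1
  refine Prod.ext (Subtype.ext (mul_right_cancel h1)) (funext fun k => ?_)
  rcases eq_or_lt_of_le (Nat.succ_le_of_lt k.2) with h | h
  · obtain ⟨k, hk⟩ := k
    obtain rfl : n + 1 = k := h
    exact h3
  · exact congrFun h2 ⟨k.1, h⟩

theorem up_injective : Function.Injective P.up := by
  rintro ⟨n, x⟩ ⟨m, y⟩ h
  obtain ⟨h1, h2⟩ := Sigma.mk.inj h
  obtain rfl : n = m := Nat.succ_injective h1
  exact congrArg (Sigma.mk n) (embed_injective n (eq_of_heq h2))

theorem exists_up_iterate_eq {p q : Σ n, P.Level n}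
    (h : Relation.EqvGen (fun p q : Σ n, P.Level n => q = P.up p) p q) :
    ∃ i j, P.up^[i] p = P.up^[j] q := by
  induction h with
  | rel p q hpq => exact ⟨1, 0, hpq.symm⟩
  | refl p => exact ⟨0, 0, rfl⟩
  | symm p q _ ih =>
    obtain ⟨i, j, hij⟩ := ih
    exact ⟨j, i, hij.symm⟩
  | trans p q s _ _ ih₁ ih₂ =>
    obtain ⟨i, j, hij⟩ := ih₁
    obtain ⟨k, l, hkl⟩ := ih₂
    refine ⟨k + i, j + l, ?_⟩
    rw [Function.iterate_add_apply, hij, ← Function.iterate_add_apply, add_comm k j,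
      Function.iterate_add_apply, hkl, ← Function.iterate_add_apply]

theorem incl_injective (n : ℕ) : Function.Injective (P.incl n) := by
  intro x y h
  obtain ⟨i, j, hij⟩ := exists_up_iterate_eq (p := ⟨n, x⟩) (q := ⟨n, y⟩) (Quot.eqvGen_exact h)
  have h1 := congrArg Sigma.fst hij
  rw [up_iterate_fst, up_iterate_fst] at h1
  obtain rfl : i = j := by simpa using h1
  exact eq_of_heq (Sigma.mk.inj (up_injective.iterate i hij)).2

/-- The embedding `X_n → X_{n+j}`. -/
def shift {n : ℕ} (j : ℕ) (x : P.Level n) : P.Level (n + j) :=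
  match j with
  | 0 => x
  | j + 1 => P.embed (shift j x)

theorem incl_shift {n : ℕ} (j : ℕ) (x : P.Level n) : P.incl (n + j) (shift j x) = P.incl n x := by
  induction j with
  | zero => rfl
  | succ j ih => rw [← ih]; exact P.incl_embed _

theorem shift_snd {n : ℕ} (j : ℕ) (x : P.Level n) (k : {k : ℕ // n + j < k}) :
    (shift j x).2 k = x.2 ⟨k.1, by have := k.2; omega⟩ := by
  induction j with
  | zero => rfl
  | succ j ih => exact ih ⟨k.1, by have := k.2; omega⟩

variable (P)

/-- The cylinder `[A]_n`: the set of points of `X` which lie in `X_n`, with first coordinate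
in `A`. -/
def cyl (n : ℕ) (A : Set G) : Set P.Space := P.incl n '' {x | x.1.1 ∈ A}

variable {P}

theorem incl_preimage_cyl (n : ℕ) (A : Set G) : P.incl n ⁻¹' P.cyl n A = {x | x.1.1 ∈ A} :=
  Set.preimage_image_eq _ (incl_injective n)

theorem incl_mem_cyl {n : ℕ} {A : Set G} {x : P.Level n} : P.incl n x ∈ P.cyl n A ↔ x.1.1 ∈ A := by
  rw [← Set.mem_preimage, incl_preimage_cyl]; rfl

theorem cyl_mono {n : ℕ} {A B : Set G} (h : A ⊆ B) : P.cyl n A ⊆ P.cyl n B :=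
  Set.image_mono fun _ hx => h hx

theorem cyl_inter (n : ℕ) (A B : Set G) : P.cyl n A ∩ P.cyl n B = P.cyl n (A ∩ B) :=
  (Set.image_inter (incl_injective n)).symm

theorem cyl_sdiff (n : ℕ) (A B : Set G) : P.cyl n A \ P.cyl n B = P.cyl n (A \ B) :=
  (Set.image_sdiff (incl_injective n) _ _).symm

theorem cyl_F (n : ℕ) : P.cyl n (P.F n) = Set.range (P.incl n) := by
  rw [cyl, ← Set.image_univ]
  congr 1
  ext x
  simp

theorem cyl_succ {n : ℕ} {A : Set G} (hA : A ⊆ P.F n) :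
    P.cyl n A = P.cyl (n + 1) (A * (P.C (n + 1) : Set G)) := by
  ext w
  constructor
  · rintro ⟨x, hx, rfl⟩
    rw [← P.incl_embed, incl_mem_cyl]
    exact ⟨_, hx, _, (P.head x.2).2, rfl⟩
  · rintro ⟨x, ⟨f, hf, c, hc, hfc⟩, rfl⟩
    classical
    refine ⟨(⟨f, hA hf⟩, fun k => if h : n + 1 < k.1 then x.2 ⟨k.1, h⟩ else
      ⟨c, by
        have h1 : k.1 = n + 1 := by have := k.2; omega
        rw [h1]; exact hc⟩), hf, ?_⟩
    rw [← P.incl_embed]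
    congr 1
    refine Prod.ext (Subtype.ext ?_) (funext fun k => ?_)
    · simpa [embed] using hfc
    · simp [embed, k.2]

theorem exists_mem_range_incl (x : P.Space) : ∃ n, x ∈ Set.range (P.incl n) := by
  obtain ⟨n, -, y, rfl⟩ := P.exists_rep 0 x
  exact ⟨n, y, rfl⟩

theorem step_one {n : ℕ} (hn : ∀ f ∈ P.F n, ∀ c ∈ P.C (n + 1), 1 * f * c ∈ P.F (n + 1)) :
    P.step 1 hn = P.embed := by
  funext x; simp [step, embed]

theorem one_gap (P : CFSequence G) (n : ℕ) :
    ∀ f ∈ P.F n, ∀ c ∈ P.C (n + 1), 1 * f * c ∈ P.F (n + 1) := by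
  simpa using P.mul_mem n

/-! ### Measurability -/

variable [MeasurableSpace G]

theorem measurableSet_iff {E : Set P.Space} :
    MeasurableSet E ↔ ∀ n, MeasurableSet (P.incl n ⁻¹' E) := by
  have h1 : MeasurableSet E ↔ MeasurableSet
      (Quot.mk (fun p q : Σ n, P.Level n => q = P.up p) ⁻¹' E) :=
    Iff.rfl
  rw [h1]
  exact MeasurableSpace.measurableSet_iInf

theorem measurable_incl (n : ℕ) : Measurable (P.incl n) := fun _ hE => measurableSet_iff.1 hE n

theorem measurable_head (n : ℕ) : Measurable (P.head (n := n)) := measurable_pi_apply _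

theorem measurable_tail (n : ℕ) : Measurable (P.tail (n := n)) :=
  measurable_pi_lambda _ fun _ => measurable_pi_apply _

variable [MeasurableMul₂ G]

theorem measurable_step (g : G) {n : ℕ}
    (hn : ∀ f ∈ P.F n, ∀ c ∈ P.C (n + 1), g * f * c ∈ P.F (n + 1)) :
    Measurable (P.step g hn) := by
  refine Measurable.prodMk (Measurable.subtype_mk ?_) ((measurable_tail n).comp measurable_snd)
  exact ((measurable_subtype_coe.comp measurable_fst).const_mul g).mul
    (measurable_subtype_coe.comp ((measurable_head n).comp measurable_snd))

theorem measurable_embed (n : ℕ) : Measurable (P.embed (n := n)) := by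
  rw [← step_one (P.one_gap n)]; exact measurable_step _ _

theorem measurable_shift {n : ℕ} (j : ℕ) : Measurable (shift (P := P) (n := n) j) := by
  induction j with
  | zero => exact measurable_id
  | succ j ih => exact (measurable_embed _).comp ih

/-- Measurability may be tested on the levels from some point on. -/
theorem measurableSet_of_le {E : Set P.Space} (N : ℕ)
    (h : ∀ n, N ≤ n → MeasurableSet (P.incl n ⁻¹' E)) : MeasurableSet E := by
  refine measurableSet_iff.2 fun n => ?_
  have : P.incl n ⁻¹' E = shift N ⁻¹' (P.incl (n + N) ⁻¹' E) := by
    ext x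
    simp only [Set.mem_preimage, incl_shift]
  rw [this]
  exact measurable_shift N (h _ (by omega))

theorem measurable_T (g : G) : Measurable (P.T g) := by
  intro E hE
  refine measurableSet_of_le (P.gapIndex g) fun n hn => ?_
  have : P.incl n ⁻¹' (P.T g ⁻¹' E) =
      P.step g (P.gapIndex_spec g hn) ⁻¹' (P.incl (n + 1) ⁻¹' E) := by
    ext x
    simp only [Set.mem_preimage, P.T_incl g hn]
  rw [this]
  exact measurable_step _ _ (measurable_incl _ hE)

end CFSequence

namespace CFSequence

set_option linter.unusedSectionVars false

variable {G : Type*} [Group G] {P : CFSequence G} [MeasurableSpace G]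

/-! ### Measures -/

theorem iSup_tsum_of_monotone (f : ℕ → ℕ → ENNReal) (hf : Monotone f) :
    ⨆ n, ∑' i, f n i = ∑' i, ⨆ n, f n i := by
  have h := lintegral_iSup (μ := (Measure.count : Measure ℕ)) (f := f)
    (fun n => measurable_from_top) hf
  simp only [lintegral_count] at h
  exact h.symm

/-- The supremum of an increasing sequence of measures is computed setwise. -/
theorem iSup_measure_apply {α : Type*} [MeasurableSpace α] {ν : ℕ → Measure α} (hν : Monotone ν)
    {E : Set α} (hE : MeasurableSet E) : (⨆ n, ν n) E = ⨆ n, ν n E := by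
  let ρ : Measure α := Measure.ofMeasurable (fun E _ => ⨆ n, ν n E) (by simp) (by
    intro f hf hd
    simp only [measure_iUnion hd hf]
    exact iSup_tsum_of_monotone _ fun n m hnm i => hν hnm _)
  have hρ : ∀ E, MeasurableSet E → ρ E = ⨆ n, ν n E := fun E hE => Measure.ofMeasurable_apply E hE
  have : (⨆ n, ν n) = ρ := by
    refine le_antisymm (iSup_le fun n => Measure.le_iff.2 fun E hE => ?_)
      (Measure.le_iff.2 fun E hE => ?_)
    · rw [hρ E hE]; exact le_iSup (fun n => ν n E) n
    · rw [hρ E hE]; exact iSup_le fun n => Measure.le_iff'.1 (le_iSup ν n) E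
  rw [this, hρ E hE]

/-- The product of the uniform probabilities on the `C_k`, `k > n`. -/
noncomputable def tailMeasure (P : CFSequence G) (n : ℕ) :
    Measure ((k : {k : ℕ // n < k}) → P.C k.1) :=
  Measure.infinitePi fun k => ProbabilityTheory.uniformOn (Set.univ : Set (P.C k.1))

instance (n : ℕ) : IsProbabilityMeasure (P.tailMeasure n) := by
  unfold tailMeasure; infer_instance

/-- The first of the coordinates `c_k`, `k > n`, is uniformly distributed, and independent of the
others. -/
theorem tailMeasure_head_tail [MeasurableSingletonClass G] (n : ℕ) (c : P.C (n + 1))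
    {V : Set ((k : {k : ℕ // n + 1 < k}) → P.C k.1)} (hV : MeasurableSet V) :
    P.tailMeasure n {y | P.head y = c ∧ P.tail y ∈ V} =
      ((P.C (n + 1)).card : ENNReal)⁻¹ * P.tailMeasure (n + 1) V := by
  classical
  have hc0 : ((P.C (n + 1)).card : ENNReal) ≠ 0 := by
    have := P.one_lt_card n
    exact_mod_cast (by omega)
  have hm : MeasurableSet {y | P.head (n := n) y = c} :=
    measurable_head n (measurableSet_singleton c)
  set ν : Measure ((k : {k : ℕ // n + 1 < k}) → P.C k.1) :=
    ((P.C (n + 1)).card : ENNReal) •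
      ((P.tailMeasure n).restrict {y | P.head y = c}).map P.tail with hν
  have key : ν = P.tailMeasure (n + 1) := by
    refine Measure.eq_infinitePi _ fun s t ht => ?_
    have ht' : MeasurableSet (Set.pi (s : Set {k : ℕ // n + 1 < k}) t) :=
      MeasurableSet.pi s.countable_toSet fun i _ => ht i
    rw [hν, Measure.smul_apply, Measure.map_apply (measurable_tail n) ht',
      Measure.restrict_apply (measurable_tail n ht'), smul_eq_mul]
    let ι : {k : ℕ // n + 1 < k} ↪ {k : ℕ // n < k} :=
      ⟨fun k => ⟨k.1, n.lt_succ_self.trans k.2⟩, fun k l h => Subtype.ext (Subtype.mk.inj h)⟩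
    let t' : (k : {k : ℕ // n < k}) → Set (P.C k.1) := fun k =>
      if h : n + 1 < k.1 then t ⟨k.1, h⟩ else {d | d.1 = c.1}
    have hbox : P.tail (n := n) ⁻¹' (Set.pi (s : Set {k : ℕ // n + 1 < k}) t) ∩ {y | P.head y = c} =
        Set.pi ((insert ⟨n + 1, n.lt_succ_self⟩ (s.map ι) : Finset {k : ℕ // n < k}) :
          Set {k : ℕ // n < k}) t' := by
      ext y
      simp only [Set.mem_inter_iff, Set.mem_preimage, Set.mem_pi, Finset.coe_insert,
        Finset.coe_map, Set.forall_mem_insert, Set.forall_mem_image]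
      rw [and_comm]
      refine and_congr ?_ (forall₂_congr fun k hk => ?_)
      · change P.head y = c ↔ y ⟨n + 1, n.lt_succ_self⟩ ∈ t' ⟨n + 1, n.lt_succ_self⟩
        simp only [t', lt_irrefl, dif_neg, not_false_eq_true]
        exact Subtype.ext_iff
      · have : t' (ι k) = t k := dif_pos k.2
        rw [this]; rfl
    have hmt : ∀ k, MeasurableSet (t' k) := fun k => Set.Finite.measurableSet (Set.toFinite _)
    rw [hbox]
    unfold tailMeasure
    rw [Measure.infinitePi_pi _ fun i _ => hmt i, Finset.prod_insert, Finset.prod_map]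
    · have e1 : ProbabilityTheory.uniformOn (Set.univ : Set (P.C (n + 1)))
          (t' ⟨n + 1, n.lt_succ_self⟩) = ((P.C (n + 1)).card : ENNReal)⁻¹ := by
        have : t' ⟨n + 1, n.lt_succ_self⟩ = {c} := by
          simp only [t', lt_irrefl, dif_neg, not_false_eq_true]
          ext d
          exact Subtype.ext_iff.symm
        rw [this, ProbabilityTheory.uniformOn_univ, Measure.count_singleton, Fintype.card_coe,
          one_div]
      rw [e1, ← mul_assoc, ENNReal.mul_inv_cancel hc0 (ENNReal.natCast_ne_top _), one_mul]
      refine Finset.prod_congr rfl fun k _ => ?_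
      have : t' (ι k) = t k := dif_pos k.2
      rw [this]
    · simp only [Finset.mem_map, not_exists, not_and]
      rintro k - h
      have h1 : k.1 = n + 1 := congrArg Subtype.val h
      have := k.2
      omega
  rw [← key, hν, Measure.smul_apply, Measure.map_apply (measurable_tail n) hV,
    Measure.restrict_apply (measurable_tail n hV), smul_eq_mul, ← mul_assoc,
    ENNReal.inv_mul_cancel hc0 (ENNReal.natCast_ne_top _), one_mul]
  congr 1
  ext y
  exact and_comm

/-- The factor `(|C_1| ⋯ |C_n|)⁻¹`. -/
noncomputable def weight (P : CFSequence G) (n : ℕ) : ENNReal :=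
  (∏ k ∈ Finset.Icc 1 n, ((P.C k).card : ENNReal))⁻¹

theorem weight_succ (n : ℕ) :
    P.weight (n + 1) = P.weight n * ((P.C (n + 1)).card : ENNReal)⁻¹ := by
  rw [weight, weight, Finset.prod_Icc_succ_top (by omega), ENNReal.mul_inv]
  · right; exact ENNReal.natCast_ne_top _
  · right
    have := P.one_lt_card n
    exact_mod_cast (by omega)

theorem levelMeasure_apply (haar : Measure G) {n : ℕ} (hF : MeasurableSet (P.F n))
    {E : Set (G × ((k : {k : ℕ // n < k}) → P.C k.1))} (hE : MeasurableSet E) :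
    P.levelMeasure haar n {x | ((x.1 : G), x.2) ∈ E} =
      P.weight n * ∫⁻ f in P.F n, P.tailMeasure n {y | (f, y) ∈ E} ∂haar := by
  have hm : MeasurableSet {x : P.Level n | ((x.1 : G), x.2) ∈ E} :=
    ((measurable_subtype_coe.comp measurable_fst).prodMk measurable_snd) hE
  have h1 : P.levelMeasure haar n =
      (P.weight n • haar.comap Subtype.val).prod (P.tailMeasure n) := rfl
  rw [h1, Measure.prod_apply hm, lintegral_smul_measure, smul_eq_mul]
  congr 1
  exact lintegral_subtype_comap hF fun f => P.tailMeasure n {y | (f, y) ∈ E}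

/-- A measurable subset of `X_n` is the trace of a measurable set of pairs with first component in
the whole group. -/
theorem exists_eq_preimage {n : ℕ} (hF : MeasurableSet (P.F n)) {E : Set (P.Level n)}
    (hE : MeasurableSet E) : ∃ E' : Set (G × ((k : {k : ℕ // n < k}) → P.C k.1)),
      MeasurableSet E' ∧ E = {x | ((x.1 : G), x.2) ∈ E'} := by
  have he : MeasurableEmbedding
      (fun x : P.Level n => ((x.1 : G), x.2)) :=
    (MeasurableEmbedding.subtype_coe hF).prodMap MeasurableEmbedding.id
  exact ⟨_, he.measurableSet_image.2 hE, (Set.preimage_image_eq E he.injective).symm⟩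

section Invariance

variable [MeasurableMul₂ G] [MeasurableSingletonClass G] (haar : Measure G)
  [haar.IsMulLeftInvariant] [haar.IsMulRightInvariant]

/-- The map `x ↦ g x c_{n+1}` does not decrease measure, from `X_n` to `X_{n+1}`: it maps the points
with a given `c_{n+1} = c` onto a piece of `X_{n+1}`, and the pieces are disjoint. -/
theorem levelMeasure_step_preimage_le (hF : ∀ n, MeasurableSet (P.F n)) (g : G) {n : ℕ}
    (hn : ∀ f ∈ P.F n, ∀ c ∈ P.C (n + 1), g * f * c ∈ P.F (n + 1)) {E : Set (P.Level (n + 1))}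
    (hE : MeasurableSet E) :
    P.levelMeasure haar n (P.step g hn ⁻¹' E) ≤ P.levelMeasure haar (n + 1) E := by
  obtain ⟨E', hE', rfl⟩ := exists_eq_preimage (hF (n + 1)) hE
  set E'' : Set (G × ((k : {k : ℕ // n < k}) → P.C k.1)) :=
    {p | (g * p.1 * (P.head p.2 : G), P.tail p.2) ∈ E'} with hE''
  have hmE'' : MeasurableSet E'' := by
    refine Measurable.prodMk ?_ ((measurable_tail n).comp measurable_snd) hE'
    exact (measurable_fst.const_mul g).mul
      (measurable_subtype_coe.comp ((measurable_head n).comp measurable_snd))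
  have h0 : P.step g hn ⁻¹' {x | ((x.1 : G), x.2) ∈ E'} = {x | ((x.1 : G), x.2) ∈ E''} := rfl
  rw [h0, levelMeasure_apply haar (hF n) hmE'', levelMeasure_apply haar (hF (n + 1)) hE',
    weight_succ, mul_assoc]
  refine mul_le_mul_right ?_ _
  set h : G → ENNReal := fun p => P.tailMeasure (n + 1) {y | (p, y) ∈ E'} with hh
  have hhm : Measurable h := measurable_measure_prodMk_left hE'
  have split : ∀ f, P.tailMeasure n {y | (f, y) ∈ E''} =
      ∑ c : P.C (n + 1), ((P.C (n + 1)).card : ENNReal)⁻¹ * h (g * f * c) := by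
    intro f
    have hs : ∀ c : P.C (n + 1), MeasurableSet {y | (g * f * (c : G), y) ∈ E'} := fun c =>
      measurable_prodMk_left hE'
    have : {y | (f, y) ∈ E''} = ⋃ c : P.C (n + 1),
        {y | P.head y = c ∧ P.tail y ∈ {y | (g * f * (c : G), y) ∈ E'}} := by
      ext y
      simp [hE'']
    rw [this, measure_iUnion, tsum_fintype]
    · exact Finset.sum_congr rfl fun c _ => tailMeasure_head_tail n c (hs c)
    · intro c c' hne
      exact Set.disjoint_left.2 fun y hy hy' => hne (hy.1.symm.trans hy'.1)
    · exact fun c =>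
        (measurable_head n (measurableSet_singleton c)).inter (measurable_tail n (hs c))
  simp only [split]
  have hφ : ∀ c : G, MeasurePreserving (fun f => g * f * c) haar haar := fun c =>
    (measurePreserving_mul_right haar c).comp (measurePreserving_mul_left haar g)
  -- the translates `g F_n c`, which are disjoint subsets of `F_{n+1}`
  set Q : P.C (n + 1) → Set G := fun c => {p | g⁻¹ * p * (c : G)⁻¹ ∈ P.F n} with hQ
  have hQm : ∀ c, MeasurableSet (Q c) := fun c =>
    ((measurable_const_mul g⁻¹).mul_const _) (hF n)
  have hQF : ∀ c, Q c ⊆ P.F (n + 1) := by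
    intro c p hp
    have := hn _ hp c c.2
    simpa [mul_assoc] using this
  have hQd : Pairwise (Function.onFun Disjoint Q) := by
    intro c c' hne
    refine Set.disjoint_left.2 fun p hp hp' => ?_
    exact Set.disjoint_left.1 (P.disjoint n _ c.2 _ c'.2 (fun h => hne (Subtype.ext h)))
      (show g⁻¹ * p ∈ P.F n * {(c : G)} from ⟨_, hp, _, rfl, by simp⟩)
      ⟨_, hp', _, rfl, by simp⟩
  have piece : ∀ c : P.C (n + 1), ∫⁻ f in P.F n, h (g * f * c) ∂haar = ∫⁻ p in Q c, h p ∂haar := by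
    intro c
    have : P.F n = (fun f => g * f * (c : G)) ⁻¹' Q c := by
      ext f; simp [hQ, mul_assoc]
    rw [this]
    exact (hφ c).setLIntegral_comp_preimage (hQm c) hhm
  have term : ∀ c : P.C (n + 1), ∫⁻ f in P.F n, ((P.C (n + 1)).card : ENNReal)⁻¹ *
      h (g * f * c) ∂haar = ((P.C (n + 1)).card : ENNReal)⁻¹ * ∫⁻ p in Q c, h p ∂haar := by
    intro c
    have hm : Measurable fun f => h (g * f * c) :=
      hhm.comp ((measurable_const_mul g).mul_const _)
    rw [lintegral_const_mul _ hm, piece]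
  rw [lintegral_finsetSum]
  · simp only [term]
    rw [← Finset.mul_sum]
    refine mul_le_mul_right ?_ _
    rw [← tsum_fintype (L := .unconditional _), ← lintegral_iUnion hQm hQd]
    exact lintegral_mono_set (Set.iUnion_subset hQF)
  · exact fun c _ => (hhm.comp ((measurable_const_mul g).mul_const _)).const_mul _

theorem monotone_map_incl (hF : ∀ n, MeasurableSet (P.F n)) :
    Monotone fun n => (P.levelMeasure haar n).map (P.incl n) := by
  refine monotone_nat_of_le_succ fun n => Measure.le_iff.2 fun E hE => ?_
  rw [Measure.map_apply (measurable_incl n) hE, Measure.map_apply (measurable_incl (n + 1)) hE]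
  refine le_trans (le_of_eq ?_) (levelMeasure_step_preimage_le haar hF 1 (P.one_gap n)
    (measurable_incl (n + 1) hE))
  rw [step_one]
  congr 1
  ext x
  simp only [Set.mem_preimage, P.incl_embed]

theorem limitMeasure_apply (hF : ∀ n, MeasurableSet (P.F n)) {E : Set P.Space}
    (hE : MeasurableSet E) :
    P.limitMeasure haar E = ⨆ n, P.levelMeasure haar n (P.incl n ⁻¹' E) := by
  rw [limitMeasure, iSup_measure_apply (monotone_map_incl haar hF) hE]
  exact iSup_congr fun n => Measure.map_apply (measurable_incl n) hE

theorem levelMeasure_mono (hF : ∀ n, MeasurableSet (P.F n)) {E : Set P.Space}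
    (hE : MeasurableSet E) {n m : ℕ} (h : n ≤ m) :
    P.levelMeasure haar n (P.incl n ⁻¹' E) ≤ P.levelMeasure haar m (P.incl m ⁻¹' E) := by
  rw [← Measure.map_apply (measurable_incl n) hE, ← Measure.map_apply (measurable_incl m) hE]
  exact monotone_map_incl haar hF h E

theorem limitMeasure_T_preimage_le (hF : ∀ n, MeasurableSet (P.F n)) (g : G) {E : Set P.Space}
    (hE : MeasurableSet E) : P.limitMeasure haar (P.T g ⁻¹' E) ≤ P.limitMeasure haar E := by
  rw [limitMeasure_apply haar hF hE, limitMeasure_apply haar hF (measurable_T g hE)]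
  refine iSup_le fun n => ?_
  have hm := le_max_right n (P.gapIndex g)
  refine (levelMeasure_mono haar hF (measurable_T g hE) (le_max_left n (P.gapIndex g))).trans ?_
  refine le_trans (le_of_eq ?_) ((levelMeasure_step_preimage_le haar hF g (P.gapIndex_spec g hm)
    (measurable_incl _ hE)).trans (le_iSup (fun n => P.levelMeasure haar n (P.incl n ⁻¹' E)) _))
  congr 1
  ext x
  simp only [Set.mem_preimage, P.T_incl g hm]

/-- The inequality for the preimages under `T_g`, used for `g` and for `g⁻¹`, is an equality. -/
theorem measurePreserving_T (hF : ∀ n, MeasurableSet (P.F n)) (g : G) :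
    MeasurePreserving (P.T g) (P.limitMeasure haar) (P.limitMeasure haar) := by
  refine ⟨measurable_T g, Measure.ext fun E hE => ?_⟩
  rw [Measure.map_apply (measurable_T g) hE]
  refine le_antisymm (limitMeasure_T_preimage_le haar hF g hE) ?_
  have h := limitMeasure_T_preimage_le haar hF g⁻¹ (measurable_T g hE)
  have : P.T g⁻¹ ⁻¹' (P.T g ⁻¹' E) = E := by
    ext x
    simp only [Set.mem_preimage, ← P.T_mul, mul_inv_cancel, P.T_one]
  rwa [this] at h

/-! ### Cylinders -/

theorem haar_mul_C {n : ℕ} {A : Set G} (hA : A ⊆ P.F n) (hm : MeasurableSet A) :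
    haar (A * (P.C (n + 1) : Set G)) = (P.C (n + 1)).card * haar A := by
  have h1 : A * (P.C (n + 1) : Set G) = ⋃ c ∈ P.C (n + 1), A * {c} := by
    ext x
    simp only [Set.mem_mul, Set.mem_iUnion, Finset.mem_coe, exists_prop, Set.mem_singleton_iff,
      exists_eq_left]
    exact ⟨fun ⟨a, ha, c, hc, h⟩ => ⟨c, hc, a, ha, h⟩, fun ⟨c, hc, a, ha, h⟩ => ⟨a, ha, c, hc, h⟩⟩
  have h2 : ∀ c : G, A * {c} = (fun x => x * c⁻¹) ⁻¹' A := fun c => by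
    ext x; simp
  rw [h1, measure_biUnion_finset]
  · simp only [h2, measure_preimage_mul_right, Finset.sum_const, nsmul_eq_mul]
  · exact fun c hc c' hc' hne => (P.disjoint n c hc c' hc' hne).mono
      (Set.mul_subset_mul_right hA) (Set.mul_subset_mul_right hA)
  · intro c _
    rw [h2]
    exact measurable_mul_const _ hm

theorem mul_C_subset {n : ℕ} {A : Set G} (hA : A ⊆ P.F n) :
    A * (P.C (n + 1) : Set G) ⊆ P.F (n + 1) := by
  rintro _ ⟨f, hf, c, hc, rfl⟩
  exact P.mul_mem n f (hA hf) c hc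

theorem measurableSet_mul_C {A : Set G} (hm : MeasurableSet A) (n : ℕ) :
    MeasurableSet (A * (P.C n : Set G)) := by
  have : A * (P.C n : Set G) = ⋃ c ∈ P.C n, (fun x => x * c⁻¹) ⁻¹' A := by
    ext x
    simp only [Set.mem_mul, Set.mem_iUnion, Finset.mem_coe, exists_prop, Set.mem_preimage]
    constructor
    · rintro ⟨a, ha, c, hc, rfl⟩
      exact ⟨c, hc, by simpa using ha⟩
    · rintro ⟨c, hc, h⟩
      exact ⟨_, h, c, hc, by simp⟩
  rw [this]
  exact Finset.measurableSet_biUnion _ fun c _ => measurable_mul_const _ hm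

theorem levelMeasure_fst {n : ℕ} (hF : MeasurableSet (P.F n)) {A : Set G} (hA : A ⊆ P.F n)
    (hm : MeasurableSet A) :
    P.levelMeasure haar n {x | x.1.1 ∈ A} = P.weight n * haar A := by
  have h := levelMeasure_apply haar hF (E := Prod.fst ⁻¹' A) (measurable_fst hm)
  refine h.trans ?_
  congr 1
  have : ∀ f, P.tailMeasure n {y | (f, y) ∈ (Prod.fst ⁻¹' A :
      Set (G × ((k : {k : ℕ // n < k}) → P.C k.1)))} = A.indicator 1 f := by
    intro f
    by_cases hf : f ∈ A <;> simp [hf]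
  simp only [this]
  rw [lintegral_indicator_one hm, Measure.restrict_apply hm, Set.inter_eq_left.2 hA]

theorem measurableSet_cyl {n : ℕ} {A : Set G} (hA : A ⊆ P.F n)
    (hm : MeasurableSet A) : MeasurableSet (P.cyl n A) := by
  refine measurableSet_of_le n fun m h => ?_
  obtain ⟨j, rfl⟩ := Nat.exists_eq_add_of_le h
  clear h
  induction j generalizing n A with
  | zero =>
    rw [add_zero, incl_preimage_cyl]
    exact (measurable_subtype_coe.comp measurable_fst) hm
  | succ j ih =>
    have := ih (mul_C_subset hA) (measurableSet_mul_C hm (n + 1))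
    have e : n + 1 + j = n + (j + 1) := by omega
    rwa [← cyl_succ hA, e] at this

/-- A cylinder over `A ⊆ F_n` has a trace of the same measure on all levels `m ≥ n`. -/
theorem levelMeasure_cyl (hF : ∀ n, MeasurableSet (P.F n)) {n : ℕ} {A : Set G} (hA : A ⊆ P.F n)
    (hm : MeasurableSet A) {m : ℕ} (h : n ≤ m) :
    P.levelMeasure haar m (P.incl m ⁻¹' P.cyl n A) = P.weight n * haar A := by
  obtain ⟨j, rfl⟩ := Nat.exists_eq_add_of_le h
  clear h
  induction j generalizing n A with
  | zero =>
    rw [add_zero, incl_preimage_cyl]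
    exact levelMeasure_fst haar (hF n) hA hm
  | succ j ih =>
    have := ih (mul_C_subset hA) (measurableSet_mul_C hm (n + 1))
    have e : n + 1 + j = n + (j + 1) := by omega
    have hc0 : ((P.C (n + 1)).card : ENNReal) ≠ 0 := by
      have := P.one_lt_card n
      exact_mod_cast (by omega)
    rw [← cyl_succ hA, haar_mul_C haar hA hm, weight_succ, e, mul_assoc, ← mul_assoc _⁻¹,
      ENNReal.inv_mul_cancel hc0 (ENNReal.natCast_ne_top _), one_mul] at this
    exact this

theorem limitMeasure_cyl (hF : ∀ n, MeasurableSet (P.F n)) {n : ℕ} {A : Set G} (hA : A ⊆ P.F n)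
    (hm : MeasurableSet A) : P.limitMeasure haar (P.cyl n A) = P.weight n * haar A := by
  have hmc := measurableSet_cyl hA hm
  rw [limitMeasure_apply haar hF hmc]
  refine le_antisymm (iSup_le fun m => ?_)
    (le_iSup_of_le n (levelMeasure_cyl haar hF hA hm le_rfl).ge)
  exact (levelMeasure_mono haar hF hmc (le_max_right n m)).trans
    (levelMeasure_cyl haar hF hA hm (le_max_left n m)).le

end Invariance

end CFSequence

/-! ### The probability space of the construction -/

namespace GG

instance : haar.IsMulLeftInvariant := by
  refine ⟨fun g => Measure.ext fun E hE => ?_⟩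
  rw [Measure.map_apply (measurable_const_mul g) hE]
  exact haar_left g hE

instance : haar.IsMulRightInvariant := by
  refine ⟨fun g => Measure.ext fun E hE => ?_⟩
  rw [Measure.map_apply (measurable_mul_const g) hE]
  exact haar_right g hE

end GG

namespace Construction

open GG Cstr

variable {K : Construction}

theorem toCF_F (n : ℕ) : K.toCF.F n = F K.r (n + 1) := rfl

theorem toCF_C (n : ℕ) : K.toCF.C n = Csucc K.r K.s n := rfl

theorem measurableSet_toCF_F (n : ℕ) : MeasurableSet (K.toCF.F n) := measurableSet_F K.r (n + 1)

theorem card_Csucc {n : ℕ} (hn : 1 ≤ n) : (Csucc K.r K.s n).card = (2 * K.r n + 1) ^ 2 := by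
  classical
  rw [Csucc, Finset.card_image_of_injOn, card_H]
  intro h hh h' hh' heq
  obtain ⟨m, rfl⟩ : ∃ m, n = m + 1 := ⟨n - 1, by omega⟩
  have h1 : (1 : GG) ∈ F K.r (m + 1) := zero_mem_box (Nat.mul_pos (by omega) (aTilde_pos _ _))
  have w := K.copy_mem_window (by omega) h1 hh
  have w' := K.copy_mem_window (by omega) h1 hh'
  rw [one_mul] at w w'
  exact window_inj w w' heq

theorem summable_ratio (K : Construction) : Summable (ratio K.r) := by
  have h : Summable fun n : ℕ => 3 * (1 / (n : ℝ) ^ 2) :=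
    (Real.summable_one_div_nat_pow.2 (by norm_num)).mul_left 3
  refine Summable.of_norm_bounded_eventually_nat h ?_
  filter_upwards [K.r_growth.eventually_le_const (show (0 : ℝ) < 1 by norm_num),
    eventually_ge_atTop 1] with n h1 hn
  have hr : (0 : ℝ) < K.r n := by exact_mod_cast K.r_pos n
  have hn' : (1 : ℝ) ≤ n := by exact_mod_cast hn
  rw [div_le_one hr] at h1
  rw [Real.norm_of_nonneg (ratio_nonneg _ _), ratio, mul_one_div,
    div_le_div_iff₀ (by positivity) (by positivity)]
  have h3 : (n : ℝ) ^ 3 ≤ n ^ 4 := pow_le_pow_right₀ hn' (by norm_num)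
  have h2 : (n : ℝ) ^ 2 ≤ n ^ 4 := pow_le_pow_right₀ hn' (by norm_num)
  have : (2 * (n : ℝ) + 1) * n ^ 2 = 2 * n ^ 3 + n ^ 2 := by ring
  rw [this]
  linarith

/-- The measure of `X_n`, before normalization. -/
noncomputable def mass (K : Construction) (n : ℕ) : ℝ :=
  (K.toCF.weight n * haar (K.toCF.F n)).toReal

theorem weight_ne_top (n : ℕ) : K.toCF.weight n ≠ ⊤ := by
  rw [CFSequence.weight, Ne, ENNReal.inv_eq_top, Finset.prod_eq_zero_iff]
  rintro ⟨k, hk, h0⟩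
  have := Finset.card_pos.2 (K.toCF.C_nonempty (k := k) (by have := (Finset.mem_Icc.1 hk).1; omega))
  rw [Nat.cast_eq_zero] at h0
  omega

theorem weight_ne_zero (n : ℕ) : K.toCF.weight n ≠ 0 := by
  rw [CFSequence.weight, Ne, ENNReal.inv_eq_zero]
  exact ENNReal.prod_ne_top fun k _ => ENNReal.natCast_ne_top _

/-- Passing from `X_n` to `X_{n+1}` multiplies the measure by `(ã_{n+1} / a_{n+1})²`. -/
theorem mass_succ_le (n : ℕ) : K.mass (n + 1) ≤ K.mass n * Real.exp (4 * ratio K.r n) := by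
  have hF : ∀ m, haar.real (F K.r (m + 1)) = 8 * (a K.r (m + 1) : ℝ) ^ 2 := fun m => haar_real_box _
  have hw0 : 0 ≤ (K.toCF.weight n).toReal := ENNReal.toReal_nonneg
  have e1 : K.mass (n + 1) = (K.toCF.weight n).toReal * (8 * (aTilde K.r (n + 1) : ℝ) ^ 2) := by
    have hR : (0 : ℝ) < 2 * K.r (n + 1) + 1 := by positivity
    rw [mass, CFSequence.weight_succ, toCF_C, card_Csucc (by omega), ENNReal.toReal_mul,
      ENNReal.toReal_mul, toCF_F, ← measureReal_def, hF, a_succ, ENNReal.toReal_inv,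
      ENNReal.toReal_natCast]
    push_cast
    field_simp
  have e2 : K.mass n = (K.toCF.weight n).toReal * (8 * (a K.r (n + 1) : ℝ) ^ 2) := by
    rw [mass, ENNReal.toReal_mul, toCF_F, ← measureReal_def, hF]
  have h1 : (aTilde K.r (n + 1) : ℝ) ≤ a K.r (n + 1) * (1 + 2 * ratio K.r n) := by
    have : (aTilde K.r (n + 1) : ℝ) ≤ a K.r (n + 1) + 2 * b K.r (n + 1) := by
      exact_mod_cast aTilde_sub_a_le K.r n
    rw [b_eq_ratio_mul] at this
    linarith
  have h2 : 1 + 2 * ratio K.r n ≤ Real.exp (2 * ratio K.r n) := by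
    have := Real.add_one_le_exp (2 * ratio K.r n)
    linarith
  have h3 : Real.exp (4 * ratio K.r n) = Real.exp (2 * ratio K.r n) ^ 2 := by
    rw [← Real.exp_nat_mul]; congr 1; push_cast; ring
  have hq := ratio_nonneg K.r n
  rw [e1, e2, h3, mul_assoc, mul_assoc, ← mul_pow]
  gcongr
  exact h1.trans (by gcongr)

theorem mass_le (n : ℕ) : K.mass n ≤ K.mass 0 * Real.exp (4 * ∑' k, ratio K.r k) := by
  have h : K.mass n ≤ K.mass 0 * Real.exp (4 * ∑ k ∈ Finset.range n, ratio K.r k) := by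
    induction n with
    | zero => simp
    | succ n ih =>
      refine (mass_succ_le n).trans ?_
      rw [Finset.sum_range_succ, mul_add, Real.exp_add, ← mul_assoc]
      gcongr
  refine h.trans ?_
  have h0 : 0 ≤ K.mass 0 := ENNReal.toReal_nonneg
  have := (summable_ratio K).sum_le_tsum (Finset.range n) (fun k _ => ratio_nonneg _ _)
  gcongr

theorem haar_toCF_F_ne_top (n : ℕ) : haar (K.toCF.F n) ≠ ⊤ := haar_box_ne_top _

theorem haar_toCF_F_ne_zero (n : ℕ) : haar (K.toCF.F n) ≠ 0 := by
  have h := haar_real_F_pos (K := K) (n := n + 1) (by omega)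
  intro h0
  rw [measureReal_def, ← toCF_F, h0] at h
  simp at h

theorem measurable_cyl {n : ℕ} {A : Set GG} (hA : A ⊆ F K.r (n + 1)) (hm : MeasurableSet A) :
    MeasurableSet (K.toCF.cyl n A) := CFSequence.measurableSet_cyl (P := K.toCF) hA hm

theorem limitMeasure_toCF_cyl {n : ℕ} {A : Set GG} (hA : A ⊆ F K.r (n + 1)) (hm : MeasurableSet A) :
    K.toCF.limitMeasure haar (K.toCF.cyl n A) = K.toCF.weight n * haar A :=
  CFSequence.limitMeasure_cyl haar measurableSet_toCF_F hA hm

theorem monotone_cyl_F : Monotone fun n => K.toCF.cyl n (F K.r (n + 1)) := by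
  refine monotone_nat_of_le_succ fun n => ?_
  rw [← toCF_F, ← toCF_F, CFSequence.cyl_succ subset_rfl]
  exact CFSequence.cyl_mono (CFSequence.mul_C_subset subset_rfl)

theorem iUnion_cyl_F : ⋃ n, K.toCF.cyl n (F K.r (n + 1)) = Set.univ := by
  refine Set.eq_univ_of_forall fun x => ?_
  obtain ⟨n, hn⟩ := CFSequence.exists_mem_range_incl x
  exact Set.mem_iUnion.2 ⟨n, by rwa [← toCF_F, CFSequence.cyl_F]⟩

theorem limitMeasure_univ_ne_top : K.toCF.limitMeasure haar Set.univ ≠ ⊤ := by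
  rw [← iUnion_cyl_F, monotone_cyl_F.measure_iUnion]
  refine ne_top_of_le_ne_top (ENNReal.ofReal_ne_top
    (r := K.mass 0 * Real.exp (4 * ∑' k, ratio K.r k))) (iSup_le fun n => ?_)
  rw [limitMeasure_toCF_cyl subset_rfl (measurableSet_F _ _), ← toCF_F,
    ← ENNReal.ofReal_toReal (ENNReal.mul_ne_top (weight_ne_top n) (haar_toCF_F_ne_top n))]
  exact ENNReal.ofReal_le_ofReal (mass_le n)

theorem limitMeasure_univ_ne_zero : K.toCF.limitMeasure haar Set.univ ≠ 0 := by
  intro h0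
  have h := measure_mono_null (Set.subset_univ (K.toCF.cyl 0 (F K.r (0 + 1)))) h0
  rw [limitMeasure_toCF_cyl subset_rfl (measurableSet_F _ _), mul_eq_zero] at h
  exact h.elim (weight_ne_zero 0) (haar_toCF_F_ne_zero 0)

instance : IsProbabilityMeasure K.μ := by
  refine ⟨?_⟩
  change ((K.toCF.limitMeasure haar Set.univ)⁻¹ • K.toCF.limitMeasure haar) Set.univ = 1
  rw [Measure.smul_apply, smul_eq_mul,
    ENNReal.inv_mul_cancel limitMeasure_univ_ne_zero limitMeasure_univ_ne_top]

theorem measurePreserving_smul (g : GG) : MeasurePreserving (fun x : K.X => g • x) K.μ K.μ :=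
  (CFSequence.measurePreserving_T haar measurableSet_toCF_F g).smul_measure _

theorem μ_real_cyl {n : ℕ} {A : Set GG} (hA : A ⊆ F K.r (n + 1)) (hm : MeasurableSet A) :
    K.μ.real (K.toCF.cyl n A) =
      K.dens (n + 1) A * K.μ.real (K.toCF.cyl n (F K.r (n + 1))) := by
  have h : ∀ A ⊆ F K.r (n + 1), MeasurableSet A → K.μ.real (K.toCF.cyl n A) =
      ((K.toCF.limitMeasure haar Set.univ)⁻¹ * K.toCF.weight n).toReal * haar.real A := by
    intro A hA hm
    change (((K.toCF.limitMeasure haar Set.univ)⁻¹ • K.toCF.limitMeasure haar)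
      (K.toCF.cyl n A)).toReal = _
    rw [Measure.smul_apply, smul_eq_mul, limitMeasure_toCF_cyl hA hm, ← mul_assoc,
      ENNReal.toReal_mul, measureReal_def]
  rw [h A hA hm, h _ subset_rfl (measurableSet_F _ _), dens]
  have := (haar_real_F_pos (K := K) (n := n + 1) (by omega)).ne'
  field_simp

theorem tendsto_μ_real_cyl_F (K : Construction) :
    Tendsto (fun n => K.μ.real (K.toCF.cyl n (F K.r (n + 1)))) atTop (𝓝 1) := by
  have h := tendsto_measure_iUnion_atTop (μ := K.μ) (monotone_cyl_F (K := K))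
  rw [iUnion_cyl_F, measure_univ] at h
  exact (ENNReal.tendsto_toReal ENNReal.one_ne_top).comp h

end Construction

/-! ### Cylinders over atoms -/

namespace Construction

open GG Cstr

variable {K : Construction}

/-- The cylinders over unions of atoms of the partitions `ξ_n`. -/
def atomCylinders (K : Construction) : Set (Set K.X) :=
  {E | ∃ n A, IsUnionOfAtoms (K.ξ (n + 1)) A ∧ E = K.toCF.cyl n A}

theorem isUnionOfAtoms_inter {n : ℕ} (hn : 1 ≤ n) {A B : Set GG}
    (hA : IsUnionOfAtoms (K.ξ n) A) (hB : IsUnionOfAtoms (K.ξ n) B) :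
    IsUnionOfAtoms (K.ξ n) (A ∩ B) := by
  rw [isUnionOfAtoms_iff]
  rintro x ⟨hxA, hxB⟩
  obtain ⟨α, hα, hxα, hαA⟩ := isUnionOfAtoms_iff.1 hA x hxA
  obtain ⟨β, hβ, hxβ, hβB⟩ := isUnionOfAtoms_iff.1 hB x hxB
  obtain rfl : α = β := (K.ξ_disjoint n hn).elim hα hβ (Set.not_disjoint_iff.2 ⟨x, hxα, hxβ⟩)
  exact ⟨α, hα, hxα, Set.subset_inter hαA hβB⟩

theorem isUnionOfAtoms_F_sdiff {n : ℕ} (hn : 1 ≤ n) {A : Set GG}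
    (hA : IsUnionOfAtoms (K.ξ n) A) : IsUnionOfAtoms (K.ξ n) (F K.r n \ A) := by
  rw [isUnionOfAtoms_iff]
  rintro x ⟨hxF, hxA⟩
  obtain ⟨α, hα, hxα, hαF⟩ := isUnionOfAtoms_iff.1 (isUnionOfAtoms_F hn) x hxF
  refine ⟨α, hα, hxα, fun y hy => ⟨hαF hy, fun hyA => hxA ?_⟩⟩
  obtain ⟨β, hβ, hyβ, hβA⟩ := isUnionOfAtoms_iff.1 hA y hyA
  obtain rfl : α = β := (K.ξ_disjoint n hn).elim hα hβ (Set.not_disjoint_iff.2 ⟨y, hy, hyβ⟩)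
  exact hβA hxα

theorem cyl_succ_lift {n : ℕ} {A : Set GG} (hA : A ⊆ F K.r (n + 1)) :
    K.toCF.cyl n A = K.toCF.cyl (n + 1) (K.lift (n + 1) A) := CFSequence.cyl_succ (P := K.toCF) hA

/-- A cylinder over a union of atoms is such a cylinder at all later levels. -/
theorem exists_cyl_eq {n : ℕ} {A : Set GG} (hA : IsUnionOfAtoms (K.ξ (n + 1)) A) {m : ℕ}
    (h : n ≤ m) : ∃ B, IsUnionOfAtoms (K.ξ (m + 1)) B ∧ K.toCF.cyl n A = K.toCF.cyl m B := by
  induction m, h using Nat.le_induction with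
  | base => exact ⟨A, hA, rfl⟩
  | succ m _ ih =>
    obtain ⟨B, hB, hAB⟩ := ih
    exact ⟨_, isUnionOfAtoms_lift (by omega) hB,
      hAB.trans (cyl_succ_lift (subset_F_of_isUnionOfAtoms (by omega) hB))⟩

theorem isPiSystem_atomCylinders (K : Construction) : IsPiSystem K.atomCylinders := by
  rintro _ ⟨n, A, hA, rfl⟩ _ ⟨m, B, hB, rfl⟩ -
  obtain ⟨A', hA', hAA'⟩ := exists_cyl_eq hA (le_max_left n m)
  obtain ⟨B', hB', hBB'⟩ := exists_cyl_eq hB (le_max_right n m)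
  rw [hAA', hBB', CFSequence.cyl_inter]
  exact ⟨_, _, isUnionOfAtoms_inter (by omega) hA' hB', rfl⟩

/-! ### Cylinders generate the σ-algebra -/

/-- Right translations are isometries, at distances less than one. -/
theorem distance_mul_right {p q d : GG} (h : distance (p * d) (q * d) < 1) :
    distance p q = distance (p * d) (q * d) := by
  have he : p.e = q.e := by
    by_contra hne
    have : (p * d).e ≠ (q * d).e := fun h => hne (add_right_cancel h)
    rw [distance, if_neg this] at h
    exact absurd (le_max_right _ _) (not_le.2 h)
  simp [distance, mul_def, he]

/-- The transition from level `n` to level `n + j`, near a point: it is a right translation,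
compatible with unions of atoms. -/
theorem exists_shift_fst {n : ℕ} (j : ℕ) (x : K.toCF.Level n) : ∃ d : GG,
    (CFSequence.shift j x).1.1 = x.1.1 * d ∧
    (∀ A, IsUnionOfAtoms (K.ξ (n + 1)) A → IsUnionOfAtoms (K.ξ (n + j + 1)) (A * {d})) ∧
    ∀ B ⊆ F K.r (n + 1), B * {d} ⊆ F K.r (n + j + 1) ∧
      K.toCF.cyl (n + j) (B * {d}) ⊆ K.toCF.cyl n B := by
  induction j with
  | zero =>
    have h1 : ∀ B : Set GG, B * {1} = B := fun B => by ext; simp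
    refine ⟨1, (mul_one _).symm, fun A hA => ?_, fun B hB => ?_⟩
    · rw [h1]; exact hA
    · rw [h1]; exact ⟨hB, subset_rfl⟩
  | succ j ih =>
    obtain ⟨d, h1, h2, h3⟩ := ih
    set c := K.toCF.head (CFSequence.shift j x).2 with hc
    have hassoc : ∀ B : Set GG, B * {d * c.1} = B * {d} * {c.1} := fun B => by
      ext y; simp [mul_assoc]
    have hsub : ∀ B : Set GG, B * {c.1} ⊆ B * (K.toCF.C (n + j + 1) : Set GG) := fun B =>
      Set.mul_subset_mul_left (Set.singleton_subset_iff.2 c.2)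
    refine ⟨d * c.1, ?_, fun A hA => ?_, fun B hB => ?_⟩
    · rw [← mul_assoc, ← h1]; rfl
    · rw [hassoc]
      exact isUnionOfAtoms_mul_singleton (by omega) (h2 A hA) c.2
    · rw [hassoc]
      obtain ⟨h4, h5⟩ := h3 B hB
      refine ⟨(hsub _).trans (CFSequence.mul_C_subset (P := K.toCF) (n := n + j) h4), ?_⟩
      refine (CFSequence.cyl_mono (P := K.toCF) (hsub (B * {d}))).trans ?_
      exact (CFSequence.cyl_succ (P := K.toCF) (n := n + j) h4).symm.subset.trans h5

/-- The cylinder over an open subset of `F_n` is a union of cylinders over atoms. -/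
theorem generateMeasurable_cyl {U : Set GG} {n : ℕ}
    (hU : ∀ p ∈ U, ∃ δ > 0, ∀ q, distance q p < δ → q ∈ U) :
    MeasurableSet[MeasurableSpace.generateFrom K.atomCylinders]
      (K.toCF.cyl n (U ∩ F K.r (n + 1))) := by
  have hcount : {V : Set K.X | (∃ k, ∃ α ∈ K.ξ (k + 1), V = K.toCF.cyl k α) ∧
      V ⊆ K.toCF.cyl n (U ∩ F K.r (n + 1))}.Countable := by
    refine (Set.countable_iUnion fun k : ℕ =>
      ((K.ξ_finite (k + 1) (by omega)).image (K.toCF.cyl k)).countable).mono ?_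
    rintro _ ⟨⟨k, α, hα, rfl⟩, -⟩
    exact Set.mem_iUnion.2 ⟨k, α, hα, rfl⟩
  have heq : K.toCF.cyl n (U ∩ F K.r (n + 1)) =
      ⋃₀ {V : Set K.X | (∃ k, ∃ α ∈ K.ξ (k + 1), V = K.toCF.cyl k α) ∧
        V ⊆ K.toCF.cyl n (U ∩ F K.r (n + 1))} := by
    refine Set.Subset.antisymm ?_ (Set.sUnion_subset fun V hV => hV.2)
    rintro _ ⟨x, ⟨hxU, hxF⟩, rfl⟩
    obtain ⟨δ, hδ, hball⟩ := hU _ hxU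
    obtain ⟨j, hj⟩ := exists_nat_gt (1 / δ)
    obtain ⟨d, h1, h2, h3⟩ := exists_shift_fst j x
    obtain ⟨β, hβ, hxβ, hβF⟩ := isUnionOfAtoms_iff.1 (h2 _ (isUnionOfAtoms_F (by omega)))
      (x.1.1 * d) ⟨_, hxF, _, rfl, rfl⟩
    refine Set.mem_sUnion.2 ⟨K.toCF.cyl (n + j) β, ⟨⟨n + j, β, hβ, rfl⟩, ?_⟩, ?_⟩
    · set B : Set GG := {f | f ∈ F K.r (n + 1) ∧ f * d ∈ β} with hB
      have hBβ : β ⊆ B * {d} := by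
        intro q hq
        obtain ⟨f, hf, _, rfl, rfl⟩ := hβF hq
        exact ⟨f, ⟨hf, hq⟩, _, rfl, rfl⟩
      have hBU : B ⊆ U ∩ F K.r (n + 1) := by
        rintro f ⟨hf, hfβ⟩
        refine ⟨hball f ?_, hf⟩
        obtain ⟨η, hη, hdist⟩ := K.ξ_diam (n + j + 1) (by omega) β hβ
        have hd := (hdist _ hfβ _ hxβ).trans_lt hη
        have hle : 1 / ((n + j + 1 : ℕ) : ℝ) ≤ 1 := by
          rw [div_le_one (by positivity)]
          exact_mod_cast (by omega)
        rw [distance_mul_right (hd.trans_le hle)]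
        refine hd.trans ?_
        rw [one_div_lt (by positivity) hδ]
        refine hj.trans_le ?_
        exact_mod_cast (by omega)
      exact (CFSequence.cyl_mono hBβ).trans
        ((h3 B fun f hf => hf.1).2.trans (CFSequence.cyl_mono hBU))
    · rw [← CFSequence.incl_shift j x, CFSequence.incl_mem_cyl, h1]
      exact hxβ
  rw [heq]
  refine MeasurableSet.sUnion hcount ?_
  rintro _ ⟨⟨k, α, hα, rfl⟩, -⟩
  exact MeasurableSpace.measurableSet_generateFrom
    ⟨k, α, ⟨{α}, by simpa using hα, by simp⟩, rfl⟩

/-- A map to `X_n` is measurable if the preimages of open sets, under the first coordinate, and of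
points, under the other coordinates, are measurable. -/
theorem measurable_to_level {Ω : Type*} [MeasurableSpace Ω] {n : ℕ} {φ : Ω → K.toCF.Level n}
    (h1 : ∀ U : Set GG, (∀ p ∈ U, ∃ δ > 0, ∀ q, distance q p < δ → q ∈ U) →
      MeasurableSet {ω | (φ ω).1.1 ∈ U})
    (h2 : ∀ (k : {k : ℕ // n < k}) (c : K.toCF.C k.1), MeasurableSet {ω | (φ ω).2 k = c}) :
    Measurable φ := by
  have hdist : ∀ p q : GG, |(q.k : ℝ) - p.k| ≤ distance q p ∧ |q.t - p.t| ≤ distance q p ∧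
      (distance q p < 1 → q.e = p.e) := by
    intro p q
    refine ⟨(le_max_left _ _).trans (le_max_left _ _), (le_max_right _ _).trans (le_max_left _ _),
      fun h => ?_⟩
    by_contra hne
    rw [distance, if_neg hne] at h
    exact absurd (le_max_right _ _) (not_le.2 h)
  refine Measurable.prodMk (Measurable.subtype_mk (measurable_of_coords ?_ ?_ ?_))
    (measurable_pi_lambda _ fun k => measurable_to_countable' fun c => h2 k c)
  · refine measurable_to_countable' fun y => h1 {p | p.k = y} fun p hp => ⟨1, one_pos,
      fun q hq => ?_⟩
    have h : |((q.k - p.k : ℤ) : ℝ)| < 1 := by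
      push_cast
      exact (hdist p q).1.trans_lt hq
    have h' : |q.k - p.k| < 1 := by exact_mod_cast h
    rw [Int.abs_lt_one_iff] at h'
    have hp : p.k = y := hp
    change q.k = y
    omega
  · refine measurable_of_Ioi fun y => h1 {p | y < p.t} fun p hp => ⟨p.t - y, sub_pos.2 hp,
      fun q hq => ?_⟩
    have h := (abs_lt.1 ((hdist p q).2.1.trans_lt hq)).1
    change y < q.t
    linarith
  · refine measurable_to_countable' fun y => h1 {p | p.e = y} fun p hp => ⟨1, one_pos,
      fun q hq => ?_⟩
    exact ((hdist p q).2.2 hq).trans hp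

theorem generateFrom_atomCylinders (K : Construction) :
    (inferInstance : MeasurableSpace K.X) = MeasurableSpace.generateFrom K.atomCylinders := by
  refine le_antisymm ?_ (MeasurableSpace.generateFrom_le ?_)
  · set m := MeasurableSpace.generateFrom K.atomCylinders with hm
    intro E hE
    have hrange : ∀ n, MeasurableSet[m] (K.toCF.cyl n (F K.r (n + 1))) := fun n =>
      MeasurableSpace.measurableSet_generateFrom ⟨n, _, isUnionOfAtoms_F (by omega), rfl⟩
    -- the σ-algebra of `X_n` is contained in the trace of the generated one
    have hlevel : ∀ n, @Measurable _ _ (m.comap (K.toCF.incl n)) inferInstance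
        (id : K.toCF.Level n → K.toCF.Level n) := by
      intro n
      refine @measurable_to_level K _ (m.comap (K.toCF.incl n)) n id ?_ ?_
      · intro U hU
        refine ⟨_, generateMeasurable_cyl (K := K) (n := n) hU, ?_⟩
        rw [CFSequence.incl_preimage_cyl]
        ext x
        have : x.1.1 ∈ F K.r (n + 1) := x.1.2
        simp [this]
      · rintro ⟨k, hk⟩ c
        obtain ⟨j, rfl⟩ : ∃ j, k = n + j + 1 := ⟨k - n - 1, by omega⟩
        -- the condition `c_k = c` says that the point lies in the cylinder over `F_{k-1} c`
        refine ⟨K.toCF.cyl (n + j + 1) (F K.r (n + j + 1) * {c.1}), ?_, ?_⟩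
        · exact MeasurableSpace.measurableSet_generateFrom
            ⟨n + j + 1, _,
              isUnionOfAtoms_mul_singleton (by omega) (isUnionOfAtoms_F (by omega)) c.2, rfl⟩
        · ext x
          have hx := CFSequence.shift_snd j x ⟨n + j + 1, by omega⟩
          change K.toCF.incl n x ∈ K.toCF.cyl (n + j + 1) (F K.r (n + j + 1) * {c.1}) ↔
            x.2 ⟨n + j + 1, hk⟩ = c
          rw [← hx, ← CFSequence.incl_shift j, ← K.toCF.incl_embed, CFSequence.incl_mem_cyl]
          set w := CFSequence.shift j x
          constructor
          · rintro ⟨f, hf, _, rfl, hfc⟩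
            by_contra hne
            exact Set.disjoint_left.1 (K.toCF.disjoint (n + j) _ (K.toCF.head w.2).2 _ c.2
              (fun h => hne (Subtype.ext h))) ⟨w.1.1, w.1.2, _, rfl, rfl⟩ ⟨f, hf, _, rfl, hfc⟩
          · intro h
            exact ⟨w.1.1, w.1.2, _, rfl, by rw [← h]; rfl⟩
    have hE' : E = ⋃ n, E ∩ K.toCF.cyl n (F K.r (n + 1)) := by
      rw [← Set.inter_iUnion, iUnion_cyl_F, Set.inter_univ]
    rw [hE']
    refine MeasurableSet.iUnion fun n => ?_
    obtain ⟨E', hE'm, hE'E⟩ := hlevel n (CFSequence.measurable_incl n hE)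
    have : E ∩ K.toCF.cyl n (F K.r (n + 1)) = E' ∩ K.toCF.cyl n (F K.r (n + 1)) := by
      rw [← toCF_F, CFSequence.cyl_F]
      ext w
      constructor
      · rintro ⟨hw, x, rfl⟩
        exact ⟨(Set.ext_iff.1 hE'E x).2 hw, x, rfl⟩
      · rintro ⟨hw, x, rfl⟩
        exact ⟨(Set.ext_iff.1 hE'E x).1 hw, x, rfl⟩
    rw [this]
    exact hE'm.inter (hrange n)
  · rintro _ ⟨n, A, hA, rfl⟩
    exact measurable_cyl (subset_F_of_isUnionOfAtoms (by omega) hA)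
      (measurableSet_of_isUnionOfAtoms (by omega) hA)

end Construction

/-! ### Mixing -/

namespace CFSequence

variable {G : Type*} [Group G] {P : CFSequence G}

/-- `T_g` is the translation by `g` of the first coordinate, where this makes sense. -/
theorem T_incl_of_mem (g : G) {m : ℕ} (x : P.Level m) (h : g * x.1.1 ∈ P.F m) :
    P.T g (P.incl m x) = P.incl m (⟨g * x.1.1, h⟩, x.2) := by
  set x' : P.Level m := (⟨g * x.1.1, h⟩, x.2) with hx'
  have hfst : ∀ j, (shift j x').1.1 = g * (shift j x).1.1 := by
    intro j
    induction j with
    | zero => rfl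
    | succ j ih =>
      change (shift j x').1.1 * ((shift j x').2 _).1 = g * ((shift j x).1.1 * ((shift j x).2 _).1)
      rw [ih, shift_snd, shift_snd, mul_assoc]
  rw [← incl_shift (P.gapIndex g) x, ← incl_shift (P.gapIndex g) x',
    P.T_incl g (Nat.le_add_left _ _)]
  have h : P.step g (P.gapIndex_spec g (Nat.le_add_left _ _)) (shift (P.gapIndex g) x) =
      P.embed (shift (P.gapIndex g) x') := by
    refine Prod.ext (Subtype.ext ?_) (funext fun k => ?_)
    · simp only [step, embed, hfst, shift_snd]
      rfl
    · simp only [step, embed, shift_snd, hx']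
  rw [h]
  exact P.incl_embed _

end CFSequence

namespace Construction

open GG Cstr

variable {K : Construction}

theorem smul_incl_of_mem (g : GG) {m : ℕ} (x : K.toCF.Level m) (h : g * x.1.1 ∈ K.toCF.F m) :
    g • (K.toCF.incl m x : K.X) = K.toCF.incl m (⟨g * x.1.1, h⟩, x.2) :=
  CFSequence.T_incl_of_mem g x h

/-- The part of `F_{n+1}` moved out of `F_{n+1}` by a central element `z(k)`, `0 ≤ k < 2 ã_n`, is
small. -/
theorem dens_escape_le {n k : ℕ} (hk : k < 2 * aTilde K.r n) :
    K.dens (n + 1) {f | f ∈ F K.r (n + 1) ∧ z k * f ∉ F K.r (n + 1)} ≤ ratio K.r n := by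
  have hF : haar.real (F K.r (n + 1)) = 8 * (a K.r (n + 1) : ℝ) ^ 2 := haar_real_box _
  have hpos : (0 : ℝ) < aTilde K.r n := by exact_mod_cast aTilde_pos K.r n
  have hR : (0 : ℝ) < 2 * K.r n + 1 := by positivity
  have ha : (0 : ℝ) < a K.r (n + 1) := by rw [a_succ]; positivity
  have hsub : {f | f ∈ F K.r (n + 1) ∧ z k * f ∉ F K.r (n + 1)} ⊆
      {p : GG | ((a K.r (n + 1) : ℤ) - k < p.k ∧ p.k ≤ a K.r (n + 1)) ∧
        (-(a K.r (n + 1) : ℝ) < p.t ∧ p.t ≤ a K.r (n + 1)) ∧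
        p.e ∈ (Finset.univ : Finset (ZMod 2))} := by
    rintro f ⟨⟨h1, h2, h3, h4⟩, hn⟩
    refine ⟨⟨?_, h2⟩, ⟨h3, h4⟩, Finset.mem_univ _⟩
    by_contra hc
    refine hn ?_
    rw [z_mul]
    exact ⟨by dsimp only; omega, by dsimp only; omega, h3, h4⟩
  have hle : haar.real {f | f ∈ F K.r (n + 1) ∧ z k * f ∉ F K.r (n + 1)} ≤
      4 * a K.r (n + 1) * k := by
    refine (measureReal_mono hsub ?_).trans_eq ?_
    · rw [haar_rect]
      exact ENNReal.mul_ne_top (by simp) (ENNReal.mul_ne_top (by simp) (by simp))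
    · rw [haar_real_rect (by omega) (by linarith)]
      simp [ZMod.card]
      ring
  have hk' : (k : ℝ) ≤ 2 * aTilde K.r n := by exact_mod_cast hk.le
  rw [dens, hF, div_le_iff₀ (by positivity)]
  calc _ ≤ 4 * (a K.r (n + 1) : ℝ) * k := hle
    _ ≤ 4 * (a K.r (n + 1) : ℝ) * (2 * aTilde K.r n) := by gcongr
    _ = 1 / (2 * K.r n + 1) * (8 * (a K.r (n + 1) : ℝ) ^ 2) := by
        rw [a_succ]; field_simp; ring
    _ ≤ ratio K.r n * (8 * (a K.r (n + 1) : ℝ) ^ 2) := by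
        unfold ratio
        gcongr
        have : (0 : ℝ) ≤ n := Nat.cast_nonneg n
        linarith

theorem aTilde_mono (r : ℕ → ℕ) : Monotone (aTilde r) := by
  refine monotone_nat_of_le_succ fun n => ?_
  rw [aTilde_succ]
  simp only [a]
  nlinarith [aTilde_pos r n]

theorem lt_aTilde (r : ℕ → ℕ) (n : ℕ) : n < aTilde r n := by
  induction n with
  | zero => exact aTilde_pos r 0
  | succ n ih =>
    rw [aTilde_succ]
    have : aTilde r n ≤ a r (n + 1) := by simp only [a]; nlinarith
    omega

theorem exists_scale (K : Construction) {N k : ℕ} (hk : 2 * aTilde K.r (N + 2) ≤ k) :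
    ∃ n, N ≤ n ∧ 2 * aTilde K.r (n + 2) ≤ k ∧ k < 2 * aTilde K.r (n + 3) := by
  classical
  have hex : ∃ m, k < 2 * aTilde K.r m := ⟨k, by have := lt_aTilde K.r k; omega⟩
  have h1 := Nat.find_spec hex
  have h2 : N + 2 < Nat.find hex := by
    by_contra hc
    have := aTilde_mono K.r (not_lt.1 hc)
    omega
  obtain ⟨n, hn⟩ : ∃ n, Nat.find hex = n + 3 := ⟨Nat.find hex - 3, by omega⟩
  refine ⟨n, by omega, ?_, by rwa [hn] at h1⟩
  have := Nat.find_min hex (m := n + 2) (by omega)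
  omega

theorem measurable_smul_X (g : GG) : Measurable fun x : K.X => g • x :=
  (measurePreserving_smul g).measurable

/-- For translations by positive elements of the center. -/
theorem eventually_correlation_le_nat {E E' : Set K.X} (hE : E ∈ K.atomCylinders)
    (hE' : E' ∈ K.atomCylinders) {ε : ℝ} (hε : 0 < ε) :
    ∀ᶠ k : ℕ in atTop,
      K.μ.real (((fun x : K.X => z k • x) ⁻¹' E) ∩ E') ≤ K.μ.real E * K.μ.real E' + ε := by
  obtain ⟨n₀, A₀, hA₀, rfl⟩ := hE
  obtain ⟨n₁, B₀, hB₀, rfl⟩ := hE'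
  set E := K.toCF.cyl n₀ A₀
  set E' := K.toCF.cyl n₁ B₀
  set e := K.μ.real E
  set e' := K.μ.real E'
  have he0 : 0 ≤ e := measureReal_nonneg
  have he'0 : 0 ≤ e' := measureReal_nonneg
  set M := fun n => K.μ.real (K.toCF.cyl n (F K.r (n + 1))) with hM
  have hlimM := tendsto_μ_real_cyl_F K
  have hdiv : Tendsto (fun n => e * e' / (M (n + 1) * M (n + 1))) atTop (𝓝 (e * e' / (1 * 1))) := by
    have h := hlimM.comp (tendsto_add_atTop_nat 1)
    exact tendsto_const_nhds.div (h.mul h) (by norm_num)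
  have ev1 := hdiv.eventually_le_const (show e * e' / (1 * 1) < e * e' + ε / 3 by
    rw [mul_one, div_one]; linarith)
  have ev2 := (hlimM.comp (tendsto_add_atTop_nat 1)).eventually_const_lt (zero_lt_one)
  have ev3 := ((tendsto_ratio K).comp (tendsto_add_atTop_nat 3)).eventually_le_const
    (show (0 : ℝ) < ε / 3 by positivity)
  obtain ⟨N, hN⟩ := eventually_atTop.1 (((eventually_translate_inter_le K
    (show 0 < ε / 3 by positivity)).and (ev1.and (ev2.and ev3))).and
      (eventually_ge_atTop (n₀ + n₁ + 1)))
  filter_upwards [eventually_ge_atTop (2 * aTilde K.r (N + 2))] with k hk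
  obtain ⟨n, hNn, hk1, hk2⟩ := exists_scale K hk
  obtain ⟨⟨g1, g2, g3, g4⟩, hn⟩ := hN n hNn
  obtain ⟨n', rfl⟩ : ∃ n', n = n' + 1 := ⟨n - 1, by omega⟩
  obtain ⟨A, hA, hEA⟩ := exists_cyl_eq hA₀ (show n₀ ≤ n' by omega)
  obtain ⟨B, hB, hEB⟩ := exists_cyl_eq hB₀ (show n₁ ≤ n' by omega)
  have key := g1 B A hB hA k hk1 hk2
  -- the same sets at the levels that occur in the estimate
  have levels : ∀ {Q : Set GG}, IsUnionOfAtoms (K.ξ (n' + 1)) Q → ∃ Q2 Q4,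
      Q2 = K.lift (n' + 1 + 1) (K.lift (n' + 1) Q) ∧
      Q4 = K.lift (n' + 1 + 3) (K.lift (n' + 1 + 2) Q2) ∧
      Q4 ⊆ F K.r (n' + 1 + 4) ∧ MeasurableSet Q4 ∧
      K.toCF.cyl n' Q = K.toCF.cyl (n' + 4) Q4 ∧
      K.μ.real (K.toCF.cyl n' Q) = K.dens (n' + 1 + 2) Q2 * M (n' + 2) := by
    intro Q hQ
    have q1 := isUnionOfAtoms_lift (by omega) hQ
    have q2 := isUnionOfAtoms_lift (by omega) q1
    have q3 := isUnionOfAtoms_lift (by omega) q2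
    have q4 := isUnionOfAtoms_lift (by omega) q3
    have c1 := cyl_succ_lift (subset_F_of_isUnionOfAtoms (by omega) hQ)
    have c2 := cyl_succ_lift (n := n' + 1) (subset_F_of_isUnionOfAtoms (by omega) q1)
    have c3 := cyl_succ_lift (n := n' + 2) (subset_F_of_isUnionOfAtoms (by omega) q2)
    have c4 := cyl_succ_lift (n := n' + 3) (subset_F_of_isUnionOfAtoms (by omega) q3)
    refine ⟨_, _, rfl, rfl, subset_F_of_isUnionOfAtoms (by omega) q4,
      measurableSet_of_isUnionOfAtoms (by omega) q4, c1.trans (c2.trans (c3.trans c4)), ?_⟩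
    rw [c1, c2]
    exact μ_real_cyl (n := n' + 2) (subset_F_of_isUnionOfAtoms (by omega) q2)
      (measurableSet_of_isUnionOfAtoms (by omega) q2)
  obtain ⟨A2, A4, hA2, hA4, fA4, mA4, cA, dA⟩ := levels hA
  obtain ⟨B2, B4, hB2, hB4, fB4, mB4, cB, dB⟩ := levels hB
  rw [← hA2, ← hB2, ← hA4, ← hB4] at key
  have hEA4 : E = K.toCF.cyl (n' + 4) A4 := hEA.trans cA
  have hEB4 : E' = K.toCF.cyl (n' + 4) B4 := hEB.trans cB
  have heA : e = K.dens (n' + 1 + 2) A2 * M (n' + 2) := by rw [← dA, ← hEA]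
  have heB : e' = K.dens (n' + 1 + 2) B2 * M (n' + 2) := by rw [← dB, ← hEB]
  set d := K.dens (n' + 1 + 2) B2 * K.dens (n' + 1 + 2) A2 with hd
  have hd1 : d ≤ e * e' + ε / 3 := by
    have hM0 : 0 < M (n' + 2) := g3
    have : e * e' / (M (n' + 2) * M (n' + 2)) = d := by
      rw [heA, heB, hd]; field_simp
    rw [← this]
    exact g2
  -- points that leave the box, and points that stay in it
  set Q : Set GG := {f | f ∈ F K.r (n' + 1 + 4) ∧ z k * f ∉ F K.r (n' + 1 + 4)} with hQ
  set R : Set GG := {f | f ∈ B4 ∧ z k * f ∈ A4} with hR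
  have fR : R ⊆ F K.r (n' + 1 + 4) := fun f hf => fB4 hf.1
  have mR : MeasurableSet R := mB4.inter (measurable_const_mul (z k) mA4)
  have fQ : Q ⊆ F K.r (n' + 1 + 4) := fun f hf => hf.1
  have mQ : MeasurableSet Q := (measurableSet_F _ _).inter
    (measurable_const_mul (z k) (measurableSet_F K.r (n' + 1 + 4))).compl
  have hcover : ((fun x : K.X => z k • x) ⁻¹' E) ∩ E' ⊆
      K.toCF.cyl (n' + 4) R ∪ K.toCF.cyl (n' + 4) Q := by
    rintro w ⟨hw1, hw2⟩
    rw [hEB4] at hw2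
    obtain ⟨x, hx, rfl⟩ := hw2
    have hxF : x.1.1 ∈ F K.r (n' + 1 + 4) := x.1.2
    by_cases h : z k * x.1.1 ∈ F K.r (n' + 1 + 4)
    · left
      rw [Set.mem_preimage, hEA4, smul_incl_of_mem (z k) x h, CFSequence.incl_mem_cyl] at hw1
      exact CFSequence.incl_mem_cyl.2 ⟨hx, hw1⟩
    · right
      exact CFSequence.incl_mem_cyl.2 ⟨hxF, h⟩
  have hM1 : M (n' + 4) ≤ 1 := measureReal_le_one
  have hM0 : 0 ≤ M (n' + 4) := measureReal_nonneg
  have bR : K.μ.real (K.toCF.cyl (n' + 4) R) ≤ d + ε / 3 := by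
    have h1 : haar.real R = haar.real ((B4 * {z k}) ∩ A4) := by
      have hm := (measurableSet_mul_singleton mB4 (z k)).inter mA4
      rw [measureReal_def, measureReal_def, ← haar_left (z k) hm]
      congr 2
      ext f
      rw [Set.mem_preimage, Set.mem_inter_iff, mem_mul_singleton, z_comm, mul_inv_cancel_right,
        ← z_comm]
      rfl
    have h2 : K.dens (n' + 1 + 4) R ≤ d + ε / 3 := by
      rw [dens, h1, div_le_iff₀ (haar_real_F_pos (by omega))]
      exact key
    have h3 : K.μ.real (K.toCF.cyl (n' + 4) R) = K.dens (n' + 1 + 4) R * M (n' + 4) :=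
      μ_real_cyl (n := n' + 4) fR mR
    rw [h3]
    exact (mul_le_of_le_one_right (dens_nonneg _ _) hM1).trans h2
  have bQ : K.μ.real (K.toCF.cyl (n' + 4) Q) ≤ ε / 3 := by
    have h3 : K.μ.real (K.toCF.cyl (n' + 4) Q) = K.dens (n' + 1 + 4) Q * M (n' + 4) :=
      μ_real_cyl (n := n' + 4) fQ mQ
    rw [h3]
    exact (mul_le_of_le_one_right (dens_nonneg _ _) hM1).trans ((dens_escape_le hk2).trans g4)
  calc _ ≤ K.μ.real (K.toCF.cyl (n' + 4) R ∪ K.toCF.cyl (n' + 4) Q) := measureReal_mono hcover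
    _ ≤ _ := measureReal_union_le _ _
    _ ≤ (d + ε / 3) + ε / 3 := add_le_add bR bQ
    _ ≤ e * e' + ε := by linarith

/-- Correlations of `E` and `E'` under the central elements. -/
noncomputable def corr (K : Construction) (E E' : Set K.X) (k : ℤ) : ℝ :=
  K.μ.real (((fun x : K.X => z k • x) ⁻¹' E) ∩ E')

/-- By invariance of the measure, the inverse translation amounts to an exchange of the two sets. -/
theorem corr_neg {E E' : Set K.X} (hE : MeasurableSet E) (hE' : MeasurableSet E') (k : ℤ) :
    K.corr E E' (-k) = K.corr E' E k := by
  have hm : MeasurableSet (((fun x : K.X => z (-k) • x) ⁻¹' E) ∩ E') :=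
    (measurable_smul_X _ hE).inter hE'
  have h := (measurePreserving_smul (K := K) (z k)).measureReal_preimage hm.nullMeasurableSet
  rw [corr, corr, ← h]
  congr 1
  ext x
  simp only [Set.mem_preimage, Set.mem_inter_iff, ← z_inv, inv_smul_smul]
  exact and_comm

theorem measurableSet_of_mem_atomCylinders {E : Set K.X} (hE : E ∈ K.atomCylinders) :
    MeasurableSet E := by
  obtain ⟨n, A, hA, rfl⟩ := hE
  exact measurable_cyl (subset_F_of_isUnionOfAtoms (by omega) hA)
    (measurableSet_of_isUnionOfAtoms (by omega) hA)

theorem eventually_corr_le {E E' : Set K.X} (hE : E ∈ K.atomCylinders)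
    (hE' : E' ∈ K.atomCylinders) {ε : ℝ} (hε : 0 < ε) :
    ∀ᶠ k in cofinite, K.corr E E' k ≤ K.μ.real E * K.μ.real E' + ε := by
  rw [Int.cofinite_eq, eventually_sup]
  obtain ⟨N, hN⟩ := eventually_atTop.1 (eventually_correlation_le_nat hE hE' hε)
  obtain ⟨N', hN'⟩ := eventually_atTop.1 (eventually_correlation_le_nat hE' hE hε)
  constructor
  · filter_upwards [eventually_le_atBot (-(N' : ℤ))] with k hk
    obtain ⟨j, rfl⟩ : ∃ j : ℕ, k = -(j : ℤ) := ⟨k.natAbs, by omega⟩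
    rw [corr_neg (measurableSet_of_mem_atomCylinders hE) (measurableSet_of_mem_atomCylinders hE'),
      mul_comm]
    exact hN' j (by omega)
  · filter_upwards [eventually_ge_atTop (N : ℤ)] with k hk
    obtain ⟨j, rfl⟩ := Int.eq_ofNat_of_zero_le (show 0 ≤ k by omega)
    exact hN j (by omega)

theorem corr_compl_right {E E' : Set K.X} (hE' : MeasurableSet E')
    (k : ℤ) : K.corr E E' k + K.corr E E'ᶜ k = K.μ.real ((fun x : K.X => z k • x) ⁻¹' E) :=
  measureReal_inter_add_sdiff hE'

theorem μ_real_smul_preimage {E : Set K.X} (hE : MeasurableSet E) (g : GG) :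
    K.μ.real ((fun x : K.X => g • x) ⁻¹' E) = K.μ.real E :=
  (measurePreserving_smul g).measureReal_preimage hE.nullMeasurableSet

/-- Cylinders are mixed: the lower bound follows from the upper bound, applied to the complement. -/
theorem tendsto_corr_atomCylinders {E E' : Set K.X} (hE : E ∈ K.atomCylinders)
    (hE' : E' ∈ K.atomCylinders) :
    Tendsto (K.corr E E') cofinite (𝓝 (K.μ.real E * K.μ.real E')) := by
  refine tendsto_order.2 ⟨fun c hc => ?_, fun c hc => ?_⟩
  · set η := (K.μ.real E * K.μ.real E' - c) / 3 with hη
    have hη0 : 0 < η := div_pos (sub_pos.2 hc) (by norm_num)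
    have mE := measurableSet_of_mem_atomCylinders hE
    have mE' := measurableSet_of_mem_atomCylinders hE'
    obtain ⟨n, B, hB, rfl⟩ := hE'
    obtain ⟨m, hm, hnm⟩ := (((tendsto_μ_real_cyl_F K).eventually_const_lt
      (show 1 - η < 1 by linarith)).and (eventually_ge_atTop n)).exists
    obtain ⟨B', hB', hBB'⟩ := exists_cyl_eq hB hnm
    rw [hBB'] at mE' hc hη ⊢
    set E'' := K.toCF.cyl m (F K.r (m + 1) \ B') with hE''
    set X' := K.toCF.cyl m (F K.r (m + 1)) with hX'
    have hXm : MeasurableSet X' := measurable_cyl subset_rfl (measurableSet_F _ _)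
    have hc'' : E'' ∈ K.atomCylinders := ⟨m, _, isUnionOfAtoms_F_sdiff (by omega) hB', rfl⟩
    filter_upwards [eventually_corr_le hE hc'' hη0] with k hk
    have h1 := corr_compl_right (E := E) mE' k
    rw [μ_real_smul_preimage mE] at h1
    have h2 : K.corr E (K.toCF.cyl m B')ᶜ k ≤ K.corr E E'' k + K.μ.real X'ᶜ := by
      refine (measureReal_mono ?_).trans (measureReal_union_le _ _)
      rintro x ⟨hx1, hx2⟩
      by_cases hx : x ∈ X'
      · left
        refine ⟨hx1, ?_⟩
        rw [hE'', ← CFSequence.cyl_sdiff]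
        exact ⟨hx, hx2⟩
      · exact Or.inr hx
    have h3 : K.μ.real X'ᶜ = 1 - K.μ.real X' := probReal_compl_eq_one_sub hXm
    have h4 : K.μ.real E'' ≤ 1 - K.μ.real (K.toCF.cyl m B') := by
      rw [← probReal_compl_eq_one_sub mE']
      refine measureReal_mono ?_
      rw [hE'', ← CFSequence.cyl_sdiff]
      exact fun x hx => hx.2
    have h5 := mul_le_mul_of_nonneg_left h4 (measureReal_nonneg (μ := K.μ) (s := E))
    linarith
  · filter_upwards [eventually_corr_le hE hE'
      (show 0 < (c - K.μ.real E * K.μ.real E') / 2 by linarith)] with k hk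
    linarith

theorem μ_real_iUnion {f : ℕ → Set K.X} (hd : Pairwise (Function.onFun Disjoint f))
    (hf : ∀ j, MeasurableSet (f j)) : K.μ.real (⋃ j, f j) = ∑' j, K.μ.real (f j) := by
  rw [measureReal_def, measure_iUnion hd hf, ENNReal.tsum_toReal_eq fun j => measure_ne_top _ _]
  rfl

theorem tendsto_measureReal_iUnion {ι : Type*} {l : Filter ι} {Q : ι → ℕ → Set K.X}
    {q : ℕ → ℝ} {bound : ℕ → ℝ} (hb : Summable bound) (hQ : ∀ i j, K.μ.real (Q i j) ≤ bound j)
    (hm : ∀ i j, MeasurableSet (Q i j)) (hd : ∀ i, Pairwise (Function.onFun Disjoint (Q i)))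
    (h : ∀ j, Tendsto (fun i => K.μ.real (Q i j)) l (𝓝 (q j))) :
    Tendsto (fun i => K.μ.real (⋃ j, Q i j)) l (𝓝 (∑' j, q j)) := by
  have : (fun i => K.μ.real (⋃ j, Q i j)) = fun i => ∑' j, K.μ.real (Q i j) := by
    funext i
    exact μ_real_iUnion (hd i) (hm i)
  rw [this]
  refine tendsto_tsum_of_dominated_convergence hb h (Eventually.of_forall fun i j => ?_)
  rw [Real.norm_of_nonneg measureReal_nonneg]
  exact hQ i j

theorem summable_μ_real {f : ℕ → Set K.X} (hf : ∀ j, MeasurableSet (f j))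
    (hd : Pairwise (Function.onFun Disjoint f)) : Summable fun j => K.μ.real (f j) :=
  ENNReal.summable_toReal (by rw [← measure_iUnion hd hf]; exact measure_ne_top _ _)

/-- Extension of the mixing property from cylinders to measurable sets, in the first argument. -/
theorem tendsto_corr_left {E' : Set K.X} (hE' : E' ∈ K.atomCylinders) {E : Set K.X}
    (hE : MeasurableSet E) :
    Tendsto (K.corr E E') cofinite (𝓝 (K.μ.real E * K.μ.real E')) := by
  have mE' := measurableSet_of_mem_atomCylinders hE'
  induction E, hE using MeasurableSpace.induction_on_inter (generateFrom_atomCylinders K)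
    (isPiSystem_atomCylinders K) with
  | empty =>
    have h : K.corr ∅ E' = fun _ => 0 := by funext k; simp [corr]
    rw [h, measureReal_empty, zero_mul]
    exact tendsto_const_nhds
  | basic E hE => exact tendsto_corr_atomCylinders hE hE'
  | compl E hE ih =>
    have h1 : K.corr Eᶜ E' = fun k => K.μ.real E' - K.corr E E' k := by
      funext k
      have := measureReal_inter_add_sdiff (μ := K.μ) (s := E')
        (measurable_smul_X (K := K) (z k) hE)
      rw [corr, corr, ← this, Set.inter_comm E', Set.preimage_compl,
        Set.sdiff_eq, Set.inter_comm E']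
      ring
    have h2 : K.μ.real Eᶜ * K.μ.real E' = K.μ.real E' - K.μ.real E * K.μ.real E' := by
      rw [probReal_compl_eq_one_sub hE]; ring
    rw [h1, h2]
    exact ih.const_sub _
  | iUnion f hd hf ih =>
    have hs := summable_μ_real hf hd
    rw [μ_real_iUnion hd hf, ← tsum_mul_right]
    have h1 : K.corr (⋃ i, f i) E' = fun k =>
        K.μ.real (⋃ j, ((fun x : K.X => z k • x) ⁻¹' f j) ∩ E') := by
      funext k
      rw [corr, Set.preimage_iUnion, Set.iUnion_inter]
    rw [h1]
    refine tendsto_measureReal_iUnion hs (fun k j => ?_)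
      (fun k j => (measurable_smul_X _ (hf j)).inter mE') (fun k i j hij => ?_) ih
    · rw [← μ_real_smul_preimage (hf j) (z k)]
      exact measureReal_mono Set.inter_subset_left
    · exact ((hd hij).preimage _).mono Set.inter_subset_left Set.inter_subset_left

theorem tendsto_corr {E E' : Set K.X} (hE : MeasurableSet E) (hE' : MeasurableSet E') :
    Tendsto (K.corr E E') cofinite (𝓝 (K.μ.real E * K.μ.real E')) := by
  induction E', hE' using MeasurableSpace.induction_on_inter (generateFrom_atomCylinders K)
    (isPiSystem_atomCylinders K) with
  | empty =>
    have h : K.corr E ∅ = fun _ => 0 := by funext k; simp [corr]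
    rw [h, measureReal_empty, mul_zero]
    exact tendsto_const_nhds
  | basic E' hE' => exact tendsto_corr_left hE' hE
  | compl E' hE' ih =>
    have h1 : K.corr E E'ᶜ = fun k => K.μ.real E - K.corr E E' k := by
      funext k
      rw [← μ_real_smul_preimage hE (z k), ← corr_compl_right hE' k]
      ring
    have h2 : K.μ.real E * K.μ.real E'ᶜ = K.μ.real E - K.μ.real E * K.μ.real E' := by
      rw [probReal_compl_eq_one_sub hE']; ring
    rw [h1, h2]
    exact ih.const_sub _
  | iUnion f hd hf ih =>
    have hs := summable_μ_real hf hd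
    rw [μ_real_iUnion hd hf, ← tsum_mul_left]
    have h1 : K.corr E (⋃ i, f i) = fun k =>
        K.μ.real (⋃ j, ((fun x : K.X => z k • x) ⁻¹' E) ∩ f j) := by
      funext k
      rw [corr, Set.inter_iUnion]
    rw [h1]
    refine tendsto_measureReal_iUnion hs (fun k j => measureReal_mono Set.inter_subset_right)
      (fun k j => (measurable_smul_X _ hE).inter (hf j)) (fun k i j hij => ?_) ih
    exact (hd hij).mono Set.inter_subset_right Set.inter_subset_right

theorem tendsto_measure_preimage_inter {A B : Set K.X} (hA : MeasurableSet A)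
    (hB : MeasurableSet B) {ι : Type*} {l : Filter ι} {k : ι → ℤ} (hk : Tendsto k l cofinite) :
    Tendsto (fun i => K.μ (((fun x : K.X => z (k i) • x) ⁻¹' A) ∩ B)) l (𝓝 (K.μ A * K.μ B)) := by
  rw [← ENNReal.tendsto_toReal_iff (fun i => measure_ne_top _ _)
    (ENNReal.mul_ne_top (measure_ne_top _ _) (measure_ne_top _ _)), ENNReal.toReal_mul]
  exact (tendsto_corr hA hB).comp hk

theorem iterate_smul_z_one (n : ℕ) :
    (fun x : K.X => z 1 • x)^[n] = fun x : K.X => z n • x := by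
  have h0 : z 0 = 1 := rfl
  induction n with
  | zero => funext x; simp [h0]
  | succ n ih =>
    rw [Function.iterate_succ', ih]
    funext x
    simp only [Function.comp_apply, smul_smul, ← z_add]
    congr 2
    push_cast
    ring

end Construction

theorem mainTheorem3 (K : Construction) :
    IsProbabilityMeasure K.μ ∧
    (∀ g : GG, MeasurePreserving (fun x : K.X => g • x) K.μ K.μ) ∧
    IsMixing (fun x : K.X => GG.z 1 • x) K.μ ∧
    (∀ k : ℕ → ℤ, Tendsto k atTop cofinite →
      ∀ A B : Set K.X, MeasurableSet A → MeasurableSet B →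
        Tendsto (fun n => K.μ ((fun x : K.X => GG.z (k n) • x) '' A ∩ B)) atTop
          (𝓝 (K.μ A * K.μ B))) := by
  refine ⟨inferInstance, Construction.measurePreserving_smul,
    ⟨Construction.measurePreserving_smul _, fun A B hA hB => ?_⟩, fun k hk A B hA hB => ?_⟩
  · simp only [Construction.iterate_smul_z_one]
    refine Construction.tendsto_measure_preimage_inter hA hB ?_
    rw [← Nat.cofinite_eq_atTop]
    exact Nat.cast_injective.tendsto_cofinite
  · have h : ∀ n, (fun x : K.X => GG.z (k n) • x) '' A =
        (fun x : K.X => GG.z (-k n) • x) ⁻¹' A := by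
      intro n
      rw [← GG.z_inv]
      exact (Set.preimage_smul_inv _ _).symm
    simp only [h]
    exact Construction.tendsto_measure_preimage_inter hA hB
      (neg_injective.tendsto_cofinite.comp hk)
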